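/- **Theorem (Coherence for autonomous multicategories).** *Signatures.* An autonomous signature $\mathcal A$ consists of a set of atoms and a multigraph (multiarrows $f : a_1,\dots,a_n \to b$) whose nodes are the types $a ::= o \mid (a_1\otimes\cdots\otimes a_k) \mid (a_1\otimes\cdots\otimes a_k)\multimap a$, with $o$ an atom and $k\in\mathbb N$. *Terms.* The autonomous resource terms over $\mathcal A$, typed à la Church and taken up to renaming of bound variables, are $$s,t ::= x \mid \lambda\langle x_1^{a_1},\dots,x_k^{a_k}\rangle s \mid s\,t \mid \langle s_1,\dots,s_k\rangle \mid s[x_1^{a_1},\dots,x_k^{a_k}:=t] \mid f(s_1,\dots,s_k),$$ where $\lambda$ and $[\vec x:=t]$ bind the $x_i$ in $s$. Typing is linear; contexts are lists of distinct typed variables, contexts that are merged are disjoint, and they are merged by a shuffle $\sigma$ (an interleaving that keeps the order inside each context): $x:a\vdash x:a$; if $\gamma_i\vdash s_i:a_i$ for $i\le k$ then $(\gamma_1,\dots,\gamma_k)\cdot\sigma\vdash\langle s_1,\dots,s_k\rangle:(a_1\otimes\cdots\otimes a_k)$, and $(\gamma_1,\dots,\gamma_k)\cdot\sigma\vdash f(s_1,\dots,s_k):b$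 for $f:a_1,\dots,a_k\to b$; if $\gamma,x_1:a_1,\dots,x_k:a_k\vdash s:b$ then $\gamma\vdash\lambda\langle\vec x^{\vec a}\rangle s:(a_1\otimes\cdots\otimes a_k)\multimap b$; if $\gamma\vdash s:\vec a\multimap b$ and $\delta\vdash t:\vec a$ then $(\gamma,\delta)\cdot\sigma\vdash st:b$; if $\gamma\vdash s:(a_1\otimes\cdots\otimes a_k)$ and $\delta_1,x_1:a_1,\dots,x_k:a_k,\delta_2\vdash t:b$ then $(\gamma,\delta_1,\delta_2)\cdot\sigma\vdash t[\vec x^{\vec a}:=s]:b$. Let $\Lambda_{\mathsf{aut}}(\mathcal A)(a_1,\dots,a_n;a)$ be the set of terms $s$ with $x_1:a_1,\dots,x_n:a_n\vdash s:a$. *Reduction.* Let $\mathtt C$ range over all one-hole contexts, $\mathtt L ::= [\cdot]\mid \mathtt L[\vec x:=t]$ over substitution contexts, $\mathtt E$ over the contexts in which the hole is not directly the argument $t$ of an explicit substitution $s[\vec x:=t]$, and $\mathtt D$ over those in which the hole is not directly the function $s$ of an application $st$. The reduction $\to_{\mathsf{aut}}$ is the union of $$\begin{aligned} \beta_1:&\quad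 s[x_1,\dots,x_k:=\mathtt L[\langle t_1,\dots,t_k\rangle]]\to\mathtt L[s\{\vec t/\vec x\}] &&\text{in all contexts } \mathtt C,\\ \beta_2:&\quad \mathtt L[\lambda\langle x_1,\dots,x_k\rangle s]\,(\mathtt L'[\langle t_1,\dots,t_k\rangle])\to\mathtt L[\mathtt L'[s\{\vec t/\vec x\}]] &&\text{in all contexts } \mathtt C,\\ \eta_1:&\quad s\to\langle\vec x\rangle[\vec x^{\vec a}:=s]\ \text{ if } s:(a_1\otimes\cdots\otimes a_k) \text{ and } s \text{ is not of the form } \mathtt L[\langle\vec t\rangle] &&\text{in contexts } \mathtt E,\\ \eta_2:&\quad s\to\lambda\langle\vec x^{\vec a}\rangle(s\langle\vec x\rangle)\ \text{ if } s:(a_1\otimes\cdots\otimes a_k)\multimap b \text{ and } s \text{ is not of the form } \mathtt L[\lambda\vec x\,t] &&\text{in contexts } \mathtt D, \end{aligned}$$ with $\vec x$ fresh in the $\eta$-rules and with the usual conventions that avoid capture. Structural equivalence $\equiv$ is the smallest congruence with $\mathtt C[s[\vec x:=t]]\equiv\mathtt C[s][\vec x:=t]$ whenever the $\vec x$ are not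 free in $\mathtt C$ and $\mathtt C$ does not bind variables of $t$. A term $m$ is a normal form of $s$ if $s\to_{\mathsf{aut}}^* m$ and no $\to_{\mathsf{aut}}$-step starts from $m$. *The free autonomous multicategory on $\mathcal A$* has the types as objects and the hom-sets $\Lambda_{\mathsf{aut}}(\mathcal A)(\gamma;a)/{\sim}$, where $\sim$ is the equivalence relation on $\Lambda_{\mathsf{aut}}(\mathcal A)(\gamma;a)$ generated by $\equiv$ and $\to_{\mathsf{aut}}$. *Claim.* For all $\gamma=(a_1,\dots,a_n)$ and $a$: 1. every $s\in\Lambda_{\mathsf{aut}}(\mathcal A)(\gamma;a)$ has a normal form; all its normal forms lie in $\Lambda_{\mathsf{aut}}(\mathcal A)(\gamma;a)$, and any two of them are structurally equivalent, so that $\mathrm{NF}(s)$ is well defined up to $\equiv$; 2. for all $s,s'\in\Lambda_{\mathsf{aut}}(\mathcal A)(\gamma;a)$, with normal forms $\mathrm{NF}(s)$ and $\mathrm{NF}(s')$, the morphisms $[s]$ and $[s']$ of the free autonomous multicategory are equal if and only if $\mathrm{NF}(s)\equiv\mathrm{NF}(s')$. -/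

import Mathlib

universe u v

namespace ResourceCalculus

/-- Objects over a set of atoms: `a ::= o | (a₁ ⊗ ⋯ ⊗ aₖ) | (a₁ ⊗ ⋯ ⊗ aₖ) ⊸ a`, with `k ∈ ℕ`. -/
inductive Ty (At : Type u) : Type u
  | atom (o : At) : Ty At
  | tensor {k : ℕ} (as : Fin k → Ty At) : Ty At
  | lolli {k : ℕ} (as : Fin k → Ty At) (b : Ty At) : Ty At

/-- An autonomous signature: a set of atoms, and a multigraph whose nodes are the objects
generated by the atoms. `Arr as b` is the collection of multiarrows `a₁, …, aₙ → b`. -/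
structure AutSig where
  Atom : Type u
  Arr : {n : ℕ} → (Fin n → Ty Atom) → Ty Atom → Type v

/-- The nodes of the signature (the types of the calculus). -/
abbrev AutSig.Ob (A : AutSig.{u, v}) : Type u := Ty A.Atom

/-- Autonomous resource terms
`s, t ::= x | λ⟨x₁^a₁, …, xₖ^aₖ⟩ s | s t | ⟨s₁, …, sₖ⟩ | s[x₁^a₁, …, xₖ^aₖ := t] | f(s₁, …, sₖ)`,
up to renaming of bound variables. Variables are de Bruijn indices: under a binder
of `k` variables `x₁, …, xₖ`, the index `i < k` is `xᵢ₊₁` and the index `k + j` is the variable that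
is called `j` outside of the binder. Terms are typed à la Church: a variable carries its type.
In `sub as s t`, that is `s[x₁^a₁, …, xₖ^aₖ := t]`, the `k` variables are bound in `s` only. -/
inductive Term (A : AutSig.{u, v}) : Type (max u v)
  | var (x : ℕ) (a : A.Ob) : Term A
  | lam {k : ℕ} (as : Fin k → A.Ob) (s : Term A) : Term A
  | app (s t : Term A) : Term A
  | tup {k : ℕ} (ts : Fin k → Term A) : Term A
  | sub {k : ℕ} (as : Fin k → A.Ob) (s t : Term A) : Term A
  | op {n : ℕ} {as : Fin n → A.Ob} {b : A.Ob} (f : A.Arr as b) (ts : Fin n → Term A) : Term A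

/-- The renaming `ρ` under a binder of `k` variables. -/
def liftRen (k : ℕ) (ρ : ℕ → ℕ) : ℕ → ℕ :=
  fun x => if x < k then x else ρ (x - k) + k

namespace Term

variable {A : AutSig.{u, v}}

/-- Renaming of free variables. -/
def rename : (ℕ → ℕ) → Term A → Term A
  | ρ, var x a => var (ρ x) a
  | ρ, lam (k := k) as s => lam as (rename (liftRen k ρ) s)
  | ρ, app s t => app (rename ρ s) (rename ρ t)
  | ρ, tup ts => tup fun i => rename ρ (ts i)
  | ρ, sub (k := k) as s t => sub as (rename (liftRen k ρ) s) (rename ρ t)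
  | ρ, op f ts => op f fun i => rename ρ (ts i)

/-- Weakening: `s`, seen under `d` additional binders. -/
def shift (d : ℕ) (s : Term A) : Term A := s.rename (· + d)

/-- The substitution `σ` under a binder of `k` variables. -/
def liftSub (k : ℕ) (σ : ℕ → A.Ob → Term A) : ℕ → A.Ob → Term A :=
  fun x a => if x < k then var x a else (σ (x - k) a).shift k

/-- Capture-avoiding parallel substitution: the variable `x` of type `a` is replaced by `σ x a`. -/
def subst : (ℕ → A.Ob → Term A) → Term A → Term A
  | σ, var x a => σ x a
  | σ, lam (k := k) as s => lam as (subst (liftSub k σ) s)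
  | σ, app s t => app (subst σ s) (subst σ t)
  | σ, tup ts => tup fun i => subst σ (ts i)
  | σ, sub (k := k) as s t => sub as (subst (liftSub k σ) s) (subst σ t)
  | σ, op f ts => op f fun i => subst σ (ts i)

/-- The substitution `{t₁, …, tₖ / x₁, …, xₖ}` on a term under a binder of `x₁, …, xₖ`, where the
`tᵢ`, and the result, stand under `d` binders that the substituted term does not see. -/
def inst {k : ℕ} (ts : Fin k → Term A) (d : ℕ) : ℕ → A.Ob → Term A :=
  fun x a => if h : x < k then ts ⟨x, h⟩ else var (x - k + d) a

/-- The list `⟨x₁, …, xₖ⟩` of the `k` innermost bound variables. -/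
def boundTuple {k : ℕ} (as : Fin k → A.Ob) : Term A := tup fun i => var i (as i)

end Term

/-! ### Typing -/

/-- Typing contexts `x₁ : a₁, …, xₙ : aₙ`. -/
abbrev Cxt (A : AutSig.{u, v}) : Type u := List (ℕ × A.Ob)

/-- `γ = (γ₁, …, γₖ) · σ` for a shuffle `σ ∈ shu(γ₁, …, γₖ)`: a bijection between the disjoint union
of the positions of the `γᵢ` and the positions of `γ` that is monotone on each `γᵢ`. -/
def IsShuffle {α : Type*} {k : ℕ} (γs : Fin k → List α) (γ : List α) : Prop :=
  ∃ σ : (Σ i : Fin k, Fin (γs i).length) ≃ Fin γ.length,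
    (∀ i, Monotone fun j : Fin (γs i).length => σ ⟨i, j⟩) ∧
    ∀ p : Σ i : Fin k, Fin (γs i).length, γ.get (σ p) = (γs p.1).get p.2

namespace Cxt

variable {A : AutSig.{u, v}}

/-- The variables of the context are pairwise distinct. -/
def Distinct (γ : Cxt A) : Prop := (γ.map Prod.fst).Nodup

/-- The context `γ` of a binder of `k` variables, seen from under this binder. -/
def shift (k : ℕ) (γ : Cxt A) : Cxt A := γ.map fun p => (p.1 + k, p.2)

/-- The context `x₁ : a₁, …, xₖ : aₖ`, where `xᵢ₊₁` is the index `i`. -/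
def ofTypes {k : ℕ} (as : Fin k → A.Ob) : Cxt A := List.ofFn fun i => ((i : ℕ), as i)

end Cxt

/-- The typing judgement `γ ⊢ s : a`. In a rule with several contexts these are disjoint,
which is to say that their shuffle has pairwise distinct variables. -/
inductive HasType {A : AutSig.{u, v}} : Cxt A → Term A → A.Ob → Prop
  | var (x : ℕ) (a : A.Ob) : HasType [(x, a)] (.var x a) a
  | op {n : ℕ} {as : Fin n → A.Ob} {b : A.Ob} (f : A.Arr as b) {ts : Fin n → Term A}
      {γs : Fin n → Cxt A} {γ : Cxt A} (hts : ∀ i, HasType (γs i) (ts i) (as i))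
      (hγ : IsShuffle γs γ) (hd : γ.Distinct) : HasType γ (.op f ts) b
  | tup {k : ℕ} {as : Fin k → A.Ob} {ts : Fin k → Term A} {γs : Fin k → Cxt A} {γ : Cxt A}
      (hts : ∀ i, HasType (γs i) (ts i) (as i))
      (hγ : IsShuffle γs γ) (hd : γ.Distinct) : HasType γ (.tup ts) (.tensor as)
  | lam {k : ℕ} {as : Fin k → A.Ob} {b : A.Ob} {s : Term A} {γ : Cxt A}
      (hs : HasType (γ.shift k ++ Cxt.ofTypes as) s b) : HasType γ (.lam as s) (.lolli as b)
  | app {k : ℕ} {as : Fin k → A.Ob} {b : A.Ob} {s t : Term A} {γ δ ε : Cxt A}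
      (hs : HasType γ s (.lolli as b)) (ht : HasType δ t (.tensor as))
      (hε : IsShuffle ![γ, δ] ε) (hd : ε.Distinct) : HasType ε (.app s t) b
  | sub {k : ℕ} {as : Fin k → A.Ob} {b : A.Ob} {s t : Term A} {γ δ₁ δ₂ ε : Cxt A}
      (hs : HasType γ s (.tensor as))
      (ht : HasType (δ₁.shift k ++ Cxt.ofTypes as ++ δ₂.shift k) t b)
      (hε : IsShuffle ![γ, δ₁, δ₂] ε) (hd : ε.Distinct) : HasType ε (.sub as t s) b

/-! ### Contexts with one hole -/

/-- `C ::= [·] | ⟨s₁, …, C, …, sₖ⟩ | C[x⃗ := t] | s[x⃗ := C] | C s | s C | λx⃗ C | f(s₁, …, C, …, sₙ)`.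
In `tup ts i C` and `op f ts i C` the context `C` takes the place of the `i`-th entry of `ts`. -/
inductive Ctx (A : AutSig.{u, v}) : Type (max u v)
  | hole : Ctx A
  | tup {k : ℕ} (ts : Fin k → Term A) (i : Fin k) (C : Ctx A) : Ctx A
  | subBody {k : ℕ} (as : Fin k → A.Ob) (C : Ctx A) (t : Term A) : Ctx A
  | subArg {k : ℕ} (as : Fin k → A.Ob) (s : Term A) (C : Ctx A) : Ctx A
  | appFun (C : Ctx A) (t : Term A) : Ctx A
  | appArg (s : Term A) (C : Ctx A) : Ctx A
  | lam {k : ℕ} (as : Fin k → A.Ob) (C : Ctx A) : Ctx A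
  | op {n : ℕ} {as : Fin n → A.Ob} {b : A.Ob} (f : A.Arr as b) (ts : Fin n → Term A) (i : Fin n)
      (C : Ctx A) : Ctx A

namespace Ctx

variable {A : AutSig.{u, v}}

/-- `C[s]`, the capture-allowing substitution of the hole by `s`. -/
def plug : Ctx A → Term A → Term A
  | hole, s => s
  | tup ts i C, s => .tup (Function.update ts i (C.plug s))
  | subBody as C t, s => .sub as (C.plug s) t
  | subArg as r C, s => .sub as r (C.plug s)
  | appFun C t, s => .app (C.plug s) t
  | appArg r C, s => .app r (C.plug s)
  | lam as C, s => .lam as (C.plug s)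
  | op f ts i C, s => .op f (Function.update ts i (C.plug s))

/-- The number of variables that `C` binds at its hole. -/
def depth : Ctx A → ℕ
  | hole => 0
  | tup _ _ C => C.depth
  | subBody (k := k) _ C _ => C.depth + k
  | subArg _ _ C => C.depth
  | appFun C _ => C.depth
  | appArg _ C => C.depth
  | lam (k := k) _ C => C.depth + k
  | op _ _ _ C => C.depth

/-- Renaming of the free variables of a context. -/
def rename : (ℕ → ℕ) → Ctx A → Ctx A
  | _, hole => hole
  | ρ, tup ts i C => tup (fun j => (ts j).rename ρ) i (rename ρ C)
  | ρ, subBody (k := k) as C t => subBody as (rename (liftRen k ρ) C) (t.rename ρ)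
  | ρ, subArg (k := k) as s C => subArg as (s.rename (liftRen k ρ)) (rename ρ C)
  | ρ, appFun C t => appFun (rename ρ C) (t.rename ρ)
  | ρ, appArg s C => appArg (s.rename ρ) (rename ρ C)
  | ρ, lam (k := k) as C => lam as (rename (liftRen k ρ) C)
  | ρ, op f ts i C => op f (fun j => (ts j).rename ρ) i (rename ρ C)

/-- Weakening: `C`, seen under `d` additional binders. -/
def shift (d : ℕ) (C : Ctx A) : Ctx A := C.rename (· + d)

/-- Substitution contexts `L ::= [·] | L[x⃗ := t]`. -/
def IsL : Ctx A → Prop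
  | hole => True
  | subBody _ C _ => C.IsL
  | _ => False

/-- Contexts `E`: all contexts, except that in `s[x⃗ := E]` one requires `E ≠ [·]`. -/
def IsE : Ctx A → Prop
  | hole => True
  | tup _ _ C => C.IsE
  | subBody _ C _ => C.IsE
  | subArg _ _ C => C ≠ hole ∧ C.IsE
  | appFun C _ => C.IsE
  | appArg _ C => C.IsE
  | lam _ C => C.IsE
  | op _ _ _ C => C.IsE

/-- Contexts `D`: all contexts, except that in `D t` one requires `D ≠ [·]`. -/
def IsD : Ctx A → Prop
  | hole => True
  | tup _ _ C => C.IsD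
  | subBody _ C _ => C.IsD
  | subArg _ _ C => C.IsD
  | appFun C _ => C ≠ hole ∧ C.IsD
  | appArg _ C => C.IsD
  | lam _ C => C.IsD
  | op _ _ _ C => C.IsD

end Ctx

/-! ### Reduction -/

section Reduction

variable {A : AutSig.{u, v}}

/-- The set `LT` of terms `L[⟨s₁, …, sₖ⟩]`. -/
def IsLT (s : Term A) : Prop :=
  ∃ (L : Ctx A) (k : ℕ) (ts : Fin k → Term A), L.IsL ∧ s = L.plug (.tup ts)

/-- The set `AT` of terms `L[λx⃗ t]`. -/
def IsAT (s : Term A) : Prop :=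
  ∃ (L : Ctx A) (k : ℕ) (as : Fin k → A.Ob) (t : Term A), L.IsL ∧ s = L.plug (.lam as t)

/-- `s[x₁, …, xₖ := L[⟨t₁, …, tₖ⟩]] → L[s{t₁, …, tₖ / x₁, …, xₖ}]`. -/
inductive Beta1Root : Term A → Term A → Prop
  | mk {k : ℕ} (as : Fin k → A.Ob) (s : Term A) (L : Ctx A) (hL : L.IsL) (ts : Fin k → Term A) :
      Beta1Root (.sub as s (L.plug (.tup ts))) (L.plug (s.subst (Term.inst ts L.depth)))

/-- `L[λ⟨x₁, …, xₖ⟩ s] (L'[⟨t₁, …, tₖ⟩]) → L[L'[s{t₁, …, tₖ / x₁, …, xₖ}]]`, where `L` does not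
capture variables of `L'` and of the `tᵢ`, and `L'` does not capture variables of `s`. -/
inductive Beta2Root : Term A → Term A → Prop
  | mk {k : ℕ} (as : Fin k → A.Ob) (s : Term A) (L L' : Ctx A) (hL : L.IsL) (hL' : L'.IsL)
      (ts : Fin k → Term A) :
      Beta2Root (.app (L.plug (.lam as s)) (L'.plug (.tup ts)))
        (L.plug ((L'.shift L.depth).plug (s.subst
          (Term.inst (fun i => (ts i).rename (liftRen L'.depth (· + L.depth))) L'.depth))))

/-- `s → x⃗[x⃗ := s]` for `γ ⊢ s : (a₁ ⊗ ⋯ ⊗ aₖ)` and `s ∉ LT`. -/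
inductive Eta1Root : Term A → Term A → Prop
  | mk {k : ℕ} (as : Fin k → A.Ob) (s : Term A) (γ : Cxt A) (hs : HasType γ s (.tensor as))
      (hLT : ¬ IsLT s) : Eta1Root s (.sub as (Term.boundTuple as) s)

/-- `s → λx⃗ (s x⃗)` for `γ ⊢ s : (a₁ ⊗ ⋯ ⊗ aₖ) ⊸ b` and `s ∉ AT`. -/
inductive Eta2Root : Term A → Term A → Prop
  | mk {k : ℕ} (as : Fin k → A.Ob) (b : A.Ob) (s : Term A) (γ : Cxt A)
      (hs : HasType γ s (.lolli as b)) (hAT : ¬ IsAT s) :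
      Eta2Root s (.lam as (.app (s.shift k) (Term.boundTuple as)))

/-- The reduction `→_aut`: `β₁` and `β₂` in all contexts, `η₁` in the contexts `E` and `η₂` in the
contexts `D`. -/
inductive Step : Term A → Term A → Prop
  | beta1 (C : Ctx A) {s s' : Term A} (h : Beta1Root s s') : Step (C.plug s) (C.plug s')
  | beta2 (C : Ctx A) {s s' : Term A} (h : Beta2Root s s') : Step (C.plug s) (C.plug s')
  | eta1 (E : Ctx A) (hE : E.IsE) {s s' : Term A} (h : Eta1Root s s') : Step (E.plug s) (E.plug s')
  | eta2 (D : Ctx A) (hD : D.IsD) {s s' : Term A} (h : Eta2Root s s') : Step (D.plug s) (D.plug s')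

/-- `m` is a normal form of `s`: `s` reduces to `m` in finitely many steps, and `m` is normal. -/
def IsNormalFormOf (m s : Term A) : Prop :=
  Relation.ReflTransGen Step s m ∧ ∀ m', ¬ Step m m'

/-- The renaming that exchanges the `k` innermost bound variables with the `d` next ones. -/
def swapRen (k d : ℕ) : ℕ → ℕ :=
  fun x => if x < k then x + d else if x < k + d then x - k else x

/-- Structural equivalence: the smallest congruence with `C[s[x⃗ := t]] ≡ C[s][x⃗ := t]`, where
`x⃗` is not free in `C` and `C` does not bind variables of `t`. -/
inductive StructEq : Term A → Term A → Prop
  | comm (C : Ctx A) {k : ℕ} (as : Fin k → A.Ob) (s t : Term A) :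
      StructEq (C.plug (.sub as s (t.shift C.depth)))
        (.sub as ((C.shift k).plug (s.rename (swapRen k C.depth))) t)
  | congr (C : Ctx A) {s t : Term A} (h : StructEq s t) : StructEq (C.plug s) (C.plug t)
  | refl (s : Term A) : StructEq s s
  | symm {s t : Term A} (h : StructEq s t) : StructEq t s
  | trans {s t r : Term A} (h : StructEq s t) (h' : StructEq t r) : StructEq s r

end Reduction

/-! ### The free autonomous multicategory -/

section Free

variable (A : AutSig.{u, v}) {n : ℕ}

/-- `Λ_aut(A)(a₁, …, aₙ; a)`: the terms `s` with `x₁ : a₁, …, xₙ : aₙ ⊢ s : a`. The names of the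
variables of the typing context do not matter; `xᵢ₊₁` is the index `i`. -/
def TermsIn (γ : Fin n → A.Ob) (a : A.Ob) : Type (max u v) :=
  {s : Term A // HasType (Cxt.ofTypes γ) s a}

/-- The generators of the equivalence `∼ = (≡ ∪ =_aut)` on `Λ_aut(A)(γ; a)`. -/
def FreeRel (γ : Fin n → A.Ob) (a : A.Ob) (s t : TermsIn A γ a) : Prop :=
  StructEq s.1 t.1 ∨ Step s.1 t.1

/-- The hom-set of the free autonomous multicategory on `A`, whose objects are the nodes of `A`:
`Λ_aut(A)(γ; a)` modulo the equivalence relation generated by `≡` and `→_aut`. -/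
def FreeHom (γ : Fin n → A.Ob) (a : A.Ob) : Type (max u v) := Quot (FreeRel A γ a)

variable {A}

/-- The morphism `[s]` of a term `s`. -/
def FreeHom.mk {γ : Fin n → A.Ob} {a : A.Ob} (s : TermsIn A γ a) : FreeHom A γ a :=
  Quot.mk (FreeRel A γ a) s

end Free

end ResourceCalculus

/-!
The theorem is proved by translating `→_aut`, which has restricted `η`-expansions, into
`β`-reduction modulo `≡`, which is confluent on linear terms.

*Encoding.* Linearity is a property of the multiset `fv s` of occurrences of free variables, and
`HasType γ s a` amounts to a typing `WT s a` without context, to `fv s = γ`, and to distinctness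
of the variables of `γ` (`HasType.wt`, `WT.hasType`). Structural equivalence is generated by the
permutations of an explicit substitution with a single term constructor (`SEq.structEq`,
`StructEq.seq`).

*Confluence.* Modulo `≡` the substitution contexts `L` inside redexes disappear, and `β`-reduction
is generated by `(λx⃗ s) t → s[x⃗ := t]` and `s[x⃗ := ⟨t⃗⟩] → s{t⃗/x⃗}` (`Red`). Contraction of
redexes commutes with the permutations that generate `≡`; here linearity enters, since a
substitution `s{t⃗/x⃗}` neither duplicates nor erases the explicit substitutions that `≡` moves in
and out of the `tᵢ` (`TupHead.psub_congr_right`). So complete developments are compatible with `≡`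
(`SEq.develop`) and monotone for reduction (`Red.develop`). Their iterates are therefore cofinal
among the reducts of a typed term, and typed terms are confluent (`Red.confluent`).

*Absorption of `η`.* Let `el s` be the term `s` with all variables and multiarrows fully
`η`-expanded. For every typed term, the full expansion of `el s` at its type has a common reduct
with `el s` (`WT.join_eta_el`), and `el` commutes with substitution up to `β` (`join_el_subst`).
Hence `el s` and `el s'` have a common reduct whenever `s ≡ s'` or `s →_aut s'` (`Step.join_el`),
and by confluence whenever `s` and `s'` represent the same morphism (`FreeHom.join_el`).

*Normal forms.* The normal forms of `→_aut` are the `η`-long terms without `β`-redexes modulo `≡`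
(`WT.normal_iff`). They exist: `η`-steps at variables, applications and multiarrows lead to an
`η`-long term (`WT.exists_long`), and `β`-steps preserve long terms and, by linearity, decrease
their size (`Long.exists_betaNF`). A long term has a common reduct with its expansion
(`Long.join`), so that two normal forms `m`, `m'` of terms with the same morphism have a common
reduct; being `β`-normal modulo `≡`, they are structurally equivalent (`Join.seq_of_betaNF`).
Conversely a term and its normal form represent the same morphism, because `→_aut` preserves
typing (`Step.wt`).
-/

namespace ResourceCalculus

namespace Term

variable {A : AutSig.{u, v}}

/-! ### Renaming and substitution -/

theorem liftRen_liftRen (k : ℕ) (ρ ρ' : ℕ → ℕ) (x : ℕ) :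
    liftRen k ρ' (liftRen k ρ x) = liftRen k (fun y => ρ' (ρ y)) x := by
  unfold liftRen
  split_ifs <;> first | rfl | omega | simp

theorem liftRen_lt {k x : ℕ} (ρ : ℕ → ℕ) (h : x < k) : liftRen k ρ x = x := if_pos h

theorem liftRen_add (k x : ℕ) (ρ : ℕ → ℕ) : liftRen k ρ (x + k) = ρ x + k := by
  simp [liftRen]

theorem liftSub_lt {k x : ℕ} (σ : ℕ → A.Ob → Term A) (a : A.Ob) (h : x < k) :
    liftSub k σ x a = var x a := if_pos h

theorem liftSub_add (k x : ℕ) (σ : ℕ → A.Ob → Term A) (a : A.Ob) :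
    liftSub k σ (x + k) a = (σ x a).shift k := by
  simp [liftSub]

theorem inst_lt {k x : ℕ} (ts : Fin k → Term A) (d : ℕ) (a : A.Ob) (h : x < k) :
    inst ts d x a = ts ⟨x, h⟩ := dif_pos h

theorem inst_add (k x : ℕ) (ts : Fin k → Term A) (d : ℕ) (a : A.Ob) :
    inst ts d (x + k) a = var (x + d) a := by
  simp [inst]

/-- Functions on indices are compared separately on the `k` bound variables and on the others. -/
theorem lt_or_eq_add (k x : ℕ) : x < k ∨ ∃ y, x = y + k := by
  rcases lt_or_ge x k with h | h
  · exact Or.inl h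
  · exact Or.inr ⟨x - k, by omega⟩

theorem rename_rename (s : Term A) (ρ ρ' : ℕ → ℕ) :
    (s.rename ρ).rename ρ' = s.rename fun x => ρ' (ρ x) := by
  induction s generalizing ρ ρ' with
  | var x a => rfl
  | lam as s ih => simp only [rename, ih, liftRen_liftRen]
  | app s t ihs iht => simp only [rename, ihs, iht]
  | tup ts ih => simp only [rename, ih]
  | sub as s t ihs iht => simp only [rename, ihs, iht, liftRen_liftRen]
  | op f ts ih => simp only [rename, ih]

theorem liftSub_var (k : ℕ) (ρ : ℕ → ℕ) :
    liftSub k (fun x a => (var (ρ x) a : Term A)) = fun x a => var (liftRen k ρ x) a := by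
  funext x a
  rcases lt_or_eq_add k x with h | ⟨y, rfl⟩
  · simp [liftSub_lt, liftRen_lt, h]
  · simp [liftSub_add, liftRen_add, shift, rename]

theorem rename_eq_subst (s : Term A) (ρ : ℕ → ℕ) :
    s.rename ρ = s.subst fun x a => var (ρ x) a := by
  induction s generalizing ρ with
  | var x a => rfl
  | lam as s ih => simp only [rename, subst, ih, liftSub_var]
  | app s t ihs iht => simp only [rename, subst, ihs, iht]
  | tup ts ih => simp only [rename, subst, ih]
  | sub as s t ihs iht => simp only [rename, subst, ihs, iht, liftSub_var]
  | op f ts ih => simp only [rename, subst, ih]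

theorem liftSub_liftRen (k : ℕ) (ρ : ℕ → ℕ) (σ : ℕ → A.Ob → Term A) :
    (fun x a => liftSub k σ (liftRen k ρ x) a) = liftSub k fun x a => σ (ρ x) a := by
  funext x a
  rcases lt_or_eq_add k x with h | ⟨y, rfl⟩
  · simp [liftSub_lt, liftRen_lt, h]
  · simp [liftSub_add, liftRen_add]

theorem subst_rename (s : Term A) (ρ : ℕ → ℕ) (σ : ℕ → A.Ob → Term A) :
    (s.rename ρ).subst σ = s.subst fun x a => σ (ρ x) a := by
  induction s generalizing ρ σ with
  | var x a => rfl
  | lam as s ih => simp only [rename, subst, ih, liftSub_liftRen]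
  | app s t ihs iht => simp only [rename, subst, ihs, iht]
  | tup ts ih => simp only [rename, subst, ih]
  | sub as s t ihs iht => simp only [rename, subst, ihs, iht, liftSub_liftRen]
  | op f ts ih => simp only [rename, subst, ih]

theorem liftSub_rename (k : ℕ) (ρ : ℕ → ℕ) (σ : ℕ → A.Ob → Term A) :
    (fun x a => (liftSub k σ x a).rename (liftRen k ρ)) =
      liftSub k fun x a => (σ x a).rename ρ := by
  funext x a
  rcases lt_or_eq_add k x with h | ⟨y, rfl⟩
  · simp [liftSub_lt, liftRen_lt, h, rename]
  · simp only [liftSub_add, shift, rename_rename, liftRen_add]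

theorem rename_subst (s : Term A) (ρ : ℕ → ℕ) (σ : ℕ → A.Ob → Term A) :
    (s.subst σ).rename ρ = s.subst fun x a => (σ x a).rename ρ := by
  induction s generalizing ρ σ with
  | var x a => rfl
  | lam as s ih => simp only [rename, subst, ih, liftSub_rename]
  | app s t ihs iht => simp only [rename, subst, ihs, iht]
  | tup ts ih => simp only [rename, subst, ih]
  | sub as s t ihs iht => simp only [rename, subst, ihs, iht, liftSub_rename]
  | op f ts ih => simp only [rename, subst, ih]

theorem liftSub_subst (k : ℕ) (σ τ : ℕ → A.Ob → Term A) :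
    (fun x a => (liftSub k σ x a).subst (liftSub k τ)) =
      liftSub k fun x a => (σ x a).subst τ := by
  funext x a
  rcases lt_or_eq_add k x with h | ⟨y, rfl⟩
  · simp [liftSub_lt, h, subst]
  · simp only [liftSub_add, shift, subst_rename, rename_subst]

theorem subst_subst (s : Term A) (σ τ : ℕ → A.Ob → Term A) :
    (s.subst σ).subst τ = s.subst fun x a => (σ x a).subst τ := by
  induction s generalizing σ τ with
  | var x a => rfl
  | lam as s ih => simp only [subst, ih, liftSub_subst]
  | app s t ihs iht => simp only [subst, ihs, iht]
  | tup ts ih => simp only [subst, ih]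
  | sub as s t ihs iht => simp only [subst, ihs, iht, liftSub_subst]
  | op f ts ih => simp only [subst, ih]

theorem liftRen_id (k : ℕ) : liftRen k (fun x => x) = fun x => x := by
  funext x
  rcases lt_or_eq_add k x with h | ⟨y, rfl⟩
  · simp [liftRen_lt, h]
  · simp [liftRen_add]

theorem rename_id (s : Term A) : s.rename (fun x => x) = s := by
  induction s with
  | var x a => rfl
  | lam as s ih => simp only [rename, liftRen_id, ih]
  | app s t ihs iht => simp only [rename, ihs, iht]
  | tup ts ih => simp only [rename, ih]
  | sub as s t ihs iht => simp only [rename, liftRen_id, ihs, iht]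
  | op f ts ih => simp only [rename, ih]

theorem subst_var (s : Term A) : s.subst (fun x a => var x a) = s := by
  rw [← rename_eq_subst s fun x => x, rename_id]

/-! ### Free variables -/

/-- The multiset of variables of `M` among the `k` innermost ones. -/
def low (k : ℕ) (M : Multiset (ℕ × A.Ob)) : Multiset (ℕ × A.Ob) :=
  M.bind fun p => if p.1 < k then {p} else 0

/-- The multiset of variables of `M` that are not among the `k` innermost ones, seen from outside
of the binder of these. -/
def down (k : ℕ) (M : Multiset (ℕ × A.Ob)) : Multiset (ℕ × A.Ob) :=
  M.bind fun p => if p.1 < k then 0 else {(p.1 - k, p.2)}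

/-- The multiset of occurrences of free variables. -/
def fv : Term A → Multiset (ℕ × A.Ob)
  | var x a => {(x, a)}
  | lam (k := k) _ s => down k (fv s)
  | app s t => fv s + fv t
  | tup ts => ∑ i, fv (ts i)
  | sub (k := k) _ s t => down k (fv s) + fv t
  | op _ ts => ∑ i, fv (ts i)

/-- The declaration of `x₁ : a₁, …, xₖ : aₖ`, as a multiset. -/
def bvs {k : ℕ} (as : Fin k → A.Ob) : Multiset (ℕ × A.Ob) := ∑ i : Fin k, {((i : ℕ), as i)}

theorem sum_bind {α β ι : Type*} (s : Finset ι) (M : ι → Multiset α) (f : α → Multiset β) :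
    (∑ i ∈ s, M i).bind f = ∑ i ∈ s, (M i).bind f := by
  classical
  induction s using Finset.induction_on with
  | empty => simp
  | insert i s hi ih => simp [Finset.sum_insert hi, ih, Multiset.add_bind]

theorem bind_bind_congr {α β γ δ : Type*} {M : Multiset α} {f : α → Multiset β}
    {g : β → Multiset γ} {f' : α → Multiset δ} {g' : δ → Multiset γ}
    (h : ∀ p ∈ M, (f p).bind g = (f' p).bind g') : (M.bind f).bind g = (M.bind f').bind g' := by
  rw [Multiset.bind_assoc, Multiset.bind_assoc]
  exact Multiset.bind_congr h

theorem bind_pure {α : Type*} {M : Multiset α} {f : α → Multiset α} (h : ∀ p ∈ M, f p = {p}) :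
    M.bind f = M := by
  rw [Multiset.bind_congr h, Multiset.bind_singleton, Multiset.map_id']

theorem low_add (k : ℕ) (M N : Multiset (ℕ × A.Ob)) : low k (M + N) = low k M + low k N :=
  Multiset.add_bind ..

theorem down_add (k : ℕ) (M N : Multiset (ℕ × A.Ob)) : down k (M + N) = down k M + down k N :=
  Multiset.add_bind ..

theorem low_sum {ι : Type*} (s : Finset ι) (k : ℕ) (M : ι → Multiset (ℕ × A.Ob)) :
    low k (∑ i ∈ s, M i) = ∑ i ∈ s, low k (M i) := sum_bind ..

theorem down_sum {ι : Type*} (s : Finset ι) (k : ℕ) (M : ι → Multiset (ℕ × A.Ob)) :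
    down k (∑ i ∈ s, M i) = ∑ i ∈ s, down k (M i) := sum_bind ..

theorem mem_low {k : ℕ} {M : Multiset (ℕ × A.Ob)} {p : ℕ × A.Ob} :
    p ∈ low k M ↔ p ∈ M ∧ p.1 < k := by
  unfold low
  simp only [Multiset.mem_bind]
  constructor
  · rintro ⟨q, hq, h⟩
    split_ifs at h with hk
    · rw [Multiset.mem_singleton] at h
      subst h
      exact ⟨hq, hk⟩
    · simp at h
  · rintro ⟨h, hk⟩
    exact ⟨p, h, by simp [hk]⟩

theorem mem_down {k : ℕ} {M : Multiset (ℕ × A.Ob)} {x : ℕ} {a : A.Ob} :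
    (x, a) ∈ down k M ↔ (x + k, a) ∈ M := by
  unfold down
  simp only [Multiset.mem_bind]
  constructor
  · rintro ⟨⟨y, b⟩, hq, h⟩
    split_ifs at h with hk
    · simp at h
    · simp only [Multiset.mem_singleton, Prod.mk.injEq] at h
      obtain ⟨rfl, rfl⟩ := h
      simp only at hk
      rwa [Nat.sub_add_cancel (by omega)]
  · intro h
    exact ⟨_, h, by simp⟩

theorem low_bvs {k : ℕ} (as : Fin k → A.Ob) : low k (bvs as) = bvs as :=
  bind_pure fun p hp => by
    simp only [bvs, Multiset.mem_sum, Multiset.mem_singleton] at hp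
    obtain ⟨i, -, rfl⟩ := hp
    simp

theorem down_bvs {k : ℕ} (as : Fin k → A.Ob) : down k (bvs as) = 0 := by
  rw [bvs, down_sum]
  exact Finset.sum_eq_zero fun i _ => by simp [down]

theorem mem_bvs {k : ℕ} {as : Fin k → A.Ob} {p : ℕ × A.Ob} :
    p ∈ bvs as ↔ ∃ h : p.1 < k, as ⟨p.1, h⟩ = p.2 := by
  simp only [bvs, Multiset.mem_sum, Multiset.mem_singleton, Finset.mem_univ, true_and]
  constructor
  · rintro ⟨i, rfl⟩
    exact ⟨i.2, rfl⟩
  · rintro ⟨h, h'⟩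
    exact ⟨⟨p.1, h⟩, by ext <;> simp [h']⟩

theorem coe_ofTypes {k : ℕ} (as : Fin k → A.Ob) :
    (Cxt.ofTypes as : Multiset (ℕ × A.Ob)) = bvs as := by
  have h := Multiset.sum_map_singleton (Finset.univ.val.map fun i : Fin k => ((i : ℕ), as i))
  rw [Multiset.map_map] at h
  exact (Fin.univ_val_map _).symm.trans h.symm

theorem fv_subst (s : Term A) (σ : ℕ → A.Ob → Term A) :
    fv (s.subst σ) = (fv s).bind fun p => fv (σ p.1 p.2) := by
  have key (k : ℕ) (s : Term A) (σ : ℕ → A.Ob → Term A)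
      (ih : ∀ σ, fv (s.subst σ) = (fv s).bind fun p => fv (σ p.1 p.2))
      (hsh : ∀ p ∈ down k (fv s), down k (fv ((σ p.1 p.2).shift k)) = fv (σ p.1 p.2)) :
      down k (fv (s.subst (liftSub k σ))) = (down k (fv s)).bind fun p => fv (σ p.1 p.2) := by
    rw [ih]
    refine bind_bind_congr fun p hp => ?_
    obtain ⟨x, a⟩ := p
    rcases lt_or_eq_add k x with h | ⟨y, rfl⟩
    · simp [liftSub_lt, h, fv]
    · simpa [liftSub_add] using! hsh (y, a) (mem_down.2 hp)
  have ren (s : Term A) : ∀ ρ : ℕ → ℕ, fv (s.rename ρ) = (fv s).bind fun p => {(ρ p.1, p.2)} := by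
    have aux (k : ℕ) (s : Term A) (ρ : ℕ → ℕ)
        (ih : ∀ ρ : ℕ → ℕ, fv (s.rename ρ) = (fv s).bind fun p => {(ρ p.1, p.2)}) :
        down k (fv (s.rename (liftRen k ρ))) = (down k (fv s)).bind fun p => {(ρ p.1, p.2)} := by
      rw [ih]
      refine bind_bind_congr fun p hp => ?_
      obtain ⟨x, a⟩ := p
      rcases lt_or_eq_add k x with h | ⟨y, rfl⟩
      · simp [liftRen_lt, h]
      · simp [liftRen_add]
    induction s with
    | var x a => intro ρ; simp [fv, rename]
    | lam as s ih => intro ρ; simp only [fv, rename]; exact aux _ _ _ ih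
    | app s t ihs iht => intro ρ; simp only [fv, rename, ihs, iht, Multiset.add_bind]
    | tup ts ih => intro ρ; simp only [fv, rename, ih, sum_bind]
    | sub as s t ihs iht =>
      intro ρ; simp only [fv, rename, iht, Multiset.add_bind, aux _ _ _ ihs]
    | op f ts ih => intro ρ; simp only [fv, rename, ih, sum_bind]
  have hsh (k : ℕ) (s : Term A) : down k (fv (s.shift k)) = fv s := by
    rw [shift, ren, down, Multiset.bind_assoc]
    exact bind_pure fun p _ => by simp
  induction s generalizing σ with
  | var x a => simp [fv, subst]
  | lam as s ih => simp only [fv, subst]; exact key _ _ _ ih fun _ _ => hsh _ _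
  | app s t ihs iht => simp only [fv, subst, ihs, iht, Multiset.add_bind]
  | tup ts ih => simp only [fv, subst, ih, sum_bind]
  | sub as s t ihs iht =>
    simp only [fv, subst, iht, Multiset.add_bind, key _ _ _ ihs fun _ _ => hsh _ _]
  | op f ts ih => simp only [fv, subst, ih, sum_bind]

theorem fv_rename (s : Term A) (ρ : ℕ → ℕ) :
    fv (s.rename ρ) = (fv s).bind fun p => {(ρ p.1, p.2)} := by
  rw [rename_eq_subst, fv_subst]
  rfl

theorem down_fv_shift (k : ℕ) (s : Term A) : down k (fv (s.shift k)) = fv s := by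
  rw [shift, fv_rename, down, Multiset.bind_assoc]
  exact bind_pure fun p _ => by simp

theorem low_fv_shift (k : ℕ) (s : Term A) : low k (fv (s.shift k)) = 0 := by
  rw [shift, fv_rename, low, Multiset.bind_assoc]
  simp

theorem low_fv_subst (k : ℕ) (s : Term A) (σ : ℕ → A.Ob → Term A) :
    low k (fv (s.subst (liftSub k σ))) = low k (fv s) := by
  rw [fv_subst, low, Multiset.bind_assoc]
  refine Multiset.bind_congr fun p _ => ?_
  obtain ⟨x, a⟩ := p
  rcases lt_or_eq_add k x with h | ⟨y, rfl⟩
  · simp [liftSub_lt, h, fv]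
  · simpa [liftSub_add] using! low_fv_shift k (σ y a)

theorem low_fv_rename (k : ℕ) (s : Term A) (ρ : ℕ → ℕ) :
    low k (fv (s.rename (liftRen k ρ))) = low k (fv s) := by
  rw [rename_eq_subst, ← liftSub_var, low_fv_subst]

theorem subst_congr {s : Term A} {σ τ : ℕ → A.Ob → Term A}
    (h : ∀ x a, (x, a) ∈ fv s → σ x a = τ x a) : s.subst σ = s.subst τ := by
  have key (k : ℕ) (s : Term A) (σ τ : ℕ → A.Ob → Term A)
      (h : ∀ x a, (x, a) ∈ down k (fv s) → σ x a = τ x a) :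
      ∀ x a, (x, a) ∈ fv s → liftSub k σ x a = liftSub k τ x a := by
    intro x a hx
    rcases lt_or_eq_add k x with hk | ⟨y, rfl⟩
    · simp [liftSub_lt, hk]
    · simp [liftSub_add, h y a (mem_down.2 hx)]
  induction s generalizing σ τ with
  | var x a => exact h x a (by simp [fv])
  | lam as s ih => exact congrArg (lam as) (ih (key _ _ _ _ h))
  | app s t ihs iht =>
    exact congrArg₂ app (ihs fun x a hx => h x a (Multiset.mem_add.2 (Or.inl hx)))
      (iht fun x a hx => h x a (Multiset.mem_add.2 (Or.inr hx)))
  | tup ts ih =>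
    exact congrArg tup (funext fun i => ih i fun x a hx =>
      h x a (Multiset.mem_sum.2 ⟨i, Finset.mem_univ i, hx⟩))
  | sub as s t ihs iht =>
    exact congrArg₂ (sub as)
      (ihs (key _ _ _ _ fun x a hx => h x a (Multiset.mem_add.2 (Or.inl hx))))
      (iht fun x a hx => h x a (Multiset.mem_add.2 (Or.inr hx)))
  | op f ts ih =>
    exact congrArg (op f) (funext fun i => ih i fun x a hx =>
      h x a (Multiset.mem_sum.2 ⟨i, Finset.mem_univ i, hx⟩))

end Term

/-! ### Typing without contexts -/

open Term

variable {A : AutSig.{u, v}}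

/-- The typing judgement without its context. The variables that a binder declares occur exactly
once in its scope; nothing is required of the free variables. -/
inductive WT : Term A → A.Ob → Prop
  | var (x : ℕ) (a : A.Ob) : WT (.var x a) a
  | op {n : ℕ} {as : Fin n → A.Ob} {b : A.Ob} (f : A.Arr as b) {ts : Fin n → Term A}
      (hts : ∀ i, WT (ts i) (as i)) : WT (.op f ts) b
  | tup {k : ℕ} {as : Fin k → A.Ob} {ts : Fin k → Term A}
      (hts : ∀ i, WT (ts i) (as i)) : WT (.tup ts) (.tensor as)
  | lam {k : ℕ} {as : Fin k → A.Ob} {b : A.Ob} {s : Term A}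
      (hs : WT s b) (hl : low k (fv s) = bvs as) : WT (.lam as s) (.lolli as b)
  | app {k : ℕ} {as : Fin k → A.Ob} {b : A.Ob} {s t : Term A}
      (hs : WT s (.lolli as b)) (ht : WT t (.tensor as)) : WT (.app s t) b
  | sub {k : ℕ} {as : Fin k → A.Ob} {b : A.Ob} {s t : Term A}
      (hs : WT s b) (hl : low k (fv s) = bvs as) (ht : WT t (.tensor as)) : WT (.sub as s t) b

theorem WT.unique {s : Term A} {a b : A.Ob} (h : WT s a) (h' : WT s b) : a = b := by
  induction h generalizing b with
  | var x a => cases h'; rfl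
  | op f hts ih => cases h'; rfl
  | tup hts ih =>
    cases h' with
    | tup hts' => exact congrArg _ (funext fun i => ih i (hts' i))
  | lam hs hl ih =>
    cases h' with
    | lam hs' hl' => rw [ih hs']
  | app hs ht ihs iht =>
    cases h' with
    | app hs' ht' => have := ihs hs'; cases this; rfl
  | sub hs hl ht ihs iht =>
    cases h' with
    | sub hs' hl' ht' => exact ihs hs'

theorem WT.rename {s : Term A} {a : A.Ob} (h : WT s a) (ρ : ℕ → ℕ) : WT (s.rename ρ) a := by
  induction h generalizing ρ with
  | var x a => exact .var _ _
  | op f hts ih => exact .op f fun i => ih i ρ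
  | tup hts ih => exact .tup fun i => ih i ρ
  | lam hs hl ih => exact .lam (ih _) (by rw [low_fv_rename, hl])
  | app hs ht ihs iht => exact .app (ihs ρ) (iht ρ)
  | sub hs hl ht ihs iht => exact .sub (ihs _) (by rw [low_fv_rename, hl]) (iht ρ)

theorem WT.of_rename {s : Term A} {a : A.Ob} {ρ : ℕ → ℕ} (h : WT (s.rename ρ) a) : WT s a := by
  induction s generalizing a ρ with
  | var x b => cases h; exact .var _ _
  | op f ts ih => cases h with | op _ hts => exact .op f fun i => ih i (hts i)
  | tup ts ih => cases h with | tup hts => exact .tup fun i => ih i (hts i)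
  | lam as s ih => cases h with | lam hs hl => exact .lam (ih hs) (by rwa [low_fv_rename] at hl)
  | app s t ihs iht => cases h with | app hs ht => exact .app (ihs hs) (iht ht)
  | sub as s t ihs iht =>
    cases h with | sub hs hl ht => exact .sub (ihs hs) (by rwa [low_fv_rename] at hl) (iht ht)

theorem WT.lift {k : ℕ} {s : Term A} {σ : ℕ → A.Ob → Term A}
    (hσ : ∀ x b, (x, b) ∈ down k (fv s) → WT (σ x b) b) :
    ∀ x b, (x, b) ∈ fv s → WT (liftSub k σ x b) b := by
  intro x b hx
  rcases lt_or_eq_add k x with hk | ⟨y, rfl⟩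
  · rw [liftSub_lt _ _ hk]; exact .var _ _
  · rw [liftSub_add]; exact (hσ y b (mem_down.2 hx)).rename _

theorem WT.subst {s : Term A} {a : A.Ob} (h : WT s a) {σ : ℕ → A.Ob → Term A}
    (hσ : ∀ x b, (x, b) ∈ fv s → WT (σ x b) b) : WT (s.subst σ) a := by
  induction h generalizing σ with
  | var x a => exact hσ x a (by simp [fv])
  | op f hts ih =>
    exact .op f fun i => ih i fun x b hx => hσ x b (Multiset.mem_sum.2 ⟨i, Finset.mem_univ i, hx⟩)
  | tup hts ih =>
    exact .tup fun i => ih i fun x b hx => hσ x b (Multiset.mem_sum.2 ⟨i, Finset.mem_univ i, hx⟩)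
  | lam hs hl ih => exact .lam (ih (WT.lift hσ)) (by rw [low_fv_subst, hl])
  | app hs ht ihs iht =>
    exact .app (ihs fun x b hx => hσ x b (Multiset.mem_add.2 (Or.inl hx)))
      (iht fun x b hx => hσ x b (Multiset.mem_add.2 (Or.inr hx)))
  | sub hs hl ht ihs iht =>
    exact .sub (ihs (WT.lift fun x b hx => hσ x b (Multiset.mem_add.2 (Or.inl hx))))
      (by rw [low_fv_subst, hl]) (iht fun x b hx => hσ x b (Multiset.mem_add.2 (Or.inr hx)))

theorem WT.subst_inst {k : ℕ} {as : Fin k → A.Ob} {s : Term A} {a : A.Ob} {ts : Fin k → Term A}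
    (hs : WT s a) (hl : low k (fv s) = bvs as) (hts : ∀ i, WT (ts i) (as i)) (d : ℕ) :
    WT (s.subst (inst ts d)) a := by
  refine hs.subst fun x b hx => ?_
  rcases lt_or_eq_add k x with hk | ⟨y, rfl⟩
  · have : (x, b) ∈ bvs as := hl ▸ mem_low.2 ⟨hx, hk⟩
    obtain ⟨h, hb⟩ := mem_bvs.1 this
    rw [inst_lt _ _ _ hk]
    have := hts ⟨x, hk⟩
    rwa [show as ⟨x, hk⟩ = b from hb] at this
  · rw [inst_add]
    exact .var _ _

theorem bind_low_down {β : Type*} (k : ℕ) (M : Multiset (ℕ × A.Ob))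
    (f : ℕ × A.Ob → Multiset β) :
    M.bind f = (low k M).bind f + (down k M).bind fun p => f (p.1 + k, p.2) := by
  rw [low, down, Multiset.bind_assoc, Multiset.bind_assoc, ← Multiset.bind_add]
  refine Multiset.bind_congr fun p _ => ?_
  obtain ⟨x, a⟩ := p
  rcases lt_or_eq_add k x with h | ⟨y, rfl⟩
  · simp [h]
  · simp

/-- Each of the substituted terms is used exactly once. -/
theorem fv_inst {k : ℕ} {as : Fin k → A.Ob} {s : Term A} (hl : low k (fv s) = bvs as)
    (ts : Fin k → Term A) (d : ℕ) : fv (s.subst (inst ts d)) =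
      (∑ i, fv (ts i)) + (down k (fv s)).bind fun p => {(p.1 + d, p.2)} := by
  rw [fv_subst, bind_low_down k, hl, bvs, sum_bind]
  congr 1
  · exact Finset.sum_congr rfl fun i _ => by simp [inst_lt]
  · exact Multiset.bind_congr fun p _ => by simp [inst_add, fv]

theorem fv_inst_zero {k : ℕ} {as : Fin k → A.Ob} {s : Term A} (hl : low k (fv s) = bvs as)
    (ts : Fin k → Term A) : fv (s.subst (inst ts 0)) = down k (fv s) + ∑ i, fv (ts i) := by
  rw [fv_inst hl, add_comm]
  congr 1
  exact bind_pure fun p _ => rfl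

/-! ### Updates of families -/

theorem comp_update' {ι α β : Type*} [DecidableEq ι] (f : α → β) (g : ι → α) (i : ι) (x : α) :
    (fun j => f (Function.update g i x j)) = Function.update (fun j => f (g j)) i (f x) :=
  Function.comp_update f g i x

theorem sum_update {ι α M : Type*} [Fintype ι] [DecidableEq ι] [AddCommMonoid M]
    (F : α → M) (g : ι → α) (i : ι) (x : α) :
    ∑ j, F (Function.update g i x j) = F x + ∑ j ∈ Finset.univ.erase i, F (g j) := by
  rw [← Finset.add_sum_erase _ _ (Finset.mem_univ i), Function.update_self]
  congr 1
  exact Finset.sum_congr rfl fun j hj => by rw [Function.update_of_ne (Finset.ne_of_mem_erase hj)]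

/-! ### Structural equivalence, one layer at a time -/

theorem swapRen_lt {k : ℕ} (d : ℕ) {x : ℕ} (h : x < k) : swapRen k d x = x + d := if_pos h

theorem swapRen_add_lt {k d x : ℕ} (h : x < d) : swapRen k d (x + k) = x := by
  simp [swapRen]; omega

theorem swapRen_add_add (k d x : ℕ) : swapRen k d (x + d + k) = x + d + k := by
  unfold swapRen
  split_ifs <;> omega

namespace Term

theorem rename_congr' {ρ ρ' : ℕ → ℕ} (h : ∀ x, ρ x = ρ' x) (s : Term A) :
    s.rename ρ = s.rename ρ' := by
  rw [funext h]

theorem subst_congr' {σ τ : ℕ → A.Ob → Term A} (h : ∀ x a, σ x a = τ x a) (s : Term A) :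
    s.subst σ = s.subst τ := subst_congr fun x a _ => h x a

theorem shift_subst (l : ℕ) (t : Term A) (σ : ℕ → A.Ob → Term A) :
    (t.shift l).subst (liftSub l σ) = (t.subst σ).shift l := by
  rw [shift, shift, subst_rename, rename_subst]
  exact subst_congr' (fun x a => liftSub_add ..) t

theorem swap_subst (k l : ℕ) (s : Term A) (σ : ℕ → A.Ob → Term A) :
    (s.rename (swapRen k l)).subst (liftSub l (liftSub k σ)) =
      (s.subst (liftSub k (liftSub l σ))).rename (swapRen k l) := by
  rw [subst_rename, rename_subst]
  refine subst_congr' (fun x a => ?_) s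
  rcases lt_or_eq_add k x with h | ⟨y, rfl⟩
  · rw [swapRen_lt l h, liftSub_add, liftSub_lt _ _ h, liftSub_lt _ _ h]
    simp [shift, rename, swapRen_lt l h]
  · rcases lt_or_eq_add l y with h | ⟨z, rfl⟩
    · rw [swapRen_add_lt h, liftSub_add, liftSub_lt _ _ h, liftSub_lt _ _ h]
      simp [shift, rename, swapRen_add_lt h]
    · rw [swapRen_add_add, liftSub_add, liftSub_add, add_right_comm, liftSub_add, liftSub_add]
      simp only [shift, rename_rename]
      refine rename_congr' (fun x => ?_) _
      rw [swapRen_add_add, add_right_comm]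

theorem liftShift_subst (l k : ℕ) (r : Term A) (σ : ℕ → A.Ob → Term A) :
    (r.rename (liftRen l (· + k))).subst (liftSub l (liftSub k σ)) =
      (r.subst (liftSub l σ)).rename (liftRen l (· + k)) := by
  rw [subst_rename, rename_subst]
  refine subst_congr' (fun x a => ?_) r
  rcases lt_or_eq_add l x with h | ⟨y, rfl⟩
  · simp [liftSub_lt, liftRen_lt, h, rename]
  · simp only [liftRen_add, liftSub_add, shift, rename_rename]

theorem swap_swap (k l x : ℕ) : swapRen l k (swapRen k l x) = x := by
  unfold swapRen
  split_ifs <;> omega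

theorem swapRen_zero (k : ℕ) : swapRen k 0 = fun x => x := by
  funext x
  unfold swapRen
  split_ifs <;> omega

theorem shift_add (d l : ℕ) (t : Term A) : t.shift (d + l) = (t.shift l).shift d := by
  simp only [shift, rename_rename]
  exact rename_congr' (fun x => by omega) t

theorem shift_zero (s : Term A) : s.shift 0 = s := rename_id s

theorem fv_rename_swap_low (k l : ℕ) (s : Term A) :
    low l (fv (s.rename (swapRen k l))) = low l (down k (fv s)) := by
  rw [fv_rename]
  refine bind_bind_congr fun p _ => ?_
  obtain ⟨x, a⟩ := p
  rcases lt_or_eq_add k x with h | ⟨y, rfl⟩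
  · simp [swapRen_lt l h, h]
  · rcases lt_or_eq_add l y with h | ⟨z, rfl⟩
    · simp [swapRen_add_lt h, h]
    · simp only [swapRen_add_add]
      simp
      omega

theorem fv_rename_swap_low_down (k l : ℕ) (s : Term A) :
    low k (down l (fv (s.rename (swapRen k l)))) = low k (fv s) := by
  rw [← fv_rename_swap_low l k (s.rename (swapRen k l)), rename_rename]
  simp only [swap_swap, rename_id]

theorem down_down_swap (k l : ℕ) (s : Term A) :
    down k (down l (fv (s.rename (swapRen k l)))) = down l (down k (fv s)) := by
  have dd (i j : ℕ) (M : Multiset (ℕ × A.Ob)) : down i (down j M) =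
      M.bind fun p => if p.1 < i + j then 0 else {(p.1 - (i + j), p.2)} := by
    rw [down, down, Multiset.bind_assoc]
    refine Multiset.bind_congr fun p _ => ?_
    obtain ⟨x, a⟩ := p
    by_cases h : x < j
    · simp [h, show x < i + j by omega]
    · by_cases h' : x < i + j
      · simp [h, h', show x - j < i by omega]
      · simp [h, h', show ¬ x - j < i by omega, show x - j - i = x - (i + j) by omega]
  rw [dd, dd, fv_rename, Multiset.bind_assoc]
  refine Multiset.bind_congr fun p _ => ?_
  obtain ⟨x, a⟩ := p
  rcases lt_or_eq_add k x with h | ⟨y, rfl⟩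
  · simp [swapRen_lt l h, show x < l + k by omega, show x + l < k + l by omega]
  · rcases lt_or_eq_add l y with h | ⟨z, rfl⟩
    · simp [swapRen_add_lt h, show y < k + l by omega, show y + k < l + k by omega]
    · simp [swapRen_add_add, add_comm l k, show ¬ z + l + k < k + l by omega]

theorem down_fv_rename_lift (l k : ℕ) (r : Term A) :
    down l (fv (r.rename (liftRen l (· + k)))) =
      (down l (fv r)).bind fun p => {(p.1 + k, p.2)} := by
  rw [fv_rename]
  refine bind_bind_congr fun p _ => ?_
  obtain ⟨x, a⟩ := p
  rcases lt_or_eq_add l x with h | ⟨y, rfl⟩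
  · simp [liftRen_lt, h]
  · simp [liftRen_add]

theorem low_down_fv_rename_lift (l k : ℕ) (r : Term A) :
    low k (down l (fv (r.rename (liftRen l (· + k))))) = 0 := by
  rw [down_fv_rename_lift, low, Multiset.bind_assoc]
  simp

theorem down_down_fv_rename_lift (l k : ℕ) (r : Term A) :
    down k (down l (fv (r.rename (liftRen l (· + k))))) = down l (fv r) := by
  rw [down_fv_rename_lift, down, Multiset.bind_assoc]
  exact bind_pure fun p _ => by simp

end Term

/-- Structural equivalence, generated by the permutations of an explicit substitution with one
term constructor. -/
inductive SEq : Term A → Term A → Prop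
  | refl (s : Term A) : SEq s s
  | symm {s t : Term A} (h : SEq s t) : SEq t s
  | trans {s t r : Term A} (h : SEq s t) (h' : SEq t r) : SEq s r
  | lam {k : ℕ} (as : Fin k → A.Ob) {s s' : Term A} (h : SEq s s') : SEq (.lam as s) (.lam as s')
  | app {s s' t t' : Term A} (h : SEq s s') (h' : SEq t t') : SEq (.app s t) (.app s' t')
  | tup {k : ℕ} {ts ts' : Fin k → Term A} (h : ∀ i, SEq (ts i) (ts' i)) : SEq (.tup ts) (.tup ts')
  | sub {k : ℕ} (as : Fin k → A.Ob) {s s' t t' : Term A} (h : SEq s s') (h' : SEq t t') :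
      SEq (.sub as s t) (.sub as s' t')
  | op {n : ℕ} {as : Fin n → A.Ob} {b : A.Ob} (f : A.Arr as b) {ts ts' : Fin n → Term A}
      (h : ∀ i, SEq (ts i) (ts' i)) : SEq (.op f ts) (.op f ts')
  | lam_sub {l k : ℕ} (bs : Fin l → A.Ob) (as : Fin k → A.Ob) (s t : Term A) :
      SEq (.lam bs (.sub as s (t.shift l))) (.sub as (.lam bs (s.rename (swapRen k l))) t)
  | app_sub {k : ℕ} (as : Fin k → A.Ob) (s t u : Term A) :
      SEq (.app (.sub as s t) u) (.sub as (.app s (u.shift k)) t)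
  | app_arg {k : ℕ} (as : Fin k → A.Ob) (u s t : Term A) :
      SEq (.app u (.sub as s t)) (.sub as (.app (u.shift k) s) t)
  | tup_sub {m k : ℕ} (ts : Fin m → Term A) (i : Fin m) (as : Fin k → A.Ob) (s t : Term A) :
      SEq (.tup (Function.update ts i (.sub as s t)))
        (.sub as (.tup (Function.update (fun j => (ts j).shift k) i s)) t)
  | op_sub {m k : ℕ} {cs : Fin m → A.Ob} {b : A.Ob} (f : A.Arr cs b) (ts : Fin m → Term A)
      (i : Fin m) (as : Fin k → A.Ob) (s t : Term A) :
      SEq (.op f (Function.update ts i (.sub as s t)))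
        (.sub as (.op f (Function.update (fun j => (ts j).shift k) i s)) t)
  | sub_body {l k : ℕ} (bs : Fin l → A.Ob) (as : Fin k → A.Ob) (s t u : Term A) :
      SEq (.sub bs (.sub as s (t.shift l)) u)
        (.sub as (.sub bs (s.rename (swapRen k l)) (u.shift k)) t)
  | sub_arg {l k : ℕ} (bs : Fin l → A.Ob) (as : Fin k → A.Ob) (r s t : Term A) :
      SEq (.sub bs r (.sub as s t)) (.sub as (.sub bs (r.rename (liftRen l (· + k))) s) t)

theorem SEq.of_eq {s t : Term A} (h : s = t) : SEq s t := h ▸ .refl s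

theorem SEq.subst {s s' : Term A} (h : SEq s s') (σ : ℕ → A.Ob → Term A) :
    SEq (s.subst σ) (s'.subst σ) := by
  induction h generalizing σ with
  | refl s => exact .refl _
  | symm h ih => exact (ih σ).symm
  | trans h h' ih ih' => exact (ih σ).trans (ih' σ)
  | lam as h ih => exact .lam as (ih _)
  | app h h' ih ih' => exact .app (ih _) (ih' _)
  | tup h ih => exact .tup fun i => ih i _
  | sub as h h' ih ih' => exact .sub as (ih _) (ih' _)
  | op f h ih => exact .op f fun i => ih i _
  | lam_sub bs as s t =>
    simp only [Term.subst, shift_subst, swap_subst]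
    exact .lam_sub ..
  | app_sub as s t u =>
    simp only [Term.subst, shift_subst]
    exact .app_sub ..
  | app_arg as u s t =>
    simp only [Term.subst, shift_subst]
    exact .app_arg ..
  | tup_sub ts i as s t =>
    simp only [Term.subst, comp_update' (Term.subst _), shift_subst]
    exact .tup_sub ..
  | op_sub f ts i as s t =>
    simp only [Term.subst, comp_update' (Term.subst _), shift_subst]
    exact .op_sub ..
  | sub_body bs as s t u =>
    simp only [Term.subst, shift_subst, swap_subst]
    exact .sub_body ..
  | sub_arg bs as r s t =>
    simp only [Term.subst, liftShift_subst]
    exact .sub_arg ..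

theorem SEq.rename {s s' : Term A} (h : SEq s s') (ρ : ℕ → ℕ) :
    SEq (s.rename ρ) (s'.rename ρ) := by
  rw [rename_eq_subst, rename_eq_subst]
  exact h.subst _

theorem SEq.lift {σ τ : ℕ → A.Ob → Term A} (h : ∀ x a, SEq (σ x a) (τ x a)) (k : ℕ) :
    ∀ x a, SEq (liftSub k σ x a) (liftSub k τ x a) := by
  intro x a
  rcases lt_or_eq_add k x with hk | ⟨y, rfl⟩
  · rw [liftSub_lt _ _ hk, liftSub_lt _ _ hk]; exact .refl _
  · rw [liftSub_add, liftSub_add]; exact (h y a).rename _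

theorem SEq.subst_right (s : Term A) {σ τ : ℕ → A.Ob → Term A}
    (h : ∀ x a, SEq (σ x a) (τ x a)) : SEq (s.subst σ) (s.subst τ) := by
  induction s generalizing σ τ with
  | var x a => exact h x a
  | lam as s ih => exact .lam as (ih (SEq.lift h _))
  | app s t ihs iht => exact .app (ihs h) (iht h)
  | tup ts ih => exact .tup fun i => ih i h
  | sub as s t ihs iht => exact .sub as (ihs (SEq.lift h _)) (iht h)
  | op f ts ih => exact .op f fun i => ih i h

theorem SEq.fv_eq {s s' : Term A} (h : SEq s s') : fv s = fv s' := by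
  induction h with
  | refl s => rfl
  | symm h ih => exact ih.symm
  | trans h h' ih ih' => exact ih.trans ih'
  | lam as h ih => simp only [fv, ih]
  | app h h' ih ih' => simp only [fv, ih, ih']
  | tup h ih => simp only [fv, ih]
  | sub as h h' ih ih' => simp only [fv, ih, ih']
  | op f h ih => simp only [fv, ih]
  | lam_sub bs as s t => simp only [fv, down_add, down_fv_shift, down_down_swap]
  | app_sub as s t u => simp only [fv, down_add, down_fv_shift, add_right_comm]
  | app_arg as u s t => simp only [fv, down_add, down_fv_shift, add_assoc]
  | tup_sub ts i as s t =>
    simp only [fv, sum_update fv, down_add, down_sum, down_fv_shift, add_right_comm]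
  | op_sub f ts i as s t =>
    simp only [fv, sum_update fv, down_add, down_sum, down_fv_shift, add_right_comm]
  | sub_body bs as s t u =>
    simp only [fv, down_add, down_fv_shift, down_down_swap, add_right_comm]
  | sub_arg bs as r s t => simp only [fv, down_add, down_down_fv_rename_lift, add_assoc]

theorem wt_update_iff {m : ℕ} {cs : Fin m → A.Ob} {ts : Fin m → Term A} {i : Fin m} {s : Term A} :
    (∀ j, WT (Function.update ts i s j) (cs j)) ↔ WT s (cs i) ∧ ∀ j, j ≠ i → WT (ts j) (cs j) := by
  constructor
  · intro h
    exact ⟨by simpa using h i, fun j hj => by simpa [hj] using h j⟩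
  · rintro ⟨h, h'⟩ j
    by_cases hj : j = i
    · subst hj; simpa using h
    · simpa [hj] using h' j hj

theorem SEq.wt_iff {s s' : Term A} (h : SEq s s') (a : A.Ob) : WT s a ↔ WT s' a := by
  induction h generalizing a with
  | refl s => rfl
  | symm h ih => exact (ih a).symm
  | trans h h' ih ih' => exact (ih a).trans (ih' a)
  | lam as h ih =>
    constructor <;> rintro (_ | _ | _ | ⟨h1, h2⟩)
    · exact .lam ((ih _).1 h1) (h.fv_eq ▸ h2)
    · exact .lam ((ih _).2 h1) (h.fv_eq ▸ h2)
  | app h h' ih ih' =>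
    constructor <;> rintro (_ | _ | _ | _ | ⟨h1, h2⟩)
    · exact .app ((ih _).1 h1) ((ih' _).1 h2)
    · exact .app ((ih _).2 h1) ((ih' _).2 h2)
  | tup h ih =>
    constructor <;> rintro (_ | _ | ⟨h1⟩)
    · exact .tup fun i => (ih i _).1 (h1 i)
    · exact .tup fun i => (ih i _).2 (h1 i)
  | sub as h h' ih ih' =>
    constructor <;> rintro (_ | _ | _ | _ | _ | ⟨h1, h2, h3⟩)
    · exact .sub ((ih _).1 h1) (h.fv_eq ▸ h2) ((ih' _).1 h3)
    · exact .sub ((ih _).2 h1) (h.fv_eq ▸ h2) ((ih' _).2 h3)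
  | op f h ih =>
    constructor
    · rintro (_ | ⟨_, h1⟩)
      exact .op f fun i => (ih i _).1 (h1 i)
    · rintro (_ | ⟨_, h1⟩)
      exact .op f fun i => (ih i _).2 (h1 i)
  | lam_sub bs as s t =>
    constructor
    · rintro (_ | _ | _ | ⟨_ | _ | _ | _ | _ | ⟨h1, h2, h3⟩, h4⟩)
      refine .sub (.lam (h1.rename _) ?_) ?_ h3.of_rename
      · simpa only [fv, low_add, low_fv_shift, add_zero, ← fv_rename_swap_low] using h4
      · simpa only [fv, fv_rename_swap_low_down] using h2
    · rintro (_ | _ | _ | _ | _ | ⟨_ | _ | _ | ⟨h1, h4⟩, h2, h3⟩)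
      refine .lam (.sub h1.of_rename ?_ (h3.rename _)) ?_
      · simpa only [fv, fv_rename_swap_low_down] using h2
      · simpa only [fv, low_add, low_fv_shift, add_zero, ← fv_rename_swap_low] using h4
  | app_sub as s t u =>
    constructor
    · rintro (_ | _ | _ | _ | ⟨_ | _ | _ | _ | _ | ⟨h1, h2, h3⟩, h4⟩)
      exact .sub (.app h1 (h4.rename _)) (by simpa only [fv, low_add, low_fv_shift, add_zero]) h3
    · rintro (_ | _ | _ | _ | _ | ⟨_ | _ | _ | _ | ⟨h1, h4⟩, h2, h3⟩)
      exact .app (.sub h1 (by simpa only [fv, low_add, low_fv_shift, add_zero] using h2) h3)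
        h4.of_rename
  | app_arg as u s t =>
    constructor
    · rintro (_ | _ | _ | _ | ⟨h4, _ | _ | _ | _ | _ | ⟨h1, h2, h3⟩⟩)
      exact .sub (.app (h4.rename _) h1) (by simpa only [fv, low_add, low_fv_shift, zero_add]) h3
    · rintro (_ | _ | _ | _ | _ | ⟨_ | _ | _ | _ | ⟨h4, h1⟩, h2, h3⟩)
      exact .app h4.of_rename
        (.sub h1 (by simpa only [fv, low_add, low_fv_shift, zero_add] using h2) h3)
  | tup_sub ts i as s t =>
    constructor
    · rintro (_ | _ | ⟨h⟩)
      obtain ⟨_ | _ | _ | _ | _ | ⟨h1, h2, h3⟩, h4⟩ := wt_update_iff.1 h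
      refine .sub (.tup (wt_update_iff.2 ⟨h1, fun j hj => (h4 j hj).rename _⟩)) ?_ h3
      simpa [fv, sum_update fv, low_add, low_sum, low_fv_shift]
    · rintro (_ | _ | _ | _ | _ | ⟨_ | _ | ⟨h⟩, h2, h3⟩)
      obtain ⟨h1, h4⟩ := wt_update_iff.1 h
      refine .tup (wt_update_iff.2 ⟨.sub h1 ?_ h3, fun j hj => (h4 j hj).of_rename⟩)
      simpa [fv, sum_update fv, low_add, low_sum, low_fv_shift] using h2
  | op_sub f ts i as s t =>
    constructor
    · rintro (_ | ⟨_, h⟩)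
      obtain ⟨_ | _ | _ | _ | _ | ⟨h1, h2, h3⟩, h4⟩ := wt_update_iff.1 h
      refine .sub (.op f (wt_update_iff.2 ⟨h1, fun j hj => (h4 j hj).rename _⟩)) ?_ h3
      simpa [fv, sum_update fv, low_add, low_sum, low_fv_shift]
    · rintro (_ | _ | _ | _ | _ | ⟨_ | ⟨_, h⟩, h2, h3⟩)
      obtain ⟨h1, h4⟩ := wt_update_iff.1 h
      refine .op f (wt_update_iff.2 ⟨.sub h1 ?_ h3, fun j hj => (h4 j hj).of_rename⟩)
      simpa [fv, sum_update fv, low_add, low_sum, low_fv_shift] using h2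
  | sub_body bs as s t u =>
    constructor
    · rintro (_ | _ | _ | _ | _ | ⟨_ | _ | _ | _ | _ | ⟨h1, h2, h3⟩, h4, h5⟩)
      refine .sub (.sub (h1.rename _) ?_ (h5.rename _)) ?_ h3.of_rename
      · simpa only [fv, low_add, low_fv_shift, add_zero, ← fv_rename_swap_low] using h4
      · simpa only [fv, low_add, low_fv_shift, add_zero, fv_rename_swap_low_down] using h2
    · rintro (_ | _ | _ | _ | _ | ⟨_ | _ | _ | _ | _ | ⟨h1, h4, h5⟩, h2, h3⟩)
      refine .sub (.sub h1.of_rename ?_ (h3.rename _)) ?_ h5.of_rename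
      · simpa only [fv, low_add, low_fv_shift, add_zero, fv_rename_swap_low_down] using h2
      · simpa only [fv, low_add, low_fv_shift, add_zero, ← fv_rename_swap_low] using h4
  | sub_arg bs as r s t =>
    constructor
    · rintro (_ | _ | _ | _ | _ | ⟨h1, h2, _ | _ | _ | _ | _ | ⟨h3, h4, h5⟩⟩)
      refine .sub (.sub (h1.rename _) ?_ h3) ?_ h5
      · rwa [low_fv_rename]
      · simpa only [fv, low_add, low_down_fv_rename_lift, zero_add] using h4
    · rintro (_ | _ | _ | _ | _ | ⟨_ | _ | _ | _ | _ | ⟨h1, h2, h3⟩, h4, h5⟩)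
      refine .sub h1.of_rename ?_ (.sub h3 ?_ h5)
      · rwa [low_fv_rename] at h2
      · simpa only [fv, low_add, low_down_fv_rename_lift, zero_add] using h4

/-! ### Structural equivalence and contexts -/

/-- A reflexive and transitive relation on families relates two families as soon as it allows to
replace their entries one after the other. -/
theorem pointwise_of_update {ι α : Type*} [Fintype ι] [DecidableEq ι] {r : α → α → Prop}
    {R : (ι → α) → (ι → α) → Prop} (hrefl : ∀ f, R f f)
    (htrans : ∀ {f g h}, R f g → R g h → R f h)
    (h : ∀ f i y, r (f i) y → R f (Function.update f i y)) {f g : ι → α}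
    (hfg : ∀ i, r (f i) (g i)) : R f g := by
  have key (S : Finset ι) : R f (S.piecewise g f) := by
    induction S using Finset.induction_on with
    | empty => simpa using hrefl f
    | insert i S hi ih =>
      rw [Finset.piecewise_insert]
      exact htrans ih (h _ _ _ (by simpa [hi] using hfg i))
  simpa using key Finset.univ

theorem SEq.update {m : ℕ} (ts : Fin m → Term A) (i : Fin m) {s s' : Term A} (h : SEq s s')
    (j : Fin m) : SEq (Function.update ts i s j) (Function.update ts i s' j) := by
  by_cases hj : j = i
  · subst hj; simpa using h
  · simpa [hj] using .refl _

theorem SEq.plug (C : Ctx A) {s s' : Term A} (h : SEq s s') : SEq (C.plug s) (C.plug s') := by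
  induction C with
  | hole => exact h
  | tup ts i C ih => exact .tup (SEq.update ts i ih)
  | subBody as C t ih => exact .sub as ih (.refl _)
  | subArg as r C ih => exact .sub as (.refl _) ih
  | appFun C t ih => exact .app ih (.refl _)
  | appArg r C ih => exact .app (.refl _) ih
  | lam as C ih => exact .lam as ih
  | op f ts i C ih => exact .op f (SEq.update ts i ih)

namespace Ctx

theorem depth_rename (C : Ctx A) (ρ : ℕ → ℕ) : (C.rename ρ).depth = C.depth := by
  induction C generalizing ρ <;> simp_all [rename, depth]

theorem rename_plug (C : Ctx A) (ρ : ℕ → ℕ) (s : Term A) :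
    (C.plug s).rename ρ = (C.rename ρ).plug (s.rename (liftRen C.depth ρ)) := by
  have lift0 (ρ : ℕ → ℕ) : liftRen 0 ρ = ρ := by funext x; simp [liftRen]
  have lift_lift (d k : ℕ) (ρ : ℕ → ℕ) : liftRen d (liftRen k ρ) = liftRen (d + k) ρ := by
    funext x
    unfold liftRen
    split_ifs <;> first | omega | (rw [show x - d - k = x - (d + k) by omega]; omega)
  induction C generalizing ρ with
  | hole => simp only [plug, rename, depth, lift0]
  | tup ts i C ih => simp only [plug, rename, Term.rename, comp_update' (Term.rename _), ih, depth]
  | subBody as C t ih => simp only [plug, rename, Term.rename, ih, depth, lift_lift]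
  | subArg as r C ih => simp only [plug, rename, Term.rename, ih, depth]
  | appFun C t ih => simp only [plug, rename, Term.rename, ih, depth]
  | appArg r C ih => simp only [plug, rename, Term.rename, ih, depth]
  | lam as C ih => simp only [plug, rename, Term.rename, ih, depth, lift_lift]
  | op f ts i C ih => simp only [plug, rename, Term.rename, comp_update' (Term.rename _), ih, depth]

theorem rename_rename (C : Ctx A) (ρ ρ' : ℕ → ℕ) :
    (C.rename ρ).rename ρ' = C.rename fun x => ρ' (ρ x) := by
  induction C generalizing ρ ρ' <;>
    simp_all only [rename, Term.rename_rename, liftRen_liftRen]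

end Ctx

theorem SEq.comm (C : Ctx A) {k : ℕ} (as : Fin k → A.Ob) (s t : Term A) :
    SEq (C.plug (.sub as s (t.shift C.depth)))
      (.sub as ((C.shift k).plug (s.rename (swapRen k C.depth))) t) := by
  have ctx (l : ℕ) (C : Ctx A) (s : Term A) :
      ((C.shift k).plug (s.rename (swapRen k C.depth))).rename (swapRen k l) =
        (C.rename (liftRen l (· + k))).plug (s.rename (swapRen k (C.depth + l))) := by
    rw [Ctx.rename_plug, Ctx.shift, Ctx.depth_rename, Ctx.rename_rename, Term.rename_rename]
    congr 2
    · funext x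
      simp only [swapRen, liftRen]
      split_ifs <;> omega
    · funext x
      simp only [swapRen, liftRen]
      split_ifs <;> omega
  induction C generalizing s t with
  | hole =>
    simp only [Ctx.plug, Ctx.depth, Ctx.shift, Ctx.rename, swapRen_zero, rename_id, shift_zero]
    exact .refl _
  | tup ts i C ih => exact (SEq.tup (SEq.update ts i (ih s t))).trans (.tup_sub ..)
  | subBody bs C u ih =>
    simp only [Ctx.plug, Ctx.depth, shift_add, Ctx.shift, Ctx.rename, ← ctx]
    exact (SEq.sub bs (ih s _) (.refl u)).trans (.sub_body ..)
  | subArg bs r C ih => exact (SEq.sub bs (.refl r) (ih s t)).trans (.sub_arg ..)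
  | appFun C u ih => exact (SEq.app (ih s t) (.refl u)).trans (.app_sub ..)
  | appArg r C ih => exact (SEq.app (.refl r) (ih s t)).trans (.app_arg ..)
  | lam bs C ih =>
    simp only [Ctx.plug, Ctx.depth, shift_add, Ctx.shift, Ctx.rename, ← ctx]
    exact (SEq.lam bs (ih s _)).trans (.lam_sub ..)
  | op f ts i C ih => exact (SEq.op f (SEq.update ts i (ih s t))).trans (.op_sub ..)

theorem StructEq.seq {s s' : Term A} (h : StructEq s s') : SEq s s' := by
  induction h with
  | comm C as s t => exact .comm C as s t
  | congr C h ih => exact .plug C ih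
  | refl s => exact .refl s
  | symm h ih => exact ih.symm
  | trans h h' ih ih' => exact ih.trans ih'

theorem SEq.structEq {s s' : Term A} (h : SEq s s') : StructEq s s' := by
  induction h with
  | refl s => exact .refl s
  | symm h ih => exact ih.symm
  | trans h h' ih ih' => exact ih.trans ih'
  | lam as h ih => exact .congr (.lam as .hole) ih
  | app h h' ih ih' =>
    exact (StructEq.congr (.appFun .hole _) ih).trans (.congr (.appArg _ .hole) ih')
  | tup h ih =>
    exact pointwise_of_update (R := fun ts ts' => StructEq (.tup ts) (.tup ts')) (fun _ => .refl _)
      .trans (fun ts i y h => by simpa [Ctx.plug] using StructEq.congr (.tup ts i .hole) h) ih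
  | sub as h h' ih ih' =>
    exact (StructEq.congr (.subBody as .hole _) ih).trans (.congr (.subArg as _ .hole) ih')
  | op f h ih =>
    exact pointwise_of_update (R := fun ts ts' => StructEq (.op f ts) (.op f ts'))
      (fun _ => .refl _) .trans
      (fun ts i y h => by simpa [Ctx.plug] using StructEq.congr (.op f ts i .hole) h) ih
  | lam_sub bs as s t =>
    simpa [Ctx.plug, Ctx.depth, Ctx.shift, Ctx.rename] using StructEq.comm (.lam bs .hole) as s t
  | app_sub as s t u =>
    simpa [Ctx.plug, Ctx.depth, Ctx.shift, Ctx.rename, swapRen_zero, rename_id, shift_zero]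
      using! StructEq.comm (.appFun .hole u) as s t
  | app_arg as u s t =>
    simpa [Ctx.plug, Ctx.depth, Ctx.shift, Ctx.rename, swapRen_zero, rename_id, shift_zero]
      using! StructEq.comm (.appArg u .hole) as s t
  | tup_sub ts i as s t =>
    simpa [Ctx.plug, Ctx.depth, Ctx.shift, Ctx.rename, swapRen_zero, rename_id, shift_zero]
      using! StructEq.comm (.tup ts i .hole) as s t
  | op_sub f ts i as s t =>
    simpa [Ctx.plug, Ctx.depth, Ctx.shift, Ctx.rename, swapRen_zero, rename_id, shift_zero]
      using! StructEq.comm (.op f ts i .hole) as s t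
  | sub_body bs as s t u =>
    simpa [Ctx.plug, Ctx.depth, Ctx.shift, Ctx.rename]
      using! StructEq.comm (.subBody bs .hole u) as s t
  | sub_arg bs as r s t =>
    simpa [Ctx.plug, Ctx.depth, Ctx.shift, Ctx.rename, swapRen_zero, rename_id, shift_zero]
      using! StructEq.comm (.subArg bs r .hole) as s t

/-! ### Typing with and without contexts -/

theorem IsShuffle.coe_eq {α : Type*} {k : ℕ} {γs : Fin k → List α} {γ : List α}
    (h : IsShuffle γs γ) : (γ : Multiset α) = ∑ i, (γs i : Multiset α) := by
  obtain ⟨σ, -, hσ⟩ := h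
  have coe (l : List α) : (l : Multiset α) = ∑ i : Fin l.length, {l.get i} := by
    have h := Multiset.sum_map_singleton (Finset.univ.val.map l.get)
    rw [Multiset.map_map, Fin.univ_val_map l.get, List.ofFn_get] at h
    exact h.symm
  rw [coe γ, ← σ.sum_comp, Fintype.sum_sigma]
  refine Finset.sum_congr rfl fun i _ => ?_
  rw [coe (γs i)]
  exact Finset.sum_congr rfl fun j _ => by rw [hσ]

/-- Lists that partition a list without duplicates, and keep its order, shuffle to it. -/
theorem isShuffle_of_sublist {α : Type*} {k : ℕ} {γs : Fin k → List α} {γ : List α}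
    (hγ : γ.Nodup) (hs : ∀ i, (γs i).Sublist γ)
    (hsum : (γ : Multiset α) = ∑ i, (γs i : Multiset α)) : IsShuffle γs γ := by
  choose f hf using fun i => List.sublist_iff_exists_fin_orderEmbedding_get_eq.1 (hs i)
  have hbij : Function.Bijective
      (fun p => f p.1 p.2 : (Σ i : Fin k, Fin (γs i).length) → Fin γ.length) := by
    rw [Fintype.bijective_iff_surjective_and_card]
    refine ⟨fun p => ?_, ?_⟩
    · have hp : γ.get p ∈ (γ : Multiset α) := List.get_mem γ p
      rw [hsum, Multiset.mem_sum] at hp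
      obtain ⟨i, -, hi⟩ := hp
      obtain ⟨j, hj⟩ := List.get_of_mem (Multiset.mem_coe.1 hi)
      exact ⟨⟨i, j⟩, List.nodup_iff_injective_get.1 hγ (by rw [← hf, hj])⟩
    · have := congrArg Multiset.card hsum
      simpa using this.symm
  refine ⟨Equiv.ofBijective _ hbij, fun i => (f i).monotone, fun p => (hf p.1 p.2).symm⟩

theorem coe_shift (k : ℕ) (γ : Cxt A) :
    (γ.shift k : Multiset (ℕ × A.Ob)) =
      (γ : Multiset (ℕ × A.Ob)).bind fun p => {(p.1 + k, p.2)} := by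
  rw [Multiset.bind_singleton]
  rfl

theorem low_shift (k : ℕ) (M : Multiset (ℕ × A.Ob)) :
    low k (M.bind fun p => {(p.1 + k, p.2)}) = 0 := by
  rw [low, Multiset.bind_assoc]
  simp

theorem down_shift (k : ℕ) (M : Multiset (ℕ × A.Ob)) :
    down k (M.bind fun p => {(p.1 + k, p.2)}) = M := by
  rw [down, Multiset.bind_assoc]
  exact bind_pure fun p _ => by simp

theorem eq_shift_add_low (k : ℕ) (M : Multiset (ℕ × A.Ob)) :
    M = (down k M).bind (fun p => {(p.1 + k, p.2)}) + low k M := by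
  have := bind_low_down k M fun p => {p}
  rw [Multiset.bind_singleton, Multiset.bind_singleton, Multiset.map_id', Multiset.map_id'] at this
  rw [add_comm]
  exact this

theorem Cxt.Distinct.sublist {γ δ : Cxt A} (h : γ.Distinct) (hs : δ.Sublist γ) : δ.Distinct :=
  List.Nodup.sublist (hs.map _) h

theorem Cxt.Distinct.nodup {γ : Cxt A} (h : γ.Distinct) : γ.Nodup := List.Nodup.of_map _ h

theorem HasType.wt {γ : Cxt A} {s : Term A} {a : A.Ob} (h : HasType γ s a) :
    WT s a ∧ fv s = γ ∧ γ.Distinct := by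
  induction h with
  | var x a => exact ⟨.var x a, rfl, by simp [Cxt.Distinct]⟩
  | op f hts hγ hd ih =>
    refine ⟨.op f fun i => (ih i).1, ?_, hd⟩
    rw [hγ.coe_eq]
    exact Finset.sum_congr rfl fun i _ => (ih i).2.1
  | tup hts hγ hd ih =>
    refine ⟨.tup fun i => (ih i).1, ?_, hd⟩
    rw [hγ.coe_eq]
    exact Finset.sum_congr rfl fun i _ => (ih i).2.1
  | @lam k as b s γ hs ih =>
    obtain ⟨h1, h2, h3⟩ := ih
    rw [← Multiset.coe_add, coe_shift, coe_ofTypes] at h2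
    refine ⟨.lam h1 ?_, ?_, ?_⟩
    · rw [h2, low_add, low_shift, low_bvs, zero_add]
    · rw [fv, h2, down_add, down_shift, down_bvs, add_zero]
    · have := h3.sublist (List.sublist_append_left _ _)
      rw [Cxt.Distinct, Cxt.shift, List.map_map] at this
      rw [Cxt.Distinct]
      refine List.Nodup.of_map (· + k) ?_
      rwa [List.map_map]
  | app hs ht hε hd ihs iht =>
    refine ⟨.app ihs.1 iht.1, ?_, hd⟩
    rw [hε.coe_eq, Fin.sum_univ_two]
    exact congrArg₂ _ ihs.2.1 iht.2.1
  | @sub k as b s t γ δ₁ δ₂ ε hs ht hε hd ihs iht =>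
    obtain ⟨h1, h2, h3⟩ := iht
    rw [← Multiset.coe_add, ← Multiset.coe_add, coe_shift, coe_shift, coe_ofTypes] at h2
    refine ⟨.sub h1 ?_ ihs.1, ?_, hd⟩
    · rw [h2, low_add, low_add, low_shift, low_shift, low_bvs, zero_add, add_zero]
    · rw [fv, h2, down_add, down_add, down_shift, down_shift, down_bvs, add_zero, hε.coe_eq,
        Fin.sum_univ_three, ihs.2.1, add_comm, ← add_assoc]
      rfl

open Classical in
theorem coe_filter_mem {γ : Cxt A} (hγ : γ.Nodup) {M N : Multiset (ℕ × A.Ob)}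
    (h : (γ : Multiset (ℕ × A.Ob)) = M + N) :
    ((γ.filter fun p => p ∈ M : List (ℕ × A.Ob)) : Multiset (ℕ × A.Ob)) = M := by
  have hd : (M + N).Nodup := h ▸ hγ
  rw [← Multiset.filter_coe, h, Multiset.filter_add, Multiset.filter_eq_self.2 fun p hp => hp,
    Multiset.filter_eq_nil.2, add_zero]
  intro p hN hM
  exact Multiset.disjoint_left.1 (Multiset.nodup_add.1 hd).2.2 hM hN

/-- The context of a typed term is determined, up to order, by the free variables of the term. The
contexts of the subterms are the corresponding sublists of `γ`, so that they shuffle to `γ`. -/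
theorem WT.hasType {s : Term A} {a : A.Ob} (h : WT s a) {γ : Cxt A}
    (hγ : (γ : Multiset (ℕ × A.Ob)) = fv s) (hd : γ.Distinct) : HasType γ s a := by
  classical
  have family {n : ℕ} (ts : Fin n → Term A) {γ : Cxt A} (hγ : (γ : Multiset _) = ∑ i, fv (ts i))
      (hd : γ.Distinct) :
      ∃ γs : Fin n → Cxt A, (∀ i, (γs i : Multiset _) = fv (ts i)) ∧ (∀ i, (γs i).Distinct) ∧
        IsShuffle γs γ := by
    have hs i : (γ.filter fun p => p ∈ fv (ts i)).Sublist γ := List.filter_sublist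
    have hc i : ((γ.filter fun p => p ∈ fv (ts i) : List _) : Multiset _) = fv (ts i) :=
      coe_filter_mem hd.nodup (hγ.trans (Finset.add_sum_erase _ _ (Finset.mem_univ i)).symm)
    exact ⟨_, hc, fun i => hd.sublist (hs i), isShuffle_of_sublist hd.nodup hs (by
      rw [hγ]; exact Finset.sum_congr rfl fun i _ => (hc i).symm)⟩
  have body {k : ℕ} {as : Fin k → A.Ob} {s : Term A} {γ : Cxt A}
      (hl : low k (fv s) = bvs as) (hγ : (γ : Multiset _) = down k (fv s)) (hd : γ.Distinct) :
      ((γ.shift k ++ Cxt.ofTypes as : List _) : Multiset _) = fv s ∧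
        (γ.shift k ++ Cxt.ofTypes as : Cxt A).Distinct := by
    refine ⟨?_, ?_⟩
    · rw [← Multiset.coe_add, coe_shift, coe_ofTypes, hγ, ← hl, ← eq_shift_add_low]
    · rw [Cxt.Distinct, List.map_append, List.nodup_append]
      refine ⟨?_, ?_, ?_⟩
      · rw [Cxt.shift, List.map_map]
        have := List.Nodup.map (add_left_injective k) hd
        rwa [List.map_map] at this
      · rw [Cxt.ofTypes, List.map_ofFn]
        exact List.nodup_ofFn.2 Fin.val_injective
      · simp only [Cxt.shift, Cxt.ofTypes, List.mem_map, List.mem_ofFn]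
        rintro _ ⟨_, ⟨p, -, rfl⟩, rfl⟩ _ ⟨_, ⟨i, rfl⟩, rfl⟩ h
        simp only at h
        omega
  induction h generalizing γ with
  | var x a => rw [(Multiset.coe_eq_singleton.1 hγ : γ = [(x, a)])]; exact .var x a
  | op f hts ih =>
    obtain ⟨γs, h1, h2, h3⟩ := family _ hγ hd
    exact .op f (fun i => ih i (h1 i) (h2 i)) h3 hd
  | tup hts ih =>
    obtain ⟨γs, h1, h2, h3⟩ := family _ hγ hd
    exact .tup (fun i => ih i (h1 i) (h2 i)) h3 hd
  | lam hs hl ih =>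
    obtain ⟨h1, h2⟩ := body hl hγ hd
    exact .lam (ih h1 h2)
  | @app k as b s t hs ht ihs iht =>
    obtain ⟨γs, h1, h2, h3⟩ := family ![s, t] (by simpa [fv] using hγ) hd
    have e : γs = ![γs 0, γs 1] := by
      funext i; fin_cases i <;> rfl
    rw [e] at h3
    exact .app (ihs (h1 0) (h2 0)) (iht (h1 1) (h2 1)) h3 hd
  | @sub k as b s t hs hl ht ihs iht =>
    rw [fv] at hγ
    have hs₁ : (γ.filter fun p => p ∈ fv t).Sublist γ := List.filter_sublist
    have hs₂ : (γ.filter fun p => p ∈ down k (fv s)).Sublist γ := List.filter_sublist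
    have hc₁ := coe_filter_mem hd.nodup (hγ.trans (add_comm _ _))
    have hc₂ := coe_filter_mem hd.nodup hγ
    obtain ⟨h1, h2⟩ := body hl hc₂ (hd.sublist hs₂)
    refine .sub (δ₂ := []) (iht hc₁ (hd.sublist hs₁))
      (by simpa [Cxt.shift] using ihs h1 h2) (isShuffle_of_sublist hd.nodup ?_ ?_) hd
    · intro i
      fin_cases i
      · exact hs₁
      · exact hs₂
      · exact List.nil_sublist _
    · rw [Fin.sum_univ_three]
      simp only [Matrix.cons_val]
      rw [hc₁, hc₂, hγ, Multiset.coe_nil, add_zero, add_comm]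

namespace Term

/-- The free variables have pairwise distinct names. -/
def Linear (s : Term A) : Prop := ((fv s).map Prod.fst).Nodup

end Term

theorem distinct_iff {γ : Cxt A} {s : Term A} (h : fv s = γ) : γ.Distinct ↔ s.Linear := by
  rw [Linear, h]
  rfl

theorem WT.exists_hasType {s : Term A} {a : A.Ob} (h : WT s a) (hs : s.Linear) :
    ∃ γ, HasType γ s a :=
  ⟨(fv s).toList, h.hasType (Multiset.coe_toList _)
    ((distinct_iff (Multiset.coe_toList _).symm).2 hs)⟩

/-! ### Head forms and contraction of a redex -/

/-- The terms `L[⟨t₁, …, tₖ⟩]`. -/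
inductive TupHead : Term A → Prop
  | tup {k : ℕ} (ts : Fin k → Term A) : TupHead (.tup ts)
  | sub {k : ℕ} (as : Fin k → A.Ob) {s : Term A} (h : TupHead s) (t : Term A) :
      TupHead (.sub as s t)

/-- The terms `L[λx⃗ s]`. -/
inductive LamHead : Term A → Prop
  | lam {k : ℕ} (as : Fin k → A.Ob) (s : Term A) : LamHead (.lam as s)
  | sub {k : ℕ} (as : Fin k → A.Ob) {s : Term A} (h : LamHead s) (t : Term A) :
      LamHead (.sub as s t)

theorem tupHead_sub {k : ℕ} {as : Fin k → A.Ob} {s t : Term A} :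
    TupHead (.sub as s t) ↔ TupHead s :=
  ⟨fun h => by cases h; assumption, fun h => .sub as h t⟩

theorem lamHead_sub {k : ℕ} {as : Fin k → A.Ob} {s t : Term A} :
    LamHead (.sub as s t) ↔ LamHead s :=
  ⟨fun h => by cases h; assumption, fun h => .sub as h t⟩

theorem TupHead.subst {s : Term A} (h : TupHead s) (σ : ℕ → A.Ob → Term A) :
    TupHead (s.subst σ) := by
  induction h generalizing σ with
  | tup ts => exact .tup _
  | sub as h t ih => exact .sub as (ih _) _

theorem LamHead.subst {s : Term A} (h : LamHead s) (σ : ℕ → A.Ob → Term A) :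
    LamHead (s.subst σ) := by
  induction h generalizing σ with
  | lam as s => exact .lam _ _
  | sub as h t ih => exact .sub as (ih _) _

theorem TupHead.rename {s : Term A} (h : TupHead s) (ρ : ℕ → ℕ) : TupHead (s.rename ρ) :=
  rename_eq_subst s ρ ▸ h.subst _

theorem LamHead.rename {s : Term A} (h : LamHead s) (ρ : ℕ → ℕ) : LamHead (s.rename ρ) :=
  rename_eq_subst s ρ ▸ h.subst _

theorem tupHead_rename {s : Term A} {ρ : ℕ → ℕ} : TupHead (s.rename ρ) ↔ TupHead s := by
  refine ⟨fun h => ?_, fun h => h.rename ρ⟩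
  induction s generalizing ρ with
  | tup ts => exact .tup ts
  | sub as s t ihs => exact .sub as (ihs (tupHead_sub.1 h)) t
  | _ => cases h

theorem lamHead_rename {s : Term A} {ρ : ℕ → ℕ} : LamHead (s.rename ρ) ↔ LamHead s := by
  refine ⟨fun h => ?_, fun h => h.rename ρ⟩
  induction s generalizing ρ with
  | lam as s => exact .lam as s
  | sub as s t ihs => exact .sub as (ihs (lamHead_sub.1 h)) t
  | _ => cases h

theorem SEq.tupHead_iff {s s' : Term A} (h : SEq s s') : TupHead s ↔ TupHead s' := by
  induction h with
  | refl s => rfl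
  | symm h ih => exact ih.symm
  | trans h h' ih ih' => exact ih.trans ih'
  | tup h => exact ⟨fun _ => .tup _, fun _ => .tup _⟩
  | sub as h h' ih => rw [tupHead_sub, tupHead_sub, ih]
  | tup_sub ts i as s t => exact ⟨fun _ => .sub as (.tup _) t, fun _ => .tup _⟩
  | sub_body bs as s t u => simp only [tupHead_sub, tupHead_rename]
  | sub_arg bs as r s t => simp only [tupHead_sub, tupHead_rename]
  | _ => exact ⟨fun h => by cases h; try contradiction, fun h => by cases h; try contradiction⟩

theorem SEq.lamHead_iff {s s' : Term A} (h : SEq s s') : LamHead s ↔ LamHead s' := by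
  induction h with
  | refl s => rfl
  | symm h ih => exact ih.symm
  | trans h h' ih ih' => exact ih.trans ih'
  | lam h => exact ⟨fun _ => .lam _ _, fun _ => .lam _ _⟩
  | sub as h h' ih => rw [lamHead_sub, lamHead_sub, ih]
  | lam_sub bs as s t => exact ⟨fun _ => .sub as (.lam _ _) t, fun _ => .lam _ _⟩
  | sub_body bs as s t u => simp only [lamHead_sub, lamHead_rename]
  | sub_arg bs as r s t => simp only [lamHead_sub, lamHead_rename]
  | _ => exact ⟨fun h => by cases h; try contradiction, fun h => by cases h; try contradiction⟩

/-- The `x`-th entry of a tuple. There is none if the tuple is too short, which does not happen in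
typed terms; the value is then a closed term, so that `fill` commutes with substitution. -/
def fill {m : ℕ} (ts : Fin m → Term A) (x : ℕ) : Term A :=
  if h : x < m then ts ⟨x, h⟩ else .tup (Fin.elim0 : Fin 0 → Term A)

theorem fill_map {m : ℕ} (F : Term A → Term A) (ts : Fin m → Term A) (x : ℕ)
    (hF : F (.tup (Fin.elim0 : Fin 0 → Term A)) = .tup (Fin.elim0 : Fin 0 → Term A)) :
    F (fill ts x) = fill (fun i => F (ts i)) x := by
  unfold fill
  split_ifs
  · rfl
  · exact hF

theorem fill_subst {m : ℕ} (ts : Fin m → Term A) (x : ℕ) (σ : ℕ → A.Ob → Term A) :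
    (fill ts x).subst σ = fill (fun i => (ts i).subst σ) x :=
  fill_map (Term.subst σ) ts x (congrArg Term.tup (funext fun i => i.elim0))

theorem fill_rename {m : ℕ} (ts : Fin m → Term A) (x : ℕ) (ρ : ℕ → ℕ) :
    (fill ts x).rename ρ = fill (fun i => (ts i).rename ρ) x :=
  fill_map (Term.rename ρ) ts x (congrArg Term.tup (funext fun i => i.elim0))

/-- The substitution that contracts `s[x₁, …, xₖ := ⟨t₁, …, tₘ⟩]`. It is also defined if `k ≠ m`, so
that reduction can be studied without types. -/
def contr (k : ℕ) {m : ℕ} (ts : Fin m → Term A) : ℕ → A.Ob → Term A :=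
  fun x a => if x < k then fill ts x else .var (x - k) a

theorem contr_lt {k m x : ℕ} (ts : Fin m → Term A) (a : A.Ob) (h : x < k) :
    contr k ts x a = fill ts x := if_pos h

theorem contr_add (k x : ℕ) {m : ℕ} (ts : Fin m → Term A) (a : A.Ob) :
    contr k ts (x + k) a = .var x a := by
  simp [contr]

theorem contr_eq_inst {k : ℕ} (ts : Fin k → Term A) : contr k ts = inst ts 0 := by
  funext x a
  rcases lt_or_eq_add k x with h | ⟨y, rfl⟩
  · simp [contr_lt, inst_lt, h, fill]
  · simp [contr_add, inst_add]

theorem contr_subst {k m : ℕ} (s : Term A) (ts : Fin m → Term A) (σ : ℕ → A.Ob → Term A) :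
    (s.subst (contr k ts)).subst σ =
      (s.subst (liftSub k σ)).subst (contr k fun i => (ts i).subst σ) := by
  rw [subst_subst, subst_subst]
  refine subst_congr' (fun x a => ?_) s
  rcases lt_or_eq_add k x with h | ⟨y, rfl⟩
  · simp only [contr_lt, liftSub_lt, h, fill_subst, Term.subst]
  · simp only [contr_add, liftSub_add, Term.subst, Term.shift, subst_rename, subst_var]

theorem shift_contr {k m : ℕ} (s : Term A) (ts : Fin m → Term A) :
    (s.shift k).subst (contr k ts) = s := by
  rw [Term.shift, subst_rename]
  simp only [contr_add, subst_var]

/-- The contraction of `(L[λx⃗ s]) t` to `L[s[x⃗ := t]]`. -/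
def papp : Term A → Term A → Term A
  | .lam as s, t => .sub as s t
  | .sub (k := k) as s u, t => .sub as (papp s (t.shift k)) u
  | s, t => .app s t

/-- The contraction of `s[x⃗ := L[⟨t₁, …, tₖ⟩]]` to `L[s{t₁, …, tₖ / x⃗}]`. -/
def psub {k : ℕ} (as : Fin k → A.Ob) : Term A → Term A → Term A
  | s, .tup ts => s.subst (contr k ts)
  | s, .sub (k := l) bs t u => .sub bs (psub as (s.rename (liftRen k (· + l))) t) u
  | s, t => .sub as s t

theorem LamHead.papp_subst {s : Term A} (hs : LamHead s) (t : Term A) (σ : ℕ → A.Ob → Term A) :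
    (papp s t).subst σ = papp (s.subst σ) (t.subst σ) := by
  induction hs generalizing t σ with
  | lam as s => rfl
  | sub as h u ih => simp only [papp, Term.subst, ih, shift_subst]

theorem LamHead.papp_rename {s : Term A} (hs : LamHead s) (t : Term A) (ρ : ℕ → ℕ) :
    (papp s t).rename ρ = papp (s.rename ρ) (t.rename ρ) := by
  simp only [rename_eq_subst, hs.papp_subst]

theorem TupHead.psub_subst {t : Term A} (ht : TupHead t) {k : ℕ} (as : Fin k → A.Ob) (s : Term A)
    (σ : ℕ → A.Ob → Term A) :
    (psub as s t).subst σ = psub as (s.subst (liftSub k σ)) (t.subst σ) := by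
  induction ht generalizing s σ with
  | tup ts => simp only [psub, Term.subst, contr_subst]
  | sub bs h u ih => simp only [psub, Term.subst, ih, liftShift_subst]

theorem TupHead.psub_rename {t : Term A} (ht : TupHead t) {k : ℕ} (as : Fin k → A.Ob) (s : Term A)
    (ρ : ℕ → ℕ) : (psub as s t).rename ρ = psub as (s.rename (liftRen k ρ)) (t.rename ρ) := by
  simp only [rename_eq_subst, ht.psub_subst, liftSub_var]

/-! ### Contractions commute with the term constructors -/

theorem swap_contr {k l m : ℕ} (s : Term A) (ts : Fin m → Term A) :
    (s.rename (swapRen k l)).subst (liftSub l (contr k ts)) =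
      s.subst (contr k fun i => (ts i).shift l) := by
  rw [subst_rename]
  refine subst_congr' (fun x a => ?_) s
  rcases lt_or_eq_add k x with h | ⟨y, rfl⟩
  · rw [swapRen_lt l h, liftSub_add, contr_lt _ _ h, contr_lt _ _ h, Term.shift, fill_rename]
    rfl
  · rcases lt_or_eq_add l y with h | ⟨z, rfl⟩
    · rw [swapRen_add_lt h, liftSub_lt _ _ h, contr_add]
    · rw [swapRen_add_add, add_right_comm, liftSub_add, contr_add, add_right_comm, contr_add]
      rfl

theorem liftShift_contr {k l m : ℕ} (r : Term A) (ts : Fin m → Term A) :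
    (r.rename (liftRen l (· + k))).subst (liftSub l (contr k ts)) = r := by
  rw [subst_rename]
  conv_rhs => rw [← subst_var r]
  refine subst_congr' (fun x a => ?_) r
  rcases lt_or_eq_add l x with h | ⟨y, rfl⟩
  · rw [liftRen_lt _ h, liftSub_lt _ _ h]
  · rw [liftRen_add, liftSub_add, contr_add]
    rfl

theorem lift_swap (c l : ℕ) (t : Term A) :
    (t.rename (liftRen c (· + l))).rename (swapRen c l) = t.shift l := by
  simp only [Term.shift, Term.rename_rename]
  refine rename_congr' (fun x => ?_) _
  simp only [liftRen, swapRen]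
  split_ifs <;> omega

theorem shift_swap (k l : ℕ) (t : Term A) :
    (t.shift k).rename (swapRen k l) = t.rename (liftRen l (· + k)) := by
  simp only [Term.shift, Term.rename_rename]
  refine rename_congr' (fun x => ?_) _
  simp only [liftRen, swapRen]
  split_ifs <;> omega

theorem lift_lift_swap (k l c : ℕ) (s : Term A) :
    ((s.rename (liftRen k (liftRen l (· + c)))).rename (swapRen k l)).rename
      (liftRen l (swapRen k c)) = (s.rename (swapRen k l)).rename (liftRen l (· + c)) := by
  simp only [Term.rename_rename]
  refine rename_congr' (fun x => ?_) _
  simp only [liftRen, swapRen]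
  split_ifs <;> omega

theorem shift_tup {k : ℕ} (ts : Fin k → Term A) (l : ℕ) :
    (Term.tup ts).shift l = .tup fun i => (ts i).shift l := rfl

theorem shift_sub {k : ℕ} (as : Fin k → A.Ob) (s t : Term A) (l : ℕ) :
    (Term.sub as s t).shift l = .sub as (s.rename (liftRen k (· + l))) (t.shift l) := rfl

theorem swap_lift (k l c : ℕ) (s : Term A) :
    ((s.rename (liftRen k (· + c))).rename (liftRen k (swapRen c l))).rename (swapRen k l) =
      (s.rename (swapRen k l)).rename (liftRen l (liftRen k (· + c))) := by
  simp only [Term.rename_rename]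
  refine rename_congr' (fun x => ?_) _
  simp only [liftRen, swapRen]
  split_ifs <;> omega

theorem shift_lift (k : ℕ) (s : Term A) (ρ : ℕ → ℕ) :
    (s.shift k).rename (liftRen k ρ) = (s.rename ρ).shift k := by
  simp only [Term.shift, Term.rename_rename, liftRen_add]

theorem TupHead.lam_psub {t : Term A} (ht : TupHead t) {l k : ℕ} (bs : Fin l → A.Ob)
    (as : Fin k → A.Ob) (s : Term A) :
    SEq (.lam bs (psub as s (t.shift l)))
      (psub as (.lam bs (s.rename (swapRen k l))) t) := by
  induction ht generalizing s with
  | tup ts =>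
    refine .of_eq ?_
    simp only [psub, Term.subst, shift_tup, swap_contr]
  | @sub c cs t ht u ih =>
    simp only [psub, shift_sub, Term.rename]
    refine (SEq.lam_sub ..).trans (.sub cs ?_ (.refl u))
    rw [(ht.rename _).psub_rename, lift_swap, ← swap_lift]
    exact ih _

theorem TupHead.app_psub {t : Term A} (ht : TupHead t) {k : ℕ} (as : Fin k → A.Ob)
    (s u : Term A) : SEq (.app (psub as s t) u)
      (psub as (.app s (u.shift k)) t) := by
  induction ht generalizing s u with
  | tup ts =>
    refine .of_eq ?_
    simp only [psub, Term.subst, shift_contr]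
  | @sub c cs t ht v ih =>
    simp only [psub, Term.rename, shift_lift]
    exact (SEq.app_sub ..).trans (.sub cs (ih _ _) (.refl v))

theorem TupHead.app_arg_psub {t : Term A} (ht : TupHead t) {k : ℕ} (as : Fin k → A.Ob)
    (u s : Term A) : SEq (.app u (psub as s t))
      (psub as (.app (u.shift k) s) t) := by
  induction ht generalizing s u with
  | tup ts =>
    refine .of_eq ?_
    simp only [psub, Term.subst, shift_contr]
  | @sub c cs t ht v ih =>
    simp only [psub, Term.rename, shift_lift]
    exact (SEq.app_arg ..).trans (.sub cs (ih _ _) (.refl v))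

theorem TupHead.tup_psub {t : Term A} (ht : TupHead t) {m k : ℕ} (ts : Fin m → Term A) (i : Fin m)
    (as : Fin k → A.Ob) (s : Term A) :
    SEq (.tup (Function.update ts i (psub as s t)))
      (psub as (.tup (Function.update (fun j => (ts j).shift k) i s)) t) := by
  induction ht generalizing s ts with
  | tup ts =>
    refine .of_eq ?_
    simp only [psub, Term.subst, comp_update' (Term.subst _), shift_contr]
  | @sub c cs t ht v ih =>
    simp only [psub, Term.rename, comp_update' (Term.rename _), shift_lift]
    exact (SEq.tup_sub ..).trans (.sub cs (ih _ _) (.refl v))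

theorem TupHead.op_psub {t : Term A} (ht : TupHead t) {m k : ℕ} {ds : Fin m → A.Ob} {b : A.Ob}
    (f : A.Arr ds b) (ts : Fin m → Term A) (i : Fin m) (as : Fin k → A.Ob) (s : Term A) :
    SEq (.op f (Function.update ts i (psub as s t)))
      (psub as (.op f (Function.update (fun j => (ts j).shift k) i s)) t) := by
  induction ht generalizing s ts with
  | tup ts =>
    refine .of_eq ?_
    simp only [psub, Term.subst, comp_update' (Term.subst _), shift_contr]
  | @sub c cs t ht v ih =>
    simp only [psub, Term.rename, comp_update' (Term.rename _), shift_lift]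
    exact (SEq.op_sub ..).trans (.sub cs (ih _ _) (.refl v))

theorem TupHead.sub_psub_body {t : Term A} (ht : TupHead t) {l k : ℕ} (bs : Fin l → A.Ob)
    (as : Fin k → A.Ob) (s u : Term A) :
    SEq (.sub bs (psub as s (t.shift l)) u)
      (psub as (.sub bs (s.rename (swapRen k l)) (u.shift k)) t) := by
  induction ht generalizing s u with
  | tup ts =>
    refine .of_eq ?_
    simp only [psub, Term.subst, shift_tup, shift_contr, swap_contr]
  | @sub c cs t ht v ih =>
    simp only [psub, shift_sub, Term.rename, shift_lift]
    refine (SEq.sub_body ..).trans (.sub cs ?_ (.refl v))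
    rw [(ht.rename _).psub_rename, lift_swap, ← swap_lift]
    exact ih _ _

theorem lift_lift_shift (l k c : ℕ) (r : Term A) :
    (r.rename (liftRen l (· + k))).rename (liftRen l (liftRen k (· + c))) =
      (r.rename (liftRen l (· + c))).rename (liftRen l (· + k)) := by
  simp only [Term.rename_rename, liftRen_liftRen, liftRen_add]

theorem TupHead.sub_psub_arg {t : Term A} (ht : TupHead t) {l k : ℕ} (bs : Fin l → A.Ob)
    (as : Fin k → A.Ob) (r s : Term A) :
    SEq (.sub bs r (psub as s t))
      (psub as (.sub bs (r.rename (liftRen l (· + k))) s) t) := by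
  induction ht generalizing s r with
  | tup ts =>
    refine .of_eq ?_
    simp only [psub, Term.subst, liftShift_contr]
  | @sub c cs t ht v ih =>
    simp only [psub, Term.rename, lift_lift_shift]
    exact (SEq.sub_arg ..).trans (.sub cs (ih _ _) (.refl v))

theorem LamHead.papp_psub {s t : Term A} (hs : LamHead s) (ht : TupHead t) {k : ℕ}
    (as : Fin k → A.Ob) (u : Term A) :
    SEq (papp (psub as s t) u)
      (psub as (papp s (u.shift k)) t) := by
  induction ht generalizing s u with
  | tup ts =>
    refine .of_eq ?_
    simp only [psub, hs.papp_subst, shift_contr]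
  | @sub c cs t ht v ih =>
    simp only [psub, papp, hs.papp_rename, shift_lift]
    exact .sub cs (ih (hs.rename _) _) (.refl v)

theorem LamHead.papp_arg_sub {u : Term A} (hu : LamHead u) {k : ℕ} (as : Fin k → A.Ob)
    (s t : Term A) : SEq (papp u (.sub as s t)) (.sub as (papp (u.shift k) s) t) := by
  induction hu generalizing s t with
  | lam bs u => exact .sub_arg ..
  | @sub l bs u hu v ih =>
    simp only [papp, shift_sub]
    refine (SEq.sub bs (ih _ _) (.refl v)).trans ((SEq.sub_body ..).trans ?_)
    rw [Term.shift, (hu.rename _).papp_rename, lift_swap, ← Term.shift, shift_swap]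
    exact .refl _

theorem LamHead.papp_arg_psub {u t : Term A} (hu : LamHead u) (ht : TupHead t) {k : ℕ}
    (as : Fin k → A.Ob) (s : Term A) :
    SEq (papp u (psub as s t))
      (psub as (papp (u.shift k) s) t) := by
  have hu' (l : ℕ) : LamHead (u.shift l) := hu.rename _
  induction ht generalizing s u with
  | tup ts =>
    refine .of_eq ?_
    simp only [psub, (hu' _).papp_subst, shift_contr]
  | @sub c cs t ht v ih =>
    simp only [psub, (hu' _).papp_rename, shift_lift]
    exact (hu.papp_arg_sub ..).trans
      (.sub cs (ih (hu' _) _ fun l => (hu' _).rename _) (.refl v))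

theorem TupHead.psub_sub_body {w : Term A} (hw : TupHead w) {l k : ℕ} (bs : Fin l → A.Ob)
    (as : Fin k → A.Ob) (s t : Term A) :
    SEq (psub bs (.sub as s (t.shift l)) w)
      (.sub as (psub bs (s.rename (swapRen k l)) (w.shift k)) t) := by
  induction hw generalizing s t with
  | tup ts =>
    refine .of_eq ?_
    simp only [psub, Term.subst, shift_contr, shift_tup]
    rw [← swap_contr, Term.rename_rename]
    simp only [swap_swap, rename_id]
  | @sub c cs w hw v ih =>
    simp only [psub, shift_sub, Term.rename, shift_lift]
    refine (SEq.sub cs (ih _ _) (.refl v)).trans ((SEq.sub_body ..).trans ?_)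
    rw [TupHead.psub_rename (t := w.shift k) (hw.rename _), lift_lift_swap, shift_swap]
    exact .refl _

theorem TupHead.psub_psub_body {t w : Term A} (ht : TupHead t) (hw : TupHead w) {l k : ℕ}
    (bs : Fin l → A.Ob) (as : Fin k → A.Ob) (s : Term A) :
    SEq (psub bs (psub as s (t.shift l)) w)
      (psub as
        (psub bs (s.rename (swapRen k l)) (w.shift k)) t) := by
  have hw' (l : ℕ) : TupHead (w.shift l) := hw.rename _
  induction ht generalizing s w with
  | tup ts =>
    refine .of_eq ?_
    simp only [psub, (hw' _).psub_subst, shift_tup]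
    rw [swap_contr, shift_contr]
  | @sub c cs t ht v ih =>
    simp only [psub, shift_sub, (hw' _).psub_rename, shift_lift]
    refine (hw.psub_sub_body ..).trans (.sub cs ?_ (.refl v))
    rw [(ht.rename _).psub_rename, lift_swap, ← swap_lift]
    exact ih (hw' _) _ fun l => (hw' _).rename _

theorem TupHead.psub_psub_arg {s t : Term A} (hs : TupHead s) (ht : TupHead t) {l k : ℕ}
    (bs : Fin l → A.Ob) (as : Fin k → A.Ob) (r : Term A) :
    SEq (psub bs r (psub as s t))
      (psub as
        (psub bs (r.rename (liftRen l (· + k))) s) t) := by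
  induction ht generalizing s r with
  | tup ts =>
    refine .of_eq ?_
    simp only [psub, hs.psub_subst, liftShift_contr]
  | @sub c cs t ht v ih =>
    simp only [psub, hs.psub_rename, lift_lift_shift]
    exact .sub cs (ih (hs.rename _) _) (.refl v)

/-! ### Linear occurrences -/

theorem mem_sum_fv {m : ℕ} {ts : Fin m → Term A} {i : Fin m} {p : ℕ × A.Ob} (h : p ∈ fv (ts i)) :
    p ∈ ∑ j, fv (ts j) := Multiset.mem_sum.2 ⟨i, Finset.mem_univ i, h⟩

theorem shift_subst_eq {k : ℕ} {s : Term A} {σ σ' : ℕ → A.Ob → Term A}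
    (h : ∀ p ∈ fv s, σ' p.1 p.2 = (σ p.1 p.2).shift k) : s.subst σ' = (s.subst σ).shift k := by
  rw [Term.shift, rename_subst]
  exact subst_congr fun x a hx => h (x, a) hx

theorem add_eq_cons {α : Type*} {M N P : Multiset α} {p : α} (h : M + N = p ::ₘ P) :
    (∃ M', M = p ::ₘ M' ∧ P = M' + N) ∨ ∃ N', N = p ::ₘ N' ∧ P = M + N' := by
  have hp : p ∈ M + N := h ▸ Multiset.mem_cons_self p P
  rcases Multiset.mem_add.1 hp with hp | hp
  · obtain ⟨M', rfl⟩ := Multiset.exists_cons_of_mem hp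
    rw [Multiset.cons_add, Multiset.cons_inj_right] at h
    exact Or.inl ⟨M', rfl, h.symm⟩
  · obtain ⟨N', rfl⟩ := Multiset.exists_cons_of_mem hp
    rw [Multiset.add_cons, Multiset.cons_inj_right] at h
    exact Or.inr ⟨N', rfl, h.symm⟩

/-- If a variable has exactly one occurrence in `s`, then an explicit substitution in the term that
is substituted for this variable can be moved to the root. -/
theorem SEq.pull {c : ℕ} (cs : Fin c → A.Ob) (s : Term A) {σ σ' : ℕ → A.Ob → Term A} {x₀ : ℕ}
    {b₀ : A.Ob} {M : Multiset (ℕ × A.Ob)} {w t : Term A} (hM : fv s = (x₀, b₀) ::ₘ M)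
    (hσ : σ x₀ b₀ = .sub cs w t) (hσ' : σ' x₀ b₀ = w)
    (h : ∀ p ∈ M, σ' p.1 p.2 = (σ p.1 p.2).shift c) :
    SEq (s.subst σ) (.sub cs (s.subst σ') t) := by
  have under {l : ℕ} {s : Term A} {σ σ' : ℕ → A.Ob → Term A} {x₀ : ℕ}
      {b₀ : A.Ob} {M : Multiset (ℕ × A.Ob)} {w t : Term A}
      (ih : ∀ {σ σ' : ℕ → A.Ob → Term A} {x₀ : ℕ} {b₀ : A.Ob} {M : Multiset (ℕ × A.Ob)}
        {w t : Term A}, fv s = (x₀, b₀) ::ₘ M → σ x₀ b₀ = .sub cs w t → σ' x₀ b₀ = w →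
        (∀ p ∈ M, σ' p.1 p.2 = (σ p.1 p.2).shift c) → SEq (s.subst σ) (.sub cs (s.subst σ') t))
      (hM : down l (fv s) = (x₀, b₀) ::ₘ M)
      (hσ : σ x₀ b₀ = .sub cs w t) (hσ' : σ' x₀ b₀ = w)
      (h : ∀ p ∈ M, σ' p.1 p.2 = (σ p.1 p.2).shift c) :
      SEq (s.subst (liftSub l σ))
        (.sub cs ((s.subst (liftSub l σ')).rename (swapRen l c)) (t.shift l)) := by
    obtain ⟨N, hN⟩ := Multiset.exists_cons_of_mem (mem_down.1 (hM ▸ Multiset.mem_cons_self _ M))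
    have hNM : down l N = M := by
      rw [hN, ← Multiset.singleton_add, down_add] at hM
      simpa [down] using hM
    rw [rename_subst]
    refine ih hN (by rw [liftSub_add, hσ, shift_sub]) (w := w.rename (liftRen c (· + l))) ?_ ?_
    · rw [liftSub_add, hσ', shift_swap]
    · rintro ⟨x, a⟩ hx
      rcases lt_or_eq_add l x with hl | ⟨y, rfl⟩
      · simp only [liftSub_lt _ _ hl, Term.shift, Term.rename, swapRen_lt _ hl]
      · have := h (y, a) (hNM ▸ mem_down.2 hx)
        simp only at this
        simp only [liftSub_add, this, shift_swap]
        rw [Term.shift, Term.shift, Term.shift, Term.rename_rename, Term.rename_rename]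
        exact rename_congr' (fun x => by rw [liftRen_add, add_right_comm]) _
  have family {m : ℕ} {ts : Fin m → Term A} {x₀ : ℕ} {b₀ : A.Ob} {M : Multiset (ℕ × A.Ob)}
      (hM : ∑ i, fv (ts i) = (x₀, b₀) ::ₘ M) :
      ∃ i M', fv (ts i) = (x₀, b₀) ::ₘ M' ∧ (∀ p ∈ M', p ∈ M) ∧
        ∀ j, j ≠ i → ∀ p ∈ fv (ts j), p ∈ M := by
    have hp : (x₀, b₀) ∈ ∑ i, fv (ts i) := hM ▸ Multiset.mem_cons_self _ M
    obtain ⟨i, -, hi⟩ := Multiset.mem_sum.1 hp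
    obtain ⟨M', hM'⟩ := Multiset.exists_cons_of_mem hi
    rw [← Finset.add_sum_erase _ _ (Finset.mem_univ i), hM', Multiset.cons_add,
      Multiset.cons_inj_right] at hM
    refine ⟨i, M', hM', fun p hp => ?_, fun j hj p hp => ?_⟩
    · exact hM ▸ Multiset.mem_add.2 (Or.inl hp)
    · exact hM ▸ Multiset.mem_add.2
        (Or.inr (Multiset.mem_sum.2 ⟨j, Finset.mem_erase.2 ⟨hj, Finset.mem_univ j⟩, hp⟩))
  induction s generalizing σ σ' x₀ b₀ M w t with
  | var x a =>
    rw [fv, ← Multiset.cons_zero, Multiset.cons_eq_cons] at hM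
    obtain ⟨h1, -⟩ | ⟨-, N, h1, -⟩ := hM
    · cases h1
      simp only [Term.subst, hσ, hσ']
      exact .refl _
    · simp at h1
  | lam bs s ih =>
    refine (SEq.lam bs (under ih hM hσ hσ' h)).trans ((SEq.lam_sub ..).trans (.of_eq ?_))
    simp only [Term.rename_rename, swap_swap, rename_id, Term.subst]
  | app s u ihs ihu =>
    obtain ⟨M', h1, rfl⟩ | ⟨M', h1, rfl⟩ := add_eq_cons hM
    · refine (SEq.app (ihs h1 hσ hσ' fun p hp => h p (Multiset.mem_add.2 (Or.inl hp)))
        (.refl _)).trans ((SEq.app_sub ..).trans (.of_eq ?_))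
      rw [← shift_subst_eq fun p hp => h p (Multiset.mem_add.2 (Or.inr hp))]
      rfl
    · refine (SEq.app (.refl _)
        (ihu h1 hσ hσ' fun p hp => h p (Multiset.mem_add.2 (Or.inr hp)))).trans
        ((SEq.app_arg ..).trans (.of_eq ?_))
      rw [← shift_subst_eq fun p hp => h p (Multiset.mem_add.2 (Or.inl hp))]
      rfl
  | tup ts ih =>
    obtain ⟨i, M', h1, h2, h3⟩ := family hM
    have hi := ih i h1 hσ hσ' fun p hp => h p (h2 p hp)
    have e : (fun j => (ts j).subst σ') =
        Function.update (fun j => ((ts j).subst σ).shift c) i ((ts i).subst σ') := by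
      funext j
      by_cases hj : j = i
      · subst hj; simp
      · simp only [hj, ne_eq, not_false_eq_true, Function.update_of_ne]
        exact shift_subst_eq fun p hp => h p (h3 j hj p hp)
    simp only [Term.subst, e]
    refine .trans (.tup ?_) (.tup_sub _ i cs _ t)
    intro j
    by_cases hj : j = i
    · subst hj; simpa using hi
    · simpa [hj] using .refl _
  | op f ts ih =>
    obtain ⟨i, M', h1, h2, h3⟩ := family hM
    have hi := ih i h1 hσ hσ' fun p hp => h p (h2 p hp)
    have e : (fun j => (ts j).subst σ') =
        Function.update (fun j => ((ts j).subst σ).shift c) i ((ts i).subst σ') := by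
      funext j
      by_cases hj : j = i
      · subst hj; simp
      · simp only [hj, ne_eq, not_false_eq_true, Function.update_of_ne]
        exact shift_subst_eq fun p hp => h p (h3 j hj p hp)
    simp only [Term.subst, e]
    refine .trans (.op f ?_) (.op_sub f _ i cs _ t)
    intro j
    by_cases hj : j = i
    · subst hj; simpa using hi
    · simpa [hj] using .refl _
  | @sub l bs s u ihs ihu =>
    obtain ⟨M', h1, rfl⟩ | ⟨M', h1, rfl⟩ := add_eq_cons hM
    · refine (SEq.sub bs (under ihs h1 hσ hσ' fun p hp => h p (Multiset.mem_add.2 (Or.inl hp)))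
        (.refl _)).trans ((SEq.sub_body ..).trans (.of_eq ?_))
      rw [← shift_subst_eq fun p hp => h p (Multiset.mem_add.2 (Or.inr hp))]
      simp only [Term.rename_rename, swap_swap, rename_id, Term.subst]
    · refine (SEq.sub bs (.refl _)
        (ihu h1 hσ hσ' fun p hp => h p (Multiset.mem_add.2 (Or.inr hp)))).trans
        ((SEq.sub_arg ..).trans (.of_eq ?_))
      have e : s.subst (liftSub l σ') = (s.subst (liftSub l σ)).rename (liftRen l (· + c)) := by
        rw [rename_subst]
        refine subst_congr fun x a hx => ?_
        rcases lt_or_eq_add l x with hl | ⟨y, rfl⟩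
        · simp only [liftSub_lt _ _ hl, Term.rename, liftRen_lt _ hl]
        · have := h (y, a) (Multiset.mem_add.2 (Or.inl (mem_down.2 hx)))
          simp only at this
          simp only [liftSub_add, this, shift_lift]
          rfl
      simp only [Term.subst, e]

theorem shift_shift_swap (k l : ℕ) (t : Term A) :
    ((t.shift l).shift k).rename (swapRen k l) = (t.shift k).shift l := by
  simp only [Term.shift, Term.rename_rename, swapRen_add_add]
  exact rename_congr' (fun x => add_right_comm ..) t

/-! ### Contractions and structural equivalence -/

theorem LamHead.papp_congr_left {s s' : Term A} (h : SEq s s') (hs : LamHead s) (t : Term A) :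
    SEq (papp s t) (papp s' t) := by
  induction h generalizing t with
  | refl s => exact .refl _
  | symm h ih => exact (ih (h.lamHead_iff.2 hs) t).symm
  | trans h h' ih ih' => exact (ih hs t).trans (ih' (h.lamHead_iff.1 hs) t)
  | lam as h ih => exact .sub as h (.refl _)
  | sub as h h' ih ih' => exact .sub as (ih (lamHead_sub.1 hs) _) h'
  | lam_sub bs as s t => exact .sub_body ..
  | sub_body bs as s t u =>
    simp only [papp]
    refine (SEq.sub_body ..).trans (.of_eq ?_)
    rw [(lamHead_sub.1 (lamHead_sub.1 hs)).papp_rename, shift_shift_swap]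
  | sub_arg bs as r s t =>
    simp only [papp]
    refine (SEq.sub_arg ..).trans (.of_eq ?_)
    rw [(lamHead_sub.1 hs).papp_rename, shift_lift]
    rfl
  | _ => cases hs

theorem LamHead.papp_congr_right {s : Term A} (hs : LamHead s) {t t' : Term A} (h : SEq t t') :
    SEq (papp s t) (papp s t') := by
  induction hs generalizing t t' with
  | lam as s => exact .sub as (.refl s) h
  | sub as hs u ih => exact .sub as (ih (h.rename _)) (.refl u)

theorem TupHead.psub_congr_left {t : Term A} (ht : TupHead t) {k : ℕ} (as : Fin k → A.Ob)
    {s s' : Term A} (h : SEq s s') :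
    SEq (psub as s t) (psub as s' t) := by
  induction ht generalizing s s' with
  | tup ts => exact h.subst _
  | sub as hs u ih => exact .sub as (ih (h.rename _)) (.refl u)

/-- Linearity of `s` is essential here: otherwise the contraction duplicates or discards the
explicit substitutions that structural equivalence has moved into the entries of the tuple. -/
theorem TupHead.psub_congr_right {t t' : Term A} (h : SEq t t') (ht : TupHead t) {k : ℕ}
    {as : Fin k → A.Ob} (hty : WT t (.tensor as)) {s : Term A} (hl : low k (fv s) = bvs as) :
    SEq (psub as s t) (psub as s t') := by
  have hl' {s : Term A} (hl : low k (fv s) = bvs as) (ρ : ℕ → ℕ) :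
      low k (fv (s.rename (liftRen k ρ))) = bvs as := by rwa [low_fv_rename]
  induction h generalizing s with
  | refl s => exact .refl _
  | symm h ih => exact (ih (h.tupHead_iff.2 ht) ((h.wt_iff _).2 hty) hl).symm
  | trans h h' ih ih' =>
    exact (ih ht hty hl).trans (ih' (h.tupHead_iff.1 ht) ((h.wt_iff _).1 hty) hl)
  | tup h ih =>
    refine SEq.subst_right s fun x a => ?_
    rcases lt_or_eq_add k x with hx | ⟨y, rfl⟩
    · rw [contr_lt _ _ hx, contr_lt _ _ hx]
      unfold fill
      split_ifs
      · exact h _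
      · exact .refl _
    · rw [contr_add, contr_add]
      exact .refl _
  | sub bs h h' ih ih' =>
    cases hty with
    | sub h1 h2 h3 => exact .sub bs (ih (tupHead_sub.1 ht) h1 (hl' hl _)) h'
  | @tup_sub _ c ts i cs w t =>
    cases hty with
    | tup hts =>
      have hi : ((i : ℕ), as i) ∈ bvs as := mem_bvs.2 ⟨i.2, rfl⟩
      obtain ⟨M, hM⟩ := Multiset.exists_cons_of_mem (mem_low.1 (hl ▸ hi)).1
      have hne : ∀ b, ((i : ℕ), b) ∉ M := by
        intro b hb
        have h1 : low k (fv s) = ((i : ℕ), as i) ::ₘ low k M := by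
          rw [hM, ← Multiset.singleton_add, low_add, ← Multiset.singleton_add]
          simp [low]
        have h2 : bvs as = ((i : ℕ), as i) ::ₘ ∑ j ∈ Finset.univ.erase i, {((j : ℕ), as j)} := by
          rw [bvs, ← Finset.add_sum_erase _ _ (Finset.mem_univ i), Multiset.singleton_add]
        rw [h1, h2, Multiset.cons_inj_right] at hl
        have h3 : ((i : ℕ), b) ∈ low k M := mem_low.2 ⟨hb, i.2⟩
        rw [hl, Multiset.mem_sum] at h3
        obtain ⟨j, hj, h4⟩ := h3
        rw [Multiset.mem_singleton, Prod.mk.injEq] at h4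
        exact Finset.ne_of_mem_erase hj (Fin.ext h4.1.symm)
      simp only [psub, subst_rename]
      refine SEq.pull cs s hM (w := w) ?_ ?_ ?_
      · rw [contr_lt _ _ i.2, fill, dif_pos i.2]
        simp
      · rw [liftRen_lt _ i.2, contr_lt _ _ i.2, fill, dif_pos i.2]
        simp
      · rintro ⟨x, b⟩ hx
        rcases lt_or_eq_add k x with hxm | ⟨y, rfl⟩
        · have hxi : (⟨x, hxm⟩ : Fin k) ≠ i := by
            rintro rfl
            exact hne b hx
          simp only [liftRen_lt _ hxm, contr_lt _ _ hxm, fill, dif_pos hxm, ne_eq, hxi,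
            not_false_eq_true, Function.update_of_ne]
        · simp only [liftRen_add, contr_add]
          rfl
  | @sub_body l c bs cs w t u =>
    have hw : TupHead w := tupHead_sub.1 (tupHead_sub.1 ht)
    simp only [psub]
    refine (SEq.sub_body ..).trans (.of_eq ?_)
    rw [hw.psub_rename]
    simp only [Term.rename_rename]
    congr 3
    refine rename_congr' (fun x => ?_) _
    simp only [swapRen, liftRen]
    split_ifs <;> omega
  | sub_arg bs cs r w t =>
    simp only [psub]
    refine (SEq.sub_arg ..).trans (.of_eq ?_)
    rw [(tupHead_sub.1 ht).psub_rename, lift_lift_shift]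
  | _ => cases ht

/-! ### Beta-reduction modulo structural equivalence -/

/-- Many-step `β`-reduction modulo structural equivalence. Modulo `≡` a redex need not have
substitution contexts inside, and `β₂` is split into `(λx⃗ s) t → s[x⃗ := t]` and `β₁`. -/
inductive Red : Term A → Term A → Prop
  | seq {s t : Term A} (h : SEq s t) : Red s t
  | trans {s t r : Term A} (h : Red s t) (h' : Red t r) : Red s r
  | lam {k : ℕ} (as : Fin k → A.Ob) {s s' : Term A} (h : Red s s') : Red (.lam as s) (.lam as s')
  | app {s s' t t' : Term A} (h : Red s s') (h' : Red t t') : Red (.app s t) (.app s' t')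
  | tup {k : ℕ} {ts ts' : Fin k → Term A} (h : ∀ i, Red (ts i) (ts' i)) : Red (.tup ts) (.tup ts')
  | sub {k : ℕ} (as : Fin k → A.Ob) {s s' t t' : Term A} (h : Red s s') (h' : Red t t') :
      Red (.sub as s t) (.sub as s' t')
  | op {n : ℕ} {as : Fin n → A.Ob} {b : A.Ob} (f : A.Arr as b) {ts ts' : Fin n → Term A}
      (h : ∀ i, Red (ts i) (ts' i)) : Red (.op f ts) (.op f ts')
  | lam_app {k : ℕ} (as : Fin k → A.Ob) (s t : Term A) : Red (.app (.lam as s) t) (.sub as s t)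
  | sub_tup {k m : ℕ} (as : Fin k → A.Ob) (s : Term A) (ts : Fin m → Term A) :
      Red (.sub as s (.tup ts)) (s.subst (contr k ts))

theorem Red.refl (s : Term A) : Red s s := .seq (.refl s)

theorem Red.of_eq {s t : Term A} (h : s = t) : Red s t := h ▸ .refl s

theorem Red.subst {s s' : Term A} (h : Red s s') (σ : ℕ → A.Ob → Term A) :
    Red (s.subst σ) (s'.subst σ) := by
  induction h generalizing σ with
  | seq h => exact .seq (h.subst σ)
  | trans h h' ih ih' => exact (ih σ).trans (ih' σ)
  | lam as h ih => exact .lam as (ih _)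
  | app h h' ih ih' => exact .app (ih _) (ih' _)
  | tup h ih => exact .tup fun i => ih i _
  | sub as h h' ih ih' => exact .sub as (ih _) (ih' _)
  | op f h ih => exact .op f fun i => ih i _
  | lam_app as s t => exact .lam_app ..
  | sub_tup as s ts =>
    rw [contr_subst]
    exact .sub_tup ..

theorem Red.rename {s s' : Term A} (h : Red s s') (ρ : ℕ → ℕ) :
    Red (s.rename ρ) (s'.rename ρ) := by
  rw [rename_eq_subst, rename_eq_subst]
  exact h.subst _

theorem Red.subst_right (s : Term A) {σ τ : ℕ → A.Ob → Term A}
    (h : ∀ x a, Red (σ x a) (τ x a)) : Red (s.subst σ) (s.subst τ) := by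
  have lift {σ τ : ℕ → A.Ob → Term A} (h : ∀ x a, Red (σ x a) (τ x a)) (k : ℕ) (x : ℕ) (a : A.Ob) :
      Red (liftSub k σ x a) (liftSub k τ x a) := by
    rcases lt_or_eq_add k x with hk | ⟨y, rfl⟩
    · rw [liftSub_lt _ _ hk, liftSub_lt _ _ hk]; exact .refl _
    · rw [liftSub_add, liftSub_add]; exact (h y a).rename _
  induction s generalizing σ τ with
  | var x a => exact h x a
  | lam as s ih => exact .lam as (ih (lift h _))
  | app s t ihs iht => exact .app (ihs h) (iht h)
  | tup ts ih => exact .tup fun i => ih i h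
  | sub as s t ihs iht => exact .sub as (ihs (lift h _)) (iht h)
  | op f ts ih => exact .op f fun i => ih i h

theorem Red.fill_congr {m : ℕ} {ts ts' : Fin m → Term A} (h : ∀ i, Red (ts i) (ts' i)) (x : ℕ) :
    Red (fill ts x) (fill ts' x) := by
  unfold fill
  split_ifs
  · exact h _
  · exact .refl _

theorem Red.contr_congr (k : ℕ) {m : ℕ} {ts ts' : Fin m → Term A} (h : ∀ i, Red (ts i) (ts' i))
    (x : ℕ) (a : A.Ob) : Red (contr k ts x a) (contr k ts' x a) := by
  rcases lt_or_eq_add k x with hx | ⟨y, rfl⟩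
  · rw [contr_lt _ _ hx, contr_lt _ _ hx]
    exact .fill_congr h x
  · rw [contr_add, contr_add]
    exact .refl _

theorem Red.wt {s s' : Term A} (h : Red s s') {a : A.Ob} (hs : WT s a) :
    WT s' a ∧ fv s' = fv s := by
  induction h generalizing a with
  | seq h => exact ⟨(h.wt_iff a).1 hs, h.fv_eq.symm⟩
  | trans h h' ih ih' => exact ⟨(ih' (ih hs).1).1, (ih' (ih hs).1).2.trans (ih hs).2⟩
  | lam as h ih =>
    cases hs with
    | lam h1 h2 =>
      obtain ⟨i1, i2⟩ := ih h1
      exact ⟨.lam i1 (i2 ▸ h2), by rw [fv, fv, i2]⟩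
  | app h h' ih ih' =>
    cases hs with
    | app h1 h2 =>
      exact ⟨.app (ih h1).1 (ih' h2).1, by rw [fv, fv, (ih h1).2, (ih' h2).2]⟩
  | tup h ih =>
    cases hs with
    | tup h1 =>
      exact ⟨.tup fun i => (ih i (h1 i)).1, Finset.sum_congr rfl fun i _ => (ih i (h1 i)).2⟩
  | sub as h h' ih ih' =>
    cases hs with
    | sub h1 h2 h3 =>
      obtain ⟨i1, i2⟩ := ih h1
      exact ⟨.sub i1 (i2 ▸ h2) (ih' h3).1, by rw [fv, fv, i2, (ih' h3).2]⟩
  | op f h ih =>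
    cases hs with
    | op _ h1 =>
      exact ⟨.op f fun i => (ih i (h1 i)).1, Finset.sum_congr rfl fun i _ => (ih i (h1 i)).2⟩
  | lam_app as s t =>
    cases hs with
    | app h1 h2 =>
      cases h1 with
      | lam h1 h3 => exact ⟨.sub h1 h3 h2, rfl⟩
  | sub_tup as s ts =>
    cases hs with
    | sub h1 h2 h3 =>
      cases h3 with
      | tup h3 =>
        rw [contr_eq_inst]
        exact ⟨h1.subst_inst h2 h3 0, fv_inst_zero h2 ts⟩

theorem Red.tupHead {s s' : Term A} (h : Red s s') (hs : TupHead s) : TupHead s' := by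
  induction h with
  | seq h => exact h.tupHead_iff.1 hs
  | trans h h' ih ih' => exact ih' (ih hs)
  | tup h => exact .tup _
  | sub as h h' ih ih' => exact .sub as (ih (tupHead_sub.1 hs)) _
  | sub_tup as s ts => exact (tupHead_sub.1 hs).subst _
  | _ => cases hs

theorem Red.lamHead {s s' : Term A} (h : Red s s') (hs : LamHead s) : LamHead s' := by
  induction h with
  | seq h => exact h.lamHead_iff.1 hs
  | trans h h' ih ih' => exact ih' (ih hs)
  | lam h => exact .lam _ _
  | sub as h h' ih ih' => exact .sub as (ih (lamHead_sub.1 hs)) _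
  | sub_tup as s ts => exact (lamHead_sub.1 hs).subst _
  | _ => cases hs

theorem TupHead.red_psub {t : Term A} (ht : TupHead t) {k : ℕ} (as : Fin k → A.Ob) (s : Term A) :
    Red (.sub as s t) (psub as s t) := by
  induction ht generalizing s with
  | tup ts => exact .sub_tup ..
  | sub bs h u ih => exact (Red.seq (.sub_arg ..)).trans (.sub bs (ih _) (.refl u))

theorem LamHead.red_papp {s : Term A} (hs : LamHead s) (t : Term A) :
    Red (.app s t) (papp s t) := by
  induction hs generalizing t with
  | lam as s => exact .lam_app ..
  | sub bs h u ih => exact (Red.seq (.app_sub ..)).trans (.sub bs (ih _) (.refl u))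

theorem TupHead.psub_mono_left {t : Term A} (ht : TupHead t) {k : ℕ} (as : Fin k → A.Ob)
    {s s' : Term A} (h : Red s s') :
    Red (psub as s t) (psub as s' t) := by
  induction ht generalizing s s' with
  | tup ts => exact h.subst _
  | sub as hs u ih => exact .sub as (ih (h.rename _)) (.refl u)

theorem TupHead.psub_mono_right {t t' : Term A} (h : Red t t') (ht : TupHead t) {k : ℕ}
    {as : Fin k → A.Ob} (hty : WT t (.tensor as)) {s : Term A} (hl : low k (fv s) = bvs as) :
    Red (psub as s t) (psub as s t') := by
  induction h generalizing s with
  | seq h => exact .seq (ht.psub_congr_right h hty hl)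
  | trans h h' ih ih' => exact (ih ht hty hl).trans (ih' (h.tupHead ht) (h.wt hty).1 hl)
  | tup h ih => exact .subst_right s (.contr_congr k h)
  | sub bs h h' ih ih' =>
    cases hty with
    | sub h1 h2 h3 =>
      exact .sub bs (ih (tupHead_sub.1 ht) h1 (by rwa [low_fv_rename])) h'
  | @sub_tup l m bs w ts =>
    refine (Red.sub_tup ..).trans (.of_eq ?_)
    rw [(tupHead_sub.1 ht).psub_subst, liftShift_contr]
  | _ => cases ht

theorem LamHead.papp_mono_left {s s' : Term A} (h : Red s s') (hs : LamHead s) (t : Term A) :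
    Red (papp s t) (papp s' t) := by
  induction h generalizing t with
  | seq h => exact .seq (hs.papp_congr_left h t)
  | trans h h' ih ih' => exact (ih hs t).trans (ih' (h.lamHead hs) t)
  | lam as h ih => exact .sub as h (.refl t)
  | sub bs h h' ih ih' => exact .sub bs (ih (lamHead_sub.1 hs) _) h'
  | @sub_tup l m bs w ts =>
    refine (Red.sub_tup ..).trans (.of_eq ?_)
    rw [(lamHead_sub.1 hs).papp_subst, shift_contr]
  | _ => cases hs

theorem LamHead.papp_mono_right {s : Term A} (hs : LamHead s) {t t' : Term A} (h : Red t t') :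
    Red (papp s t) (papp s t') := by
  induction hs generalizing t t' with
  | lam as s => exact .sub as (.refl s) h
  | sub as hs u ih => exact .sub as (ih (h.rename _)) (.refl u)

/-! ### Complete developments -/

open Classical in
/-- The complete development of a term: all its redexes are contracted, but none of those that
these contractions create. -/
noncomputable def dev : Term A → Term A
  | .var x a => .var x a
  | .lam as s => .lam as (dev s)
  | .app s t => if LamHead s then papp (dev s) (dev t) else .app (dev s) (dev t)
  | .tup ts => .tup fun i => dev (ts i)
  | .sub as s t => if TupHead t then psub as (dev s) (dev t) else .sub as (dev s) (dev t)
  | .op f ts => .op f fun i => dev (ts i)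

theorem dev_tup {k : ℕ} (ts : Fin k → Term A) : dev (.tup ts) = .tup fun i => dev (ts i) := rfl

theorem dev_op {k : ℕ} {as : Fin k → A.Ob} {b : A.Ob} (f : A.Arr as b) (ts : Fin k → Term A) :
    dev (.op f ts) = .op f fun i => dev (ts i) := rfl

theorem dev_app_pos {s t : Term A} (h : LamHead s) : dev (.app s t) = papp (dev s) (dev t) := by
  rw [dev, if_pos h]

theorem dev_app_neg {s t : Term A} (h : ¬ LamHead s) :
    dev (.app s t) = .app (dev s) (dev t) := by
  rw [dev, if_neg h]

theorem dev_sub_pos {k : ℕ} {as : Fin k → A.Ob} {s t : Term A} (h : TupHead t) :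
    dev (.sub as s t) = psub as (dev s) (dev t) := by
  rw [dev, if_pos h]

theorem dev_sub_neg {k : ℕ} {as : Fin k → A.Ob} {s t : Term A} (h : ¬ TupHead t) :
    dev (.sub as s t) = .sub as (dev s) (dev t) := by
  rw [dev, if_neg h]

theorem red_dev (s : Term A) : Red s (dev s) := by
  induction s with
  | var x a => exact .refl _
  | lam as s ih => exact .lam as ih
  | app s t ihs iht =>
    by_cases h : LamHead s
    · rw [dev_app_pos h]
      exact (Red.app ihs iht).trans ((ihs.lamHead h).red_papp _)
    · rw [dev_app_neg h]
      exact .app ihs iht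
  | tup ts ih => exact .tup ih
  | sub as s t ihs iht =>
    by_cases h : TupHead t
    · rw [dev_sub_pos h]
      exact (Red.sub as ihs iht).trans ((iht.tupHead h).red_psub as _)
    · rw [dev_sub_neg h]
      exact .sub as ihs iht
  | op f ts ih => exact .op f ih

theorem TupHead.develop {s : Term A} (h : TupHead s) : TupHead (dev s) := (red_dev s).tupHead h

theorem LamHead.develop {s : Term A} (h : LamHead s) : LamHead (dev s) := (red_dev s).lamHead h

theorem WT.develop {s : Term A} {a : A.Ob} (h : WT s a) : WT (dev s) a := ((red_dev s).wt h).1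

theorem fv_dev {s : Term A} {a : A.Ob} (h : WT s a) : fv (dev s) = fv s := ((red_dev s).wt h).2

theorem dev_rename (s : Term A) (ρ : ℕ → ℕ) : dev (s.rename ρ) = (dev s).rename ρ := by
  induction s generalizing ρ with
  | var x a => rfl
  | lam as s ih => simp only [Term.rename, dev, ih]
  | app s t ihs iht =>
    by_cases h : LamHead s
    · rw [dev_app_pos h, h.develop.papp_rename, ← ihs, ← iht]
      exact dev_app_pos (h.rename ρ)
    · rw [dev_app_neg h, Term.rename, Term.rename, ← ihs, ← iht]
      exact dev_app_neg (mt lamHead_rename.1 h)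
  | tup ts ih => simp only [Term.rename, dev, ih]
  | sub as s t ihs iht =>
    by_cases h : TupHead t
    · rw [dev_sub_pos h, h.develop.psub_rename, ← ihs, ← iht]
      exact dev_sub_pos (h.rename ρ)
    · rw [dev_sub_neg h, Term.rename, Term.rename, ← ihs, ← iht]
      exact dev_sub_neg (mt tupHead_rename.1 h)
  | op f ts ih => simp only [Term.rename, dev, ih]

theorem dev_shift (s : Term A) (l : ℕ) : dev (s.shift l) = (dev s).shift l := dev_rename ..

theorem tupHead_shift {s : Term A} {l : ℕ} : TupHead (s.shift l) ↔ TupHead s := tupHead_rename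

theorem lamHead_shift {s : Term A} {l : ℕ} : LamHead (s.shift l) ↔ LamHead s := lamHead_rename

/-- Structural equivalence neither creates nor destroys redexes, so that complete developments are
compatible with it. -/
theorem SEq.develop {s s' : Term A} (h : SEq s s') {a : A.Ob} (hs : WT s a) :
    SEq (dev s) (dev s') := by
  induction h generalizing a with
  | refl s => exact .refl _
  | symm h ih => exact (ih ((h.wt_iff a).2 hs)).symm
  | trans h h' ih ih' => exact (ih hs).trans (ih' ((h.wt_iff a).1 hs))
  | lam as h ih => cases hs with | lam h1 h2 => exact .lam as (ih h1)
  | @app s s' t t' h h' ih ih' =>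
    cases hs with
    | app h1 h2 =>
      by_cases hh : LamHead s
      · rw [dev_app_pos hh, dev_app_pos (h.lamHead_iff.1 hh)]
        exact (hh.develop.papp_congr_left (ih h1) _).trans
          ((h.lamHead_iff.1 hh).develop.papp_congr_right (ih' h2))
      · rw [dev_app_neg hh, dev_app_neg (mt h.lamHead_iff.2 hh)]
        exact .app (ih h1) (ih' h2)
  | tup h ih => cases hs with | tup h1 => exact .tup fun i => ih i (h1 i)
  | @sub k as s s' t t' h h' ih ih' =>
    cases hs with
    | sub h1 h2 h3 =>
      by_cases hh : TupHead t
      · rw [dev_sub_pos hh, dev_sub_pos (h'.tupHead_iff.1 hh)]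
        exact (hh.develop.psub_congr_right (ih' h3) h3.develop (fv_dev h1 ▸ h2)).trans
          ((h'.tupHead_iff.1 hh).develop.psub_congr_left as (ih h1))
      · rw [dev_sub_neg hh, dev_sub_neg (mt h'.tupHead_iff.2 hh)]
        exact .sub as (ih h1) (ih' h3)
  | op f h ih => cases hs with | op _ h1 => exact .op f fun i => ih i (h1 i)
  | lam_sub bs as s t =>
    by_cases ht : TupHead t
    · rw [dev_sub_pos ht, dev, dev_sub_pos (tupHead_shift.2 ht),
        dev, dev_shift, dev_rename]
      exact ht.develop.lam_psub ..
    · rw [dev_sub_neg ht, dev, dev_sub_neg (mt tupHead_shift.1 ht),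
        dev, dev_shift, dev_rename]
      exact .lam_sub ..
  | app_sub as s t u =>
    by_cases hl : LamHead s <;> by_cases ht : TupHead t
    · rw [dev_app_pos (lamHead_sub.2 hl), dev_sub_pos ht, dev_sub_pos ht, dev_app_pos hl, dev_shift]
      exact hl.develop.papp_psub ht.develop ..
    · rw [dev_app_pos (lamHead_sub.2 hl), dev_sub_neg ht, dev_sub_neg ht, dev_app_pos hl, dev_shift]
      exact .refl _
    · rw [dev_app_neg (mt lamHead_sub.1 hl), dev_sub_pos ht, dev_sub_pos ht, dev_app_neg hl,
        dev_shift]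
      exact ht.develop.app_psub ..
    · rw [dev_app_neg (mt lamHead_sub.1 hl), dev_sub_neg ht, dev_sub_neg ht, dev_app_neg hl,
        dev_shift]
      exact .app_sub ..
  | app_arg as u s t =>
    by_cases hl : LamHead u <;> by_cases ht : TupHead t
    · rw [dev_app_pos hl, dev_sub_pos ht, dev_sub_pos ht, dev_app_pos (lamHead_shift.2 hl),
        dev_shift]
      exact hl.develop.papp_arg_psub ht.develop ..
    · rw [dev_app_pos hl, dev_sub_neg ht, dev_sub_neg ht, dev_app_pos (lamHead_shift.2 hl),
        dev_shift]
      exact hl.develop.papp_arg_sub ..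
    · rw [dev_app_neg hl, dev_sub_pos ht, dev_sub_pos ht, dev_app_neg (mt lamHead_shift.1 hl),
        dev_shift]
      exact ht.develop.app_arg_psub ..
    · rw [dev_app_neg hl, dev_sub_neg ht, dev_sub_neg ht, dev_app_neg (mt lamHead_shift.1 hl),
        dev_shift]
      exact .app_arg ..
  | tup_sub ts i as s t =>
    by_cases ht : TupHead t
    · simp only [dev_sub_pos ht, dev_tup, comp_update' dev, dev_shift]
      exact ht.develop.tup_psub ..
    · simp only [dev_sub_neg ht, dev_tup, comp_update' dev, dev_shift]
      exact .tup_sub ..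
  | op_sub f ts i as s t =>
    by_cases ht : TupHead t
    · simp only [dev_sub_pos ht, dev_op, comp_update' dev, dev_shift]
      exact ht.develop.op_psub ..
    · simp only [dev_sub_neg ht, dev_op, comp_update' dev, dev_shift]
      exact .op_sub ..
  | @sub_body l k bs as s t u =>
    by_cases hu : TupHead u <;> by_cases ht : TupHead t
    · rw [dev_sub_pos hu, dev_sub_pos ht, dev_sub_pos (tupHead_shift.2 ht),
        dev_sub_pos (tupHead_shift.2 hu), dev_shift, dev_shift, dev_rename]
      exact ht.develop.psub_psub_body hu.develop ..
    · rw [dev_sub_pos hu, dev_sub_neg ht, dev_sub_neg (mt tupHead_shift.1 ht),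
        dev_sub_pos (tupHead_shift.2 hu), dev_shift, dev_shift, dev_rename]
      exact hu.develop.psub_sub_body ..
    · rw [dev_sub_neg hu, dev_sub_pos ht, dev_sub_pos (tupHead_shift.2 ht),
        dev_sub_neg (mt tupHead_shift.1 hu), dev_shift, dev_shift, dev_rename]
      exact ht.develop.sub_psub_body ..
    · rw [dev_sub_neg hu, dev_sub_neg ht, dev_sub_neg (mt tupHead_shift.1 ht),
        dev_sub_neg (mt tupHead_shift.1 hu), dev_shift, dev_shift, dev_rename]
      exact .sub_body ..
  | @sub_arg l k bs as r s t =>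
    by_cases hs : TupHead s <;> by_cases ht : TupHead t
    · rw [dev_sub_pos (tupHead_sub.2 hs), dev_sub_pos ht, dev_sub_pos ht, dev_sub_pos hs,
        dev_rename]
      exact hs.develop.psub_psub_arg ht.develop ..
    · rw [dev_sub_pos (tupHead_sub.2 hs), dev_sub_neg ht, dev_sub_neg ht, dev_sub_pos hs,
        dev_rename]
      exact .refl _
    · rw [dev_sub_neg (mt tupHead_sub.1 hs), dev_sub_pos ht, dev_sub_pos ht, dev_sub_neg hs,
        dev_rename]
      exact ht.develop.sub_psub_arg ..
    · rw [dev_sub_neg (mt tupHead_sub.1 hs), dev_sub_neg ht, dev_sub_neg ht, dev_sub_neg hs,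
        dev_rename]
      exact .sub_arg ..

theorem app_dev_red (s t : Term A) : Red (.app (dev s) (dev t)) (dev (.app s t)) := by
  by_cases h : LamHead s
  · rw [dev_app_pos h]
    exact h.develop.red_papp _
  · rw [dev_app_neg h]
    exact .refl _

theorem sub_dev_red {k : ℕ} (as : Fin k → A.Ob) (s t : Term A) :
    Red (.sub as (dev s) (dev t)) (dev (.sub as s t)) := by
  by_cases h : TupHead t
  · rw [dev_sub_pos h]
    exact h.develop.red_psub as _
  · rw [dev_sub_neg h]
    exact .refl _

theorem dev_liftSub (k : ℕ) (σ : ℕ → A.Ob → Term A) :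
    (fun x a => dev (liftSub k σ x a)) = liftSub k fun x a => dev (σ x a) := by
  funext x a
  rcases lt_or_eq_add k x with h | ⟨y, rfl⟩
  · simp only [liftSub_lt _ _ h, dev]
  · simp only [liftSub_add, dev_shift]

theorem dev_contr (k : ℕ) {m : ℕ} (ts : Fin m → Term A) :
    (fun x a => dev (contr k ts x a)) = contr k fun i => dev (ts i) := by
  funext x a
  rcases lt_or_eq_add k x with h | ⟨y, rfl⟩
  · simp only [contr_lt _ _ h]
    exact fill_map dev ts x (by rw [dev]; exact congrArg Term.tup (funext fun i => i.elim0))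
  · simp only [contr_add, dev]

/-- Reduction is needed on the left because `dev (s.subst σ)` also contracts the redexes that the
substitution creates. -/
theorem WT.dev_subst {s : Term A} {a : A.Ob} (hs : WT s a) {σ : ℕ → A.Ob → Term A}
    (hσ : ∀ x b, (x, b) ∈ fv s → WT (σ x b) b) :
    Red ((dev s).subst fun x a => dev (σ x a))
      (dev (s.subst σ)) := by
  induction hs generalizing σ with
  | var x a => exact .refl _
  | op f hts ih => exact .op f fun i => ih i fun x b hx => hσ x b (mem_sum_fv hx)
  | tup hts ih => exact .tup fun i => ih i fun x b hx => hσ x b (mem_sum_fv hx)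
  | lam hs hl ih =>
    simp only [dev, Term.subst, ← dev_liftSub]
    exact .lam _ (ih (WT.lift hσ))
  | @app k as b s t hs ht ihs iht =>
    have ihs := ihs fun x b hx => hσ x b (Multiset.mem_add.2 (Or.inl hx))
    have iht := iht fun x b hx => hσ x b (Multiset.mem_add.2 (Or.inr hx))
    by_cases h : LamHead s
    · rw [dev_app_pos h, h.develop.papp_subst, Term.subst, dev_app_pos (h.subst σ)]
      exact (LamHead.papp_mono_left ihs (h.develop.subst _) _).trans
        ((h.subst σ).develop.papp_mono_right iht)
    · rw [dev_app_neg h]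
      exact (Red.app ihs iht).trans (app_dev_red _ _)
  | @sub k as b s t hs hl ht ihs iht =>
    have hσt : ∀ x b, (x, b) ∈ fv t → WT (σ x b) b :=
      fun x b hx => hσ x b (Multiset.mem_add.2 (Or.inr hx))
    have ihs := ihs (WT.lift fun x b hx => hσ x b (Multiset.mem_add.2 (Or.inl hx)))
    have iht := iht hσt
    rw [dev_liftSub] at ihs
    by_cases h : TupHead t
    · rw [dev_sub_pos h, h.develop.psub_subst, Term.subst, dev_sub_pos (h.subst σ)]
      refine (TupHead.psub_mono_right iht (h.develop.subst _) (ht.develop.subst ?_) ?_).trans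
        ((h.subst σ).develop.psub_mono_left as ihs)
      · exact fun x b hx => (hσt x b (fv_dev ht ▸ hx)).develop
      · rw [low_fv_subst, fv_dev hs, hl]
    · rw [dev_sub_neg h]
      exact (Red.sub as ihs iht).trans (sub_dev_red _ _ _)

/-- Complete developments are monotone for reduction. -/
theorem Red.develop {s s' : Term A} (h : Red s s') {a : A.Ob} (hs : WT s a) :
    Red (dev s) (dev s') := by
  induction h generalizing a with
  | seq h => exact .seq (h.develop hs)
  | trans h h' ih ih' => exact (ih hs).trans (ih' (h.wt hs).1)
  | lam as h ih => cases hs with | lam h1 h2 => exact .lam as (ih h1)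
  | @app s s' t t' h h' ih ih' =>
    cases hs with
    | app h1 h2 =>
      by_cases hh : LamHead s
      · rw [dev_app_pos hh, dev_app_pos (h.lamHead hh)]
        exact (LamHead.papp_mono_left (ih h1) hh.develop _).trans
          ((h.lamHead hh).develop.papp_mono_right (ih' h2))
      · rw [dev_app_neg hh]
        exact (Red.app (ih h1) (ih' h2)).trans (app_dev_red _ _)
  | tup h ih => cases hs with | tup h1 => exact .tup fun i => ih i (h1 i)
  | @sub k as s s' t t' h h' ih ih' =>
    cases hs with
    | sub h1 h2 h3 =>
      by_cases hh : TupHead t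
      · rw [dev_sub_pos hh, dev_sub_pos (h'.tupHead hh)]
        exact (TupHead.psub_mono_right (ih' h3) hh.develop h3.develop (fv_dev h1 ▸ h2)).trans
          ((h'.tupHead hh).develop.psub_mono_left as (ih h1))
      · rw [dev_sub_neg hh]
        exact (Red.sub as (ih h1) (ih' h3)).trans (sub_dev_red _ _ _)
  | op f h ih => cases hs with | op _ h1 => exact .op f fun i => ih i (h1 i)
  | lam_app as s t =>
    rw [dev_app_pos (.lam as s), dev, papp]
    exact sub_dev_red _ _ _
  | @sub_tup k m as s ts =>
    cases hs with
    | sub h1 h2 h3 =>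
      cases h3 with
      | tup h3 =>
        rw [dev_sub_pos (.tup ts), dev, psub, ← dev_contr]
        refine h1.dev_subst fun x b hx => ?_
        rcases lt_or_eq_add k x with hk | ⟨y, rfl⟩
        · obtain ⟨h, hb⟩ := mem_bvs.1 (h2 ▸ mem_low.2 ⟨hx, hk⟩ : (x, b) ∈ bvs as)
          rw [contr_lt _ _ hk, fill, dif_pos hk]
          exact (show as ⟨x, hk⟩ = b from hb) ▸ h3 ⟨x, hk⟩
        · rw [contr_add]
          exact .var _ _

/-! ### Confluence -/

theorem WT.iterate_dev {s : Term A} {a : A.Ob} (h : WT s a) (n : ℕ) : WT (dev^[n] s) a := by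
  induction n with
  | zero => exact h
  | succ n ih => rw [Function.iterate_succ_apply']; exact ih.develop

theorem fv_iterate_dev {s : Term A} {a : A.Ob} (h : WT s a) (n : ℕ) : fv (dev^[n] s) = fv s := by
  induction n with
  | zero => rfl
  | succ n ih => rw [Function.iterate_succ_apply', fv_dev (h.iterate_dev n), ih]

theorem Red.iterate_dev {s s' : Term A} (h : Red s s') {a : A.Ob} (hs : WT s a) (n : ℕ) :
    Red (dev^[n] s) (dev^[n] s') := by
  induction n with
  | zero => exact h
  | succ n ih =>
    rw [Function.iterate_succ_apply', Function.iterate_succ_apply']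
    exact ih.develop (hs.iterate_dev n)

theorem iterate_dev_red_of_le (s : Term A) {n m : ℕ} (h : n ≤ m) : Red (dev^[n] s) (dev^[m] s) := by
  induction h with
  | refl => exact .refl _
  | step h ih => exact ih.trans (by rw [Function.iterate_succ_apply']; exact red_dev _)

theorem app_iterate_dev_red {s t : Term A} {a : A.Ob} (h : WT (.app s t) a) (n : ℕ) :
    Red (.app (dev^[n] s) (dev^[n] t)) (dev^[n] (.app s t)) := by
  induction n with
  | zero => exact .refl _
  | succ n ih =>
    simp only [Function.iterate_succ_apply']
    refine (app_dev_red _ _).trans (ih.develop (a := a) ?_)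
    cases h with | app h1 h2 => exact .app (h1.iterate_dev n) (h2.iterate_dev n)

theorem sub_iterate_dev_red {k : ℕ} {as : Fin k → A.Ob} {s t : Term A} {a : A.Ob}
    (h : WT (.sub as s t) a) (n : ℕ) :
    Red (.sub as (dev^[n] s) (dev^[n] t)) (dev^[n] (.sub as s t)) := by
  induction n with
  | zero => exact .refl _
  | succ n ih =>
    simp only [Function.iterate_succ_apply']
    refine (sub_dev_red _ _ _).trans (ih.develop (a := a) ?_)
    cases h with
    | sub h1 h2 h3 =>
      exact .sub (h1.iterate_dev n) (by rwa [fv_iterate_dev h1]) (h3.iterate_dev n)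

theorem iterate_dev_lam {k : ℕ} (as : Fin k → A.Ob) (s : Term A) (n : ℕ) :
    dev^[n] (.lam as s) = .lam as (dev^[n] s) := by
  induction n with
  | zero => rfl
  | succ n ih => rw [Function.iterate_succ_apply', Function.iterate_succ_apply', ih, dev]

theorem iterate_dev_tup {k : ℕ} (ts : Fin k → Term A) (n : ℕ) :
    dev^[n] (.tup ts) = .tup fun i => dev^[n] (ts i) := by
  induction n with
  | zero => rfl
  | succ n ih => simp only [Function.iterate_succ_apply', ih, dev]

theorem iterate_dev_op {k : ℕ} {as : Fin k → A.Ob} {b : A.Ob} (f : A.Arr as b)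
    (ts : Fin k → Term A) (n : ℕ) :
    dev^[n] (.op f ts) = .op f fun i => dev^[n] (ts i) := by
  induction n with
  | zero => rfl
  | succ n ih => simp only [Function.iterate_succ_apply', ih, dev]

/-- Iterated complete developments are cofinal among the reducts of a typed term. -/
theorem Red.exists_iterate_dev {s s' : Term A} (h : Red s s') {a : A.Ob} (hs : WT s a) :
    ∃ n, Red s' (dev^[n] s) := by
  have family {m : ℕ} {ts ts' : Fin m → Term A} (h : ∀ i, ∃ n, Red (ts' i) (dev^[n] (ts i))) :
      ∃ n, ∀ i, Red (ts' i) (dev^[n] (ts i)) := by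
    choose n hn using h
    exact ⟨Finset.univ.sup n, fun i =>
      (hn i).trans (iterate_dev_red_of_le _ (Finset.le_sup (Finset.mem_univ i)))⟩
  induction h generalizing a with
  | seq h => exact ⟨0, .seq h.symm⟩
  | trans h h' ih ih' =>
    obtain ⟨n, hn⟩ := ih hs
    obtain ⟨m, hm⟩ := ih' (h.wt hs).1
    refine ⟨m + n, hm.trans ?_⟩
    rw [Function.iterate_add_apply]
    exact hn.iterate_dev (h.wt hs).1 m
  | lam as h ih =>
    cases hs with
    | lam h1 h2 =>
      obtain ⟨n, hn⟩ := ih h1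
      exact ⟨n, by rw [iterate_dev_lam]; exact .lam as hn⟩
  | app h h' ih ih' =>
    have hs' := hs
    cases hs' with
    | app h1 h2 =>
      obtain ⟨n, hn⟩ := ih h1
      obtain ⟨m, hm⟩ := ih' h2
      exact ⟨max n m, (Red.app (hn.trans (iterate_dev_red_of_le _ (le_max_left n m)))
        (hm.trans (iterate_dev_red_of_le _ (le_max_right n m)))).trans (app_iterate_dev_red hs _)⟩
  | tup h ih =>
    cases hs with
    | tup h1 =>
      obtain ⟨n, hn⟩ := family fun i => ih i (h1 i)
      exact ⟨n, by rw [iterate_dev_tup]; exact .tup hn⟩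
  | sub as h h' ih ih' =>
    have hs' := hs
    cases hs' with
    | sub h1 h2 h3 =>
      obtain ⟨n, hn⟩ := ih h1
      obtain ⟨m, hm⟩ := ih' h3
      exact ⟨max n m, (Red.sub as (hn.trans (iterate_dev_red_of_le _ (le_max_left n m)))
        (hm.trans (iterate_dev_red_of_le _ (le_max_right n m)))).trans (sub_iterate_dev_red hs _)⟩
  | op f h ih =>
    cases hs with
    | op _ h1 =>
      obtain ⟨n, hn⟩ := family fun i => ih i (h1 i)
      exact ⟨n, by rw [iterate_dev_op]; exact .op f hn⟩
  | lam_app as s t =>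
    refine ⟨1, ?_⟩
    rw [Function.iterate_one, dev_app_pos (.lam as s), dev, papp]
    exact .sub as (red_dev s) (red_dev t)
  | @sub_tup k m as s ts =>
    refine ⟨1, ?_⟩
    rw [Function.iterate_one, dev_sub_pos (.tup ts), dev, psub]
    exact ((red_dev s).subst _).trans (.subst_right _ (.contr_congr k fun i => red_dev (ts i)))

theorem Red.confluent {s r r' : Term A} (h : Red s r) (h' : Red s r') {a : A.Ob} (hs : WT s a) :
    ∃ u, Red r u ∧ Red r' u := by
  obtain ⟨n, hn⟩ := h.exists_iterate_dev hs
  obtain ⟨m, hm⟩ := h'.exists_iterate_dev hs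
  exact ⟨dev^[max n m] s, hn.trans (iterate_dev_red_of_le _ (le_max_left n m)),
    hm.trans (iterate_dev_red_of_le _ (le_max_right n m))⟩

/-! ### Joinability -/

/-- Two terms with a common reduct. On typed terms this is an equivalence relation. -/
def Join (s t : Term A) : Prop := ∃ r, Red s r ∧ Red t r

namespace Join

theorem of_red {s t : Term A} (h : Red s t) : Join s t := ⟨t, h, .refl t⟩

theorem of_seq {s t : Term A} (h : SEq s t) : Join s t := of_red (.seq h)

theorem refl (s : Term A) : Join s s := of_red (.refl s)

theorem symm {s t : Term A} (h : Join s t) : Join t s := by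
  obtain ⟨r, h1, h2⟩ := h
  exact ⟨r, h2, h1⟩

/-- Joinability is transitive by confluence. -/
theorem trans {s t u : Term A} (h : Join s t) (h' : Join t u) {a : A.Ob} (ht : WT t a) :
    Join s u := by
  obtain ⟨r, h1, h2⟩ := h
  obtain ⟨r', h3, h4⟩ := h'
  obtain ⟨q, h5, h6⟩ := h2.confluent h3 ht
  exact ⟨q, h1.trans h5, h4.trans h6⟩

theorem red_trans {s t u : Term A} (h : Red s t) (h' : Join t u) : Join s u := by
  obtain ⟨r, h1, h2⟩ := h'
  exact ⟨r, h.trans h1, h2⟩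

theorem lam {k : ℕ} (as : Fin k → A.Ob) {s s' : Term A} (h : Join s s') :
    Join (.lam as s) (.lam as s') := by
  obtain ⟨r, h1, h2⟩ := h
  exact ⟨_, .lam as h1, .lam as h2⟩

theorem app {s s' t t' : Term A} (h : Join s s') (h' : Join t t') :
    Join (.app s t) (.app s' t') := by
  obtain ⟨r, h1, h2⟩ := h
  obtain ⟨q, h3, h4⟩ := h'
  exact ⟨_, .app h1 h3, .app h2 h4⟩

theorem sub {k : ℕ} (as : Fin k → A.Ob) {s s' t t' : Term A} (h : Join s s') (h' : Join t t') :
    Join (.sub as s t) (.sub as s' t') := by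
  obtain ⟨r, h1, h2⟩ := h
  obtain ⟨q, h3, h4⟩ := h'
  exact ⟨_, .sub as h1 h3, .sub as h2 h4⟩

theorem tup {k : ℕ} {ts ts' : Fin k → Term A} (h : ∀ i, Join (ts i) (ts' i)) :
    Join (.tup ts) (.tup ts') := by
  choose r h1 h2 using h
  exact ⟨_, .tup h1, .tup h2⟩

theorem op {k : ℕ} {as : Fin k → A.Ob} {b : A.Ob} (f : A.Arr as b) {ts ts' : Fin k → Term A}
    (h : ∀ i, Join (ts i) (ts' i)) : Join (.op f ts) (.op f ts') := by
  choose r h1 h2 using h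
  exact ⟨_, .op f h1, .op f h2⟩

theorem rename {s s' : Term A} (h : Join s s') (ρ : ℕ → ℕ) :
    Join (s.rename ρ) (s'.rename ρ) := by
  obtain ⟨r, h1, h2⟩ := h
  exact ⟨_, h1.rename ρ, h2.rename ρ⟩

end Join

/-! ### Eta-expansion -/

/-- The full `η`-expansion of a term of type `a`. -/
def eta : A.Ob → Term A → Term A
  | .atom _, n => n
  | .tensor as, n => .sub as (.tup fun i => eta (as i) (.var i (as i))) n
  | .lolli (k := k) as b, n =>
    .lam as (eta b (.app (n.shift k) (.tup fun i => eta (as i) (.var i (as i)))))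

/-- The tuple `⟨x₁, …, xₖ⟩` of bound variables, fully `η`-expanded. -/
def etaTuple {k : ℕ} (as : Fin k → A.Ob) : Term A := .tup fun i => eta (as i) (.var i (as i))

theorem eta_tensor {k : ℕ} (as : Fin k → A.Ob) (n : Term A) :
    eta (.tensor as) n = .sub as (etaTuple as) n := rfl

theorem eta_lolli {k : ℕ} (as : Fin k → A.Ob) (b : A.Ob) (n : Term A) :
    eta (.lolli as b) n = .lam as (eta b (.app (n.shift k) (etaTuple as))) := rfl

theorem eta_subst (a : A.Ob) (n : Term A) (σ : ℕ → A.Ob → Term A) :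
    (eta a n).subst σ = eta a (n.subst σ) := by
  have tuple {k : ℕ} {as : Fin k → A.Ob}
      (ih : ∀ i n σ, (eta (as i) n).subst σ = eta (as i) (n.subst σ)) (σ : ℕ → A.Ob → Term A) :
      (etaTuple as).subst (liftSub k σ) = etaTuple as :=
    congrArg Term.tup (funext fun i => by rw [ih, Term.subst, liftSub_lt _ _ i.2])
  induction a generalizing n σ with
  | atom o => rfl
  | tensor as ih => rw [eta_tensor, eta_tensor, Term.subst, tuple ih]
  | lolli as b iha ihb =>
    rw [eta_lolli, eta_lolli, Term.subst, ihb, Term.subst, tuple iha, shift_subst]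

theorem eta_rename (a : A.Ob) (n : Term A) (ρ : ℕ → ℕ) :
    (eta a n).rename ρ = eta a (n.rename ρ) := by
  rw [rename_eq_subst, eta_subst, ← rename_eq_subst]

theorem etaTuple_subst {k : ℕ} (as : Fin k → A.Ob) (σ : ℕ → A.Ob → Term A) :
    (etaTuple as).subst σ = .tup fun i => eta (as i) (σ i (as i)) :=
  congrArg Term.tup (funext fun i => by rw [eta_subst, Term.subst])

theorem etaTuple_rename_lift {k : ℕ} (as : Fin k → A.Ob) (ρ : ℕ → ℕ) :
    (etaTuple as).rename (liftRen k ρ) = etaTuple as := by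
  rw [rename_eq_subst, etaTuple_subst]
  exact congrArg Term.tup (funext fun i => by rw [liftRen_lt _ i.2])

theorem etaTuple_contr {k : ℕ} (as : Fin k → A.Ob) (ts : Fin k → Term A) :
    (etaTuple as).subst (contr k ts) = .tup fun i => eta (as i) (ts i) := by
  rw [etaTuple_subst]
  exact congrArg Term.tup (funext fun i => by rw [contr_lt _ _ i.2, fill, dif_pos i.2])

theorem fv_eta (a : A.Ob) (n : Term A) : fv (eta a n) = fv n := by
  have tuple {k : ℕ} {as : Fin k → A.Ob} (ih : ∀ i n, fv (eta (as i) n) = fv n) :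
      fv (etaTuple as) = bvs as := Finset.sum_congr rfl fun i _ => ih i _
  induction a generalizing n with
  | atom o => rfl
  | tensor as ih => rw [eta_tensor, fv, tuple ih, down_bvs, zero_add]
  | lolli as b iha ihb =>
    rw [eta_lolli, fv, ihb, fv, tuple iha, down_add, down_bvs, add_zero, down_fv_shift]

theorem fv_etaTuple {k : ℕ} (as : Fin k → A.Ob) : fv (etaTuple as) = bvs as :=
  Finset.sum_congr rfl fun _ _ => fv_eta _ _

theorem WT.eta {a : A.Ob} {n : Term A} (h : WT n a) : WT (eta a n) a := by
  induction a generalizing n with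
  | atom o => exact h
  | tensor as ih =>
    exact .sub (.tup fun i => ih i (.var _ _)) (by rw [← etaTuple, fv_etaTuple, low_bvs]) h
  | lolli as b iha ihb =>
    refine .lam (ihb (.app (h.rename _) (.tup fun i => iha i (.var _ _)))) ?_
    rw [fv_eta, fv, ← etaTuple, fv_etaTuple, low_add, low_fv_shift, low_bvs, zero_add]

theorem wt_etaTuple {k : ℕ} (as : Fin k → A.Ob) : WT (etaTuple as) (.tensor as) :=
  .tup fun i => WT.eta (.var i (as i))

theorem SEq.eta (a : A.Ob) {n n' : Term A} (h : SEq n n') : SEq (eta a n) (eta a n') := by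
  induction a generalizing n n' with
  | atom o => exact h
  | tensor as ih => exact .sub as (.refl _) h
  | lolli as b iha ihb => exact .lam as (ihb (.app (h.rename _) (.refl _)))

theorem Red.eta (a : A.Ob) {n n' : Term A} (h : Red n n') : Red (eta a n) (eta a n') := by
  induction a generalizing n n' with
  | atom o => exact h
  | tensor as ih => exact .sub as (.refl _) h
  | lolli as b iha ihb => exact .lam as (ihb (.app (h.rename _) (.refl _)))

theorem Join.eta (a : A.Ob) {n n' : Term A} (h : Join n n') : Join (eta a n) (eta a n') := by
  obtain ⟨r, h1, h2⟩ := h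
  exact ⟨_, h1.eta a, h2.eta a⟩

theorem eta_sub (a : A.Ob) {k : ℕ} (cs : Fin k → A.Ob) (s t : Term A) :
    SEq (eta a (.sub cs s t)) (.sub cs (eta a s) t) := by
  induction a generalizing s t with
  | atom o => exact .refl _
  | tensor as ih =>
    rw [eta_tensor, eta_tensor]
    exact (SEq.sub_arg ..).trans (.of_eq (by rw [etaTuple_rename_lift]))
  | lolli as b iha ihb =>
    rw [eta_lolli, eta_lolli, shift_sub]
    refine (SEq.lam as (((SEq.app_sub ..).eta b).trans (ihb _ _))).trans
      ((SEq.lam_sub ..).trans (.of_eq ?_))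
    rw [eta_rename, Term.rename, lift_swap, shift_swap, etaTuple_rename_lift]

theorem sub_eta_app {k : ℕ} (as : Fin k → A.Ob) (b : A.Ob) (s t : Term A) :
    SEq (.sub as (eta b (.app (s.shift k) (etaTuple as))) t)
      (eta b (.app s (eta (.tensor as) t))) :=
  (eta_sub b as _ t).symm.trans (SEq.eta b (SEq.app_arg as s _ t).symm)

/-- An expanded function passes the expansion on to its argument and to its value. -/
theorem app_eta_red {k : ℕ} (as : Fin k → A.Ob) (b : A.Ob) (s t : Term A) :
    Red (.app (eta (.lolli as b) s) t) (eta b (.app s (eta (.tensor as) t))) :=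
  (Red.lam_app ..).trans (.seq (sub_eta_app as b s t))

theorem eta_tup_red {k : ℕ} (as : Fin k → A.Ob) (ts : Fin k → Term A) :
    Red (eta (.tensor as) (.tup ts)) (.tup fun i => eta (as i) (ts i)) := by
  rw [← etaTuple_contr]
  exact .sub_tup ..

theorem eta_lam_red {k : ℕ} (as : Fin k → A.Ob) (b : A.Ob) (s : Term A) :
    Red (eta (.lolli as b) (.lam as s)) (.lam as (eta b ((s.rename (liftRen k (· + k))).subst
      (contr k fun i => eta (as i) (.var i (as i)))))) :=
  .lam as (.eta b ((Red.lam_app ..).trans (.sub_tup ..)))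

theorem join_eta_eta {a : A.Ob} {n : Term A} (h : WT n a) :
    Join (eta a (eta a n)) (eta a n) := by
  induction a generalizing n with
  | atom o => exact .refl _
  | @tensor k as ih =>
    have h1 : Red (eta (.tensor as) (eta (.tensor as) n))
        (.sub as (.tup fun i => eta (as i) (eta (as i) (.var i (as i)))) n) := by
      rw [eta_tensor, eta_tensor]
      refine (Red.seq (.sub_arg ..)).trans (.sub as ?_ (.refl n))
      rw [etaTuple_rename_lift]
      exact eta_tup_red _ _
    exact .red_trans h1 (.sub as (.tup fun i => ih i (.var _ _)) (.refl n))
  | @lolli k as b iha ihb =>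
    have h1 : Red (eta (.lolli as b) (eta (.lolli as b) n))
        (.lam as (eta b (eta b (.app (n.shift k)
          (.tup fun i => eta (as i) (eta (as i) (.var i (as i)))))))) := by
      rw [eta_lolli as b n]
      refine (eta_lam_red ..).trans (.of_eq ?_)
      rw [eta_rename, eta_subst, Term.rename, Term.subst, shift_lift, shift_contr,
        etaTuple_rename_lift, etaTuple_contr]
      rfl
    have hw : WT (.app (n.shift k) (etaTuple as)) b := .app (h.rename _) (wt_etaTuple as)
    exact .red_trans h1 (.lam as (.trans
      (.eta b (.eta b (.app (.refl _) (.tup fun i => iha i (.var _ _))))) (ihb hw)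
      (WT.eta (WT.eta hw))))

/-- The term in which all variables and all multiarrows are fully `η`-expanded. This suffices for
the whole term to be expanded, up to reduction: see `WT.join_eta_el`. -/
def el : Term A → Term A
  | .var x a => eta a (.var x a)
  | .lam as s => .lam as (el s)
  | .app s t => .app (el s) (el t)
  | .tup ts => .tup fun i => el (ts i)
  | .sub as s t => .sub as (el s) (el t)
  | .op (b := b) f ts => eta b (.op f fun i => el (ts i))

theorem el_rename (s : Term A) (ρ : ℕ → ℕ) : el (s.rename ρ) = (el s).rename ρ := by
  induction s generalizing ρ with
  | var x a => simp only [el, Term.rename, eta_rename]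
  | lam as s ih => simp only [el, Term.rename, ih]
  | app s t ihs iht => simp only [el, Term.rename, ihs, iht]
  | tup ts ih => simp only [el, Term.rename, ih]
  | sub as s t ihs iht => simp only [el, Term.rename, ihs, iht]
  | op f ts ih => simp only [el, Term.rename, eta_rename, ih]

theorem fv_el (s : Term A) : fv (el s) = fv s := by
  induction s with
  | var x a => rw [el, fv_eta]
  | lam as s ih => simp only [el, fv, ih]
  | app s t ihs iht => simp only [el, fv, ihs, iht]
  | tup ts ih => simp only [el, fv, ih]
  | sub as s t ihs iht => simp only [el, fv, ihs, iht]
  | op f ts ih => simp only [el, fv_eta, fv, ih]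

theorem WT.el {s : Term A} {a : A.Ob} (h : WT s a) : WT (el s) a := by
  induction h with
  | var x a => exact WT.eta (.var x a)
  | op f hts ih => exact WT.eta (.op f ih)
  | tup hts ih => exact .tup ih
  | lam hs hl ih => exact .lam ih (by rwa [fv_el])
  | app hs ht ihs iht => exact .app ihs iht
  | sub hs hl ht ihs iht => exact .sub ihs (by rwa [fv_el]) iht

/-- Expansion commutes with substitution, up to reduction. -/
theorem join_el_subst (s : Term A) {σ τ : ℕ → A.Ob → Term A}
    (h : ∀ x b, (x, b) ∈ fv s → Join (eta b (τ x b)) (el (σ x b))) :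
    Join ((el s).subst τ) (el (s.subst σ)) := by
  have lift {k : ℕ} {s : Term A} {σ τ : ℕ → A.Ob → Term A}
      (h : ∀ x b, (x, b) ∈ down k (fv s) → Join (eta b (τ x b)) (el (σ x b))) (x : ℕ) (b : A.Ob)
      (hx : (x, b) ∈ fv s) : Join (eta b (liftSub k τ x b)) (el (liftSub k σ x b)) := by
    rcases lt_or_eq_add k x with hk | ⟨y, rfl⟩
    · rw [liftSub_lt _ _ hk, liftSub_lt _ _ hk]
      exact .refl _
    · rw [liftSub_add, liftSub_add, Term.shift, Term.shift, el_rename, ← eta_rename]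
      exact (h y b (mem_down.2 hx)).rename _
  induction s generalizing σ τ with
  | var x a =>
    rw [el, eta_subst]
    exact h x a (by simp [fv])
  | lam as s ih => exact .lam as (ih (lift h))
  | app s t ihs iht =>
    exact .app (ihs fun x a hx => h x a (Multiset.mem_add.2 (Or.inl hx)))
      (iht fun x a hx => h x a (Multiset.mem_add.2 (Or.inr hx)))
  | tup ts ih => exact .tup fun i => ih i fun x a hx => h x a (mem_sum_fv hx)
  | sub as s t ihs iht =>
    exact .sub as (ihs (lift fun x a hx => h x a (Multiset.mem_add.2 (Or.inl hx))))
      (iht fun x a hx => h x a (Multiset.mem_add.2 (Or.inr hx)))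
  | op f ts ih =>
    rw [el, eta_subst]
    exact .eta _ (.op f fun i => ih i fun x a hx => h x a (mem_sum_fv hx))

/-- The substitution that `η`-expands the `k` innermost variables. -/
def etaLow (k : ℕ) : ℕ → A.Ob → Term A :=
  fun x b => if x < k then eta b (.var x b) else .var x b

/-- In a redex that arises from an expansion, the contraction expands the bound variables. -/
theorem subst_contr_eta {k : ℕ} {as : Fin k → A.Ob} {s : Term A} (hl : low k (fv s) = bvs as) :
    (s.rename (liftRen k (· + k))).subst (contr k fun i => eta (as i) (.var i (as i))) =
      s.subst (etaLow k) := by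
  rw [subst_rename]
  refine subst_congr fun x b hx => ?_
  rcases lt_or_eq_add k x with hk | ⟨y, rfl⟩
  · obtain ⟨h, hb⟩ := mem_bvs.1 (hl ▸ mem_low.2 ⟨hx, hk⟩ : (x, b) ∈ bvs as)
    simp only at hb
    rw [liftRen_lt _ hk, contr_lt _ _ hk, fill, dif_pos hk, etaLow, if_pos hk, hb]
  · rw [liftRen_add, contr_add, etaLow, if_neg (by omega)]

theorem join_el_etaLow (k : ℕ) (s : Term A) : Join ((el s).subst (etaLow k)) (el s) := by
  have := join_el_subst s (σ := fun x b => .var x b) (τ := etaLow k) fun x b _ => ?_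
  · rwa [subst_var] at this
  · unfold etaLow
    split_ifs
    · exact join_eta_eta (.var x b)
    · exact .refl _

/-- Expanded terms are invariant under `η`-expansion. -/
theorem WT.join_eta_el {s : Term A} {a : A.Ob} (h : WT s a) :
    Join (ResourceCalculus.eta a (ResourceCalculus.el s)) (ResourceCalculus.el s) := by
  induction h with
  | var x a => exact join_eta_eta (.var x a)
  | op f hts ih => exact join_eta_eta (.op f fun i => (hts i).el)
  | tup hts ih => exact .red_trans (eta_tup_red _ _) (.tup ih)
  | @lam k as b s hs hl ih =>
    rw [ResourceCalculus.el]
    refine .red_trans (eta_lam_red ..) ?_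
    rw [subst_contr_eta (by rwa [fv_el])]
    refine .lam as (.trans (.eta b (join_el_etaLow k s)) ih hs.el.eta)
  | @app k as b s t hs ht ihs iht =>
    rw [ResourceCalculus.el]
    exact .trans (.trans (.eta b (.app (.refl _) iht.symm))
      (Join.of_red (app_eta_red as b _ _)).symm (WT.eta (.app hs.el ht.el.eta)))
      (.app ihs (.refl _)) (.app hs.el.eta ht.el)
  | sub hs hl ht ihs iht =>
    exact .red_trans (.seq (eta_sub ..)) (.sub _ ihs (.refl _))

theorem SEq.el {s s' : Term A} (h : SEq s s') : SEq (el s) (el s') := by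
  induction h with
  | refl s => exact .refl _
  | symm h ih => exact ih.symm
  | trans h h' ih ih' => exact ih.trans ih'
  | lam as h ih => exact .lam as ih
  | app h h' ih ih' => exact .app ih ih'
  | tup h ih => exact .tup ih
  | sub as h h' ih ih' => exact .sub as ih ih'
  | op f h ih => exact .eta _ (.op f ih)
  | lam_sub bs as s t =>
    simp only [ResourceCalculus.el, Term.shift, el_rename]
    exact .lam_sub ..
  | app_sub as s t u =>
    simp only [ResourceCalculus.el, Term.shift, el_rename]
    exact .app_sub ..
  | app_arg as u s t =>
    simp only [ResourceCalculus.el, Term.shift, el_rename]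
    exact .app_arg ..
  | tup_sub ts i as s t =>
    simp only [ResourceCalculus.el, comp_update' ResourceCalculus.el, Term.shift, el_rename]
    exact .tup_sub ..
  | op_sub f ts i as s t =>
    simp only [ResourceCalculus.el, comp_update' ResourceCalculus.el, Term.shift, el_rename]
    exact (SEq.eta _ (.op_sub ..)).trans (eta_sub ..)
  | sub_body bs as s t u =>
    simp only [ResourceCalculus.el, Term.shift, el_rename]
    exact .sub_body ..
  | sub_arg bs as r s t =>
    simp only [ResourceCalculus.el, el_rename]
    exact .sub_arg ..

theorem Red.join_el {s s' : Term A} (h : Red s s') {a : A.Ob} (hs : WT s a) :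
    Join (el s) (el s') := by
  induction h generalizing a with
  | seq h => exact .of_seq h.el
  | trans h h' ih ih' => exact (ih hs).trans (ih' (h.wt hs).1) (h.wt hs).1.el
  | lam as h ih => cases hs with | lam h1 h2 => exact .lam as (ih h1)
  | app h h' ih ih' => cases hs with | app h1 h2 => exact .app (ih h1) (ih' h2)
  | tup h ih => cases hs with | tup h1 => exact .tup fun i => ih i (h1 i)
  | sub as h h' ih ih' => cases hs with | sub h1 h2 h3 => exact .sub as (ih h1) (ih' h3)
  | op f h ih => cases hs with | op _ h1 => exact .eta _ (.op f fun i => ih i (h1 i))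
  | lam_app as s t => exact .of_red (.lam_app ..)
  | @sub_tup k m as s ts =>
    cases hs with
    | sub h1 h2 h3 =>
      cases h3 with
      | tup h3 =>
        refine .red_trans (.sub_tup ..) (join_el_subst s fun x b hx => ?_)
        rcases lt_or_eq_add k x with hk | ⟨y, rfl⟩
        · obtain ⟨h, hb⟩ := mem_bvs.1 (h2 ▸ mem_low.2 ⟨hx, hk⟩ : (x, b) ∈ bvs as)
          rw [contr_lt _ _ hk, contr_lt _ _ hk, fill, dif_pos hk, fill, dif_pos hk]
          exact (show as ⟨x, hk⟩ = b from hb) ▸ (h3 ⟨x, hk⟩).join_eta_el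
        · rw [contr_add, contr_add]
          exact .refl _

/-! ### The steps of `→_aut` -/

theorem isLT_iff {s : Term A} : IsLT s ↔ TupHead s := by
  constructor
  · rintro ⟨L, k, ts, hL, rfl⟩
    induction L with
    | hole => exact .tup ts
    | subBody as L t ih => exact .sub as (ih hL) t
    | _ => cases hL
  · intro h
    induction h with
    | @tup k ts => exact ⟨.hole, k, ts, trivial, rfl⟩
    | sub as h t ih =>
      obtain ⟨L, k, ts, hL, rfl⟩ := ih
      exact ⟨.subBody as L t, k, ts, hL, rfl⟩

theorem isAT_iff {s : Term A} : IsAT s ↔ LamHead s := by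
  constructor
  · rintro ⟨L, k, as, t, hL, rfl⟩
    induction L with
    | hole => exact .lam as t
    | subBody as L t ih => exact .sub as (ih hL) t
    | _ => cases hL
  · intro h
    induction h with
    | @lam k as s => exact ⟨.hole, k, as, s, trivial, rfl⟩
    | sub as h t ih =>
      obtain ⟨L, k, bs, s, hL, rfl⟩ := ih
      exact ⟨.subBody as L t, k, bs, s, hL, rfl⟩

theorem Ctx.IsL.rename {L : Ctx A} (hL : L.IsL) (ρ : ℕ → ℕ) : (L.rename ρ).IsL := by
  induction L generalizing ρ with
  | hole => trivial
  | subBody as L t ih => exact ih hL _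
  | _ => cases hL

theorem shift_plug (C : Ctx A) (s : Term A) (d : ℕ) :
    (C.plug s).shift d = (C.shift d).plug (s.rename (liftRen C.depth (· + d))) :=
  Ctx.rename_plug ..

theorem inst_lift {k : ℕ} (s : Term A) (ts : Fin k → Term A) (d l : ℕ) :
    (s.rename (liftRen k (· + l))).subst (inst ts d) = s.subst (inst ts (d + l)) := by
  rw [subst_rename]
  refine subst_congr' (fun x a => ?_) s
  rcases lt_or_eq_add k x with h | ⟨y, rfl⟩
  · rw [liftRen_lt _ h, inst_lt _ _ _ h, inst_lt _ _ _ h]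
  · rw [liftRen_add, inst_add, inst_add, add_assoc, add_comm l d]

theorem Red.plug (C : Ctx A) {s s' : Term A} (h : Red s s') : Red (C.plug s) (C.plug s') := by
  have update {m : ℕ} (ts : Fin m → Term A) (i : Fin m) {s s' : Term A} (h : Red s s')
      (j : Fin m) : Red (Function.update ts i s j) (Function.update ts i s' j) := by
    by_cases hj : j = i
    · subst hj; simpa using h
    · simpa [hj] using .refl _
  induction C with
  | hole => exact h
  | tup ts i C ih => exact .tup (update ts i ih)
  | subBody as C t ih => exact .sub as ih (.refl _)
  | subArg as r C ih => exact .sub as (.refl _) ih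
  | appFun C t ih => exact .app ih (.refl _)
  | appArg r C ih => exact .app (.refl _) ih
  | lam as C ih => exact .lam as ih
  | op f ts i C ih => exact .op f (update ts i ih)

theorem red_beta1 {L : Ctx A} (hL : L.IsL) {k : ℕ} (as : Fin k → A.Ob) (s : Term A)
    (ts : Fin k → Term A) :
    Red (.sub as s (L.plug (.tup ts))) (L.plug (s.subst (inst ts L.depth))) := by
  induction L generalizing s with
  | hole =>
    rw [Ctx.depth, ← contr_eq_inst]
    exact .sub_tup ..
  | subBody bs L t ih =>
    refine (Red.seq (.sub_arg ..)).trans (.sub bs ((ih hL _).trans (.of_eq ?_)) (.refl t))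
    rw [inst_lift]
    rfl
  | _ => cases hL

theorem red_lam_app {L : Ctx A} (hL : L.IsL) {k : ℕ} (as : Fin k → A.Ob) (s t : Term A) :
    Red (.app (L.plug (.lam as s)) t) (L.plug (.sub as s (t.shift L.depth))) := by
  induction L generalizing t with
  | hole =>
    rw [Ctx.depth, shift_zero]
    exact .lam_app ..
  | subBody bs L u ih =>
    rw [Ctx.depth, shift_add]
    exact (Red.seq (.app_sub ..)).trans (.sub bs (ih hL _) (.refl u))
  | _ => cases hL

/-- A `β₂`-step consists of the creation of an explicit substitution and of a `β₁`-step. -/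
theorem Beta2Root.factor {x y : Term A} (h : Beta2Root x y) :
    ∃ (L : Ctx A) (k : ℕ) (as : Fin k → A.Ob) (s t r : Term A), L.IsL ∧
      x = .app (L.plug (.lam as s)) t ∧ y = L.plug r ∧
      Beta1Root (.sub as s (t.shift L.depth)) r := by
  obtain ⟨as, s, L, L', hL, hL', ts⟩ := h
  refine ⟨L, _, as, s, _, _, hL, rfl, rfl, ?_⟩
  rw [shift_plug]
  have := Beta1Root.mk as s (L'.shift L.depth) (hL'.rename _)
    fun i => (ts i).rename (liftRen L'.depth (· + L.depth))
  rwa [Ctx.shift, Ctx.depth_rename] at this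

theorem Beta1Root.red {s s' : Term A} (h : Beta1Root s s') : Red s s' := by
  obtain ⟨as, s, L, hL, ts⟩ := h
  exact red_beta1 hL as s ts

theorem Beta2Root.red {s s' : Term A} (h : Beta2Root s s') : Red s s' := by
  obtain ⟨L, k, as, s, t, r, hL, rfl, rfl, h1⟩ := h.factor
  exact (red_lam_app hL as s t).trans (h1.red.plug L)

theorem WT.plug {r r' : Term A} (h : ∀ a, WT r a → WT r' a ∧ fv r' = fv r) (C : Ctx A)
    {a : A.Ob} (hC : WT (C.plug r) a) : WT (C.plug r') a ∧ fv (C.plug r') = fv (C.plug r) := by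
  induction C generalizing a with
  | hole => exact h a hC
  | tup ts i C ih =>
    cases hC with
    | tup hts =>
      obtain ⟨h1, h2⟩ := wt_update_iff.1 hts
      exact ⟨.tup (wt_update_iff.2 ⟨(ih h1).1, h2⟩), by
        simp only [Ctx.plug, fv, sum_update fv, (ih h1).2]⟩
  | subBody as C t ih =>
    cases hC with
    | sub h1 h2 h3 =>
      obtain ⟨i1, i2⟩ := ih h1
      exact ⟨.sub i1 (i2 ▸ h2) h3, by simp only [Ctx.plug, fv, i2]⟩
  | subArg as s C ih =>
    cases hC with
    | sub h1 h2 h3 => exact ⟨.sub h1 h2 (ih h3).1, by simp only [Ctx.plug, fv, (ih h3).2]⟩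
  | appFun C t ih =>
    cases hC with
    | app h1 h2 => exact ⟨.app (ih h1).1 h2, by simp only [Ctx.plug, fv, (ih h1).2]⟩
  | appArg s C ih =>
    cases hC with
    | app h1 h2 => exact ⟨.app h1 (ih h2).1, by simp only [Ctx.plug, fv, (ih h2).2]⟩
  | lam as C ih =>
    cases hC with
    | lam h1 h2 =>
      obtain ⟨i1, i2⟩ := ih h1
      exact ⟨.lam i1 (i2 ▸ h2), by simp only [Ctx.plug, fv, i2]⟩
  | op f ts i C ih =>
    cases hC with
    | op _ hts =>
      obtain ⟨h1, h2⟩ := wt_update_iff.1 hts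
      exact ⟨.op f (wt_update_iff.2 ⟨(ih h1).1, h2⟩), by
        simp only [Ctx.plug, fv, sum_update fv, (ih h1).2]⟩

theorem Join.el_plug {s s' : Term A} (h : Join (el s) (el s')) (C : Ctx A) :
    Join (el (C.plug s)) (el (C.plug s')) := by
  have update {m : ℕ} (ts : Fin m → Term A) (i : Fin m) {s s' : Term A} (h : Join (el s) (el s'))
      (j : Fin m) : Join (el (Function.update ts i s j)) (el (Function.update ts i s' j)) := by
    by_cases hj : j = i
    · subst hj; simpa using h
    · simpa [hj] using .refl _
  induction C with
  | hole => exact h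
  | tup ts i C ih => exact .tup (update ts i ih)
  | subBody as C t ih => exact .sub as ih (.refl _)
  | subArg as r C ih => exact .sub as (.refl _) ih
  | appFun C t ih => exact .app ih (.refl _)
  | appArg r C ih => exact .app (.refl _) ih
  | lam as C ih => exact .lam as ih
  | op f ts i C ih => exact .eta _ (.op f (update ts i ih))

theorem fv_boundTuple {k : ℕ} (as : Fin k → A.Ob) : fv (boundTuple as) = bvs as := rfl

theorem wt_boundTuple {k : ℕ} (as : Fin k → A.Ob) : WT (boundTuple as) (.tensor as) :=
  .tup fun i => .var i (as i)

theorem el_boundTuple {k : ℕ} (as : Fin k → A.Ob) : el (boundTuple as) = etaTuple as := rfl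

theorem el_shift (s : Term A) (k : ℕ) : el (s.shift k) = (el s).shift k := el_rename ..

theorem WT.eta1 {k : ℕ} {as : Fin k → A.Ob} {s : Term A} (h : WT s (.tensor as)) :
    WT (.sub as (boundTuple as) s) (.tensor as) :=
  .sub (wt_boundTuple as) (low_bvs as) h

theorem fv_eta1 {k : ℕ} (as : Fin k → A.Ob) (s : Term A) :
    fv (.sub as (boundTuple as) s) = fv s := by
  rw [fv, fv_boundTuple, down_bvs, zero_add]

theorem low_fv_app_boundTuple {k : ℕ} (as : Fin k → A.Ob) (s : Term A) :
    low k (fv (.app (s.shift k) (boundTuple as))) = bvs as := by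
  rw [fv, low_add, low_fv_shift, fv_boundTuple, low_bvs, zero_add]

theorem WT.eta2 {k : ℕ} {as : Fin k → A.Ob} {b : A.Ob} {s : Term A} (h : WT s (.lolli as b)) :
    WT (.lam as (.app (s.shift k) (boundTuple as))) (.lolli as b) :=
  .lam (.app (h.rename _) (wt_boundTuple as)) (low_fv_app_boundTuple as s)

theorem fv_eta2 {k : ℕ} (as : Fin k → A.Ob) (s : Term A) :
    fv (.lam as (.app (s.shift k) (boundTuple as))) = fv s := by
  rw [fv, fv, down_add, down_fv_shift, fv_boundTuple, down_bvs, add_zero]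

/-- The reduction `→_aut` preserves types and free variables. -/
theorem Step.wt {s s' : Term A} (h : Step s s') {a : A.Ob} (hs : WT s a) :
    WT s' a ∧ fv s' = fv s := by
  cases h with
  | beta1 C h => exact WT.plug (fun _ => h.red.wt) C hs
  | beta2 C h => exact WT.plug (fun _ => h.red.wt) C hs
  | eta1 E hE h =>
    refine WT.plug (fun b hb => ?_) E hs
    obtain ⟨as, s, γ, hγ, -⟩ := h
    obtain rfl := hb.unique hγ.wt.1
    exact ⟨hb.eta1, fv_eta1 ..⟩
  | eta2 D hD h =>
    refine WT.plug (fun b hb => ?_) D hs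
    obtain ⟨as, c, s, γ, hγ, -⟩ := h
    obtain rfl := hb.unique hγ.wt.1
    exact ⟨hb.eta2, fv_eta2 ..⟩

theorem WT.join_el_eta2 {k : ℕ} {as : Fin k → A.Ob} {b : A.Ob} {s : Term A}
    (h : WT s (.lolli as b)) :
    Join (ResourceCalculus.el s)
      (ResourceCalculus.el (.lam as (.app (s.shift k) (boundTuple as)))) := by
  have h1 := (WT.app (h.rename (· + k)) (wt_boundTuple as)).join_eta_el
  rw [ResourceCalculus.el, el_boundTuple] at h1
  rw [ResourceCalculus.el, ResourceCalculus.el, el_boundTuple, el_shift]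
  refine h.join_eta_el.symm.trans (.lam as ?_) h.el.eta
  rw [← el_shift]
  exact h1

/-- A `β`-step is a reduction also between the expanded terms, and an `η`-step disappears up to
reduction, because expanded terms are invariant under expansion. -/
theorem Step.join_el {s s' : Term A} (h : Step s s') {a : A.Ob} (hs : WT s a) :
    Join (el s) (el s') := by
  cases h with
  | beta1 C h => exact (h.red.plug C).join_el hs
  | beta2 C h => exact (h.red.plug C).join_el hs
  | eta1 E hE h =>
    refine .el_plug ?_ E
    obtain ⟨as, s, γ, hγ, -⟩ := h
    exact hγ.wt.1.join_eta_el.symm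
  | eta2 D hD h =>
    refine .el_plug ?_ D
    obtain ⟨as, b, s, γ, hγ, -⟩ := h
    exact hγ.wt.1.join_el_eta2

/-! ### Eta-long terms -/

/-- The typed terms in which no subterm is subject to `η`-expansion. A flag records the position:
it is `false` for the argument `t` of `s[x⃗ := t]` and for the function `s` of `s t`, where the term
itself must not be expanded, and `true` elsewhere. A variable, an application or a multiarrow at a
position with flag `true` must be of atomic type. -/
inductive Long : Bool → Term A → A.Ob → Prop
  | var {r : Bool} (x : ℕ) (a : A.Ob) (h : r = true → ∃ o, a = .atom o) : Long r (.var x a) a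
  | op {r : Bool} {n : ℕ} {as : Fin n → A.Ob} {b : A.Ob} (f : A.Arr as b) {ts : Fin n → Term A}
      (hts : ∀ i, Long true (ts i) (as i)) (h : r = true → ∃ o, b = .atom o) : Long r (.op f ts) b
  | app {r : Bool} {k : ℕ} {as : Fin k → A.Ob} {b : A.Ob} {s t : Term A}
      (hs : Long false s (.lolli as b)) (ht : Long true t (.tensor as))
      (h : r = true → ∃ o, b = .atom o) : Long r (.app s t) b
  | tup {r : Bool} {k : ℕ} {as : Fin k → A.Ob} {ts : Fin k → Term A}
      (hts : ∀ i, Long true (ts i) (as i)) : Long r (.tup ts) (.tensor as)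
  | lam {r : Bool} {k : ℕ} {as : Fin k → A.Ob} {b : A.Ob} {s : Term A}
      (hs : Long true s b) (hl : low k (fv s) = bvs as) : Long r (.lam as s) (.lolli as b)
  | sub {r : Bool} {k : ℕ} {as : Fin k → A.Ob} {b : A.Ob} {s t : Term A}
      (hs : Long true s b) (hl : low k (fv s) = bvs as) (ht : Long false t (.tensor as)) :
      Long r (.sub as s t) b

namespace Long

theorem wt {r : Bool} {s : Term A} {a : A.Ob} (h : Long r s a) : WT s a := by
  induction h with
  | var x a h => exact .var x a
  | op f hts h ih => exact .op f ih
  | app hs ht h ihs iht => exact .app ihs iht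
  | tup hts ih => exact .tup ih
  | lam hs hl ih => exact .lam ih hl
  | sub hs hl ht ihs iht => exact .sub ihs hl iht

theorem of_true {s : Term A} {a : A.Ob} (h : Long true s a) (r : Bool) : Long r s a := by
  cases h with
  | var x a h => exact .var x a fun _ => h rfl
  | op f hts h => exact .op f hts fun _ => h rfl
  | app hs ht h => exact .app hs ht fun _ => h rfl
  | tup hts => exact .tup hts
  | lam hs hl => exact .lam hs hl
  | sub hs hl ht => exact .sub hs hl ht

theorem tupHead {s : Term A} {k : ℕ} {as : Fin k → A.Ob} (h : Long true s (.tensor as)) :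
    TupHead s := by
  induction s with
  | tup ts => exact .tup ts
  | sub bs s t ihs => cases h with | sub hs hl ht => exact .sub bs (ihs hs) t
  | var x b => cases h with | var _ _ h => obtain ⟨o, ho⟩ := h rfl; cases ho
  | op f ts => cases h with | op _ hts h => obtain ⟨o, ho⟩ := h rfl; cases ho
  | app s t => cases h with | app hs ht h => obtain ⟨o, ho⟩ := h rfl; cases ho
  | lam bs s => cases h

theorem lamHead {s : Term A} {k : ℕ} {as : Fin k → A.Ob} {b : A.Ob}
    (h : Long true s (.lolli as b)) : LamHead s := by
  induction s with
  | lam bs s => exact .lam bs s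
  | sub bs s t ihs => cases h with | sub hs hl ht => exact .sub bs (ihs hs) t
  | var x b => cases h with | var _ _ h => obtain ⟨o, ho⟩ := h rfl; cases ho
  | op f ts => cases h with | op _ hts h => obtain ⟨o, ho⟩ := h rfl; cases ho
  | app s t => cases h with | app hs ht h => obtain ⟨o, ho⟩ := h rfl; cases ho
  | tup ts => cases h

theorem rename {r : Bool} {s : Term A} {a : A.Ob} (h : Long r s a) (ρ : ℕ → ℕ) :
    Long r (s.rename ρ) a := by
  induction h generalizing ρ with
  | var x a h => exact .var _ a h
  | op f hts h ih => exact .op f (fun i => ih i ρ) h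
  | app hs ht h ihs iht => exact .app (ihs ρ) (iht ρ) h
  | tup hts ih => exact .tup fun i => ih i ρ
  | lam hs hl ih => exact .lam (ih _) (by rwa [low_fv_rename])
  | sub hs hl ht ihs iht => exact .sub (ihs _) (by rwa [low_fv_rename]) (iht ρ)

theorem subst {r : Bool} {s : Term A} {a : A.Ob} (h : Long r s a) {σ : ℕ → A.Ob → Term A}
    (hσ : ∀ x b, (x, b) ∈ fv s → Long true (σ x b) b ∨ ∃ y, σ x b = .var y b) :
    Long r (s.subst σ) a := by
  have lift {k : ℕ} {s : Term A} {σ : ℕ → A.Ob → Term A}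
      (hσ : ∀ x b, (x, b) ∈ down k (fv s) → Long true (σ x b) b ∨ ∃ y, σ x b = .var y b) (x : ℕ)
      (b : A.Ob) (hx : (x, b) ∈ fv s) :
      Long true (liftSub k σ x b) b ∨ ∃ y, liftSub k σ x b = .var y b := by
    rcases lt_or_eq_add k x with hk | ⟨y, rfl⟩
    · exact .inr ⟨x, liftSub_lt _ _ hk⟩
    · rw [liftSub_add]
      rcases hσ y b (mem_down.2 hx) with h | ⟨z, hz⟩
      · exact .inl (h.rename _)
      · exact .inr ⟨z + k, by rw [hz]; rfl⟩
  induction h generalizing σ with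
  | var x a h =>
    rw [Term.subst]
    rcases hσ x a (by simp [fv]) with h' | ⟨y, hy⟩
    · exact h'.of_true _
    · rw [hy]
      exact .var y a h
  | op f hts h ih => exact .op f (fun i => ih i fun x b hx => hσ x b (mem_sum_fv hx)) h
  | app hs ht h ihs iht =>
    exact .app (ihs fun x b hx => hσ x b (Multiset.mem_add.2 (Or.inl hx)))
      (iht fun x b hx => hσ x b (Multiset.mem_add.2 (Or.inr hx))) h
  | tup hts ih => exact .tup fun i => ih i fun x b hx => hσ x b (mem_sum_fv hx)
  | lam hs hl ih => exact .lam (ih (lift hσ)) (by rwa [low_fv_subst])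
  | sub hs hl ht ihs iht =>
    exact .sub (ihs (lift fun x b hx => hσ x b (Multiset.mem_add.2 (Or.inl hx))))
      (by rwa [low_fv_subst]) (iht fun x b hx => hσ x b (Multiset.mem_add.2 (Or.inr hx)))

/-- Full expansion does not change a long term, up to reduction; a term that is long but for its
head is changed by the expansion of the head. -/
theorem join {r : Bool} {s : Term A} {a : A.Ob} (h : Long r s a) :
    Join (el s) (eta a s) ∧ (r = true → Join (el s) s) := by
  have of_join {r : Bool} {s : Term A} {a : A.Ob} (hw : WT s a) (h : Join (el s) s) :
      Join (el s) (ResourceCalculus.eta a s) ∧ (r = true → Join (el s) s) :=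
    ⟨hw.join_eta_el.symm.trans (h.eta a) hw.el.eta, fun _ => h⟩
  have of_eta {r : Bool} {s : Term A} {a : A.Ob} (h : r = true → ∃ o, a = .atom o)
      (hj : Join (el s) (ResourceCalculus.eta a s)) :
      Join (el s) (ResourceCalculus.eta a s) ∧ (r = true → Join (el s) s) :=
    ⟨hj, fun hr => by obtain ⟨o, rfl⟩ := h hr; exact hj⟩
  induction h with
  | var x a h => exact of_eta h (.refl _)
  | op f hts h ih => exact of_eta h (.eta _ (.op f fun i => (ih i).2 rfl))
  | @app _ k as b s t hs ht h ihs iht =>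
    refine of_eta h ?_
    have h1 : Join (eta (.tensor as) t) t := iht.1.symm.trans (iht.2 rfl) ht.wt.el
    exact (ihs.1.app (iht.2 rfl)).trans (.red_trans (app_eta_red as b s t)
      (.eta b (.app (.refl s) h1))) (.app hs.wt.eta ht.wt)
  | tup hts ih => exact of_join (.tup fun i => (hts i).wt) (.tup fun i => (ih i).2 rfl)
  | lam hs hl ih => exact of_join (.lam hs.wt hl) (.lam _ (ih.2 rfl))
  | @sub _ k as b s t hs hl ht ihs iht =>
    have hl' : low k (fv (el s)) = bvs as := by rwa [fv_el]
    refine of_join (.sub hs.wt hl ht.wt) ?_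
    have h1 : Red (.sub as (el s) (eta (.tensor as) t))
        (.sub as ((el s).subst (etaLow k)) t) := by
      rw [eta_tensor, ← subst_contr_eta hl']
      exact (Red.seq (.sub_arg ..)).trans (.sub as (.sub_tup ..) (.refl t))
    have h2 : Join (.sub as ((el s).subst (etaLow k)) t) (.sub as (el s) t) :=
      .sub as (join_el_etaLow k s) (.refl t)
    exact (Join.sub as (.refl _) iht.1).trans ((Join.red_trans h1 h2).trans
      (.sub as (ihs.2 rfl) (.refl t)) (.sub hs.wt.el hl' ht.wt)) (.sub hs.wt.el hl' ht.wt.eta)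

theorem plug {x y : Term A} (h : ∀ r a, Long r x a → Long r y a)
    (hw : ∀ a, WT x a → WT y a ∧ fv y = fv x) (C : Ctx A) {r : Bool} {a : A.Ob}
    (hC : Long r (C.plug x) a) : Long r (C.plug y) a := by
  have update {m : ℕ} {as : Fin m → A.Ob} {ts : Fin m → Term A} {i : Fin m} {s s' : Term A}
      (h : Long true s (as i) → Long true s' (as i))
      (hts : ∀ j, Long true (Function.update ts i s j) (as j)) (j : Fin m) :
      Long true (Function.update ts i s' j) (as j) := by
    have := hts j
    by_cases hj : j = i
    · subst hj
      simp only [Function.update_self] at this ⊢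
      exact h this
    · simpa [hj] using this
  induction C generalizing r a with
  | hole => exact h r a hC
  | tup ts i C ih => cases hC with | tup hts => exact .tup (update ih hts)
  | subBody as C t ih =>
    cases hC with
    | sub h1 h2 h3 => exact .sub (ih h1) (by rwa [(WT.plug hw C h1.wt).2]) h3
  | subArg as s C ih => cases hC with | sub h1 h2 h3 => exact .sub h1 h2 (ih h3)
  | appFun C t ih => cases hC with | app h1 h2 h3 => exact .app (ih h1) h2 h3
  | appArg s C ih => cases hC with | app h1 h2 h3 => exact .app h1 (ih h2) h3
  | lam as C ih =>
    cases hC with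
    | lam h1 h2 => exact .lam (ih h1) (by rwa [(WT.plug hw C h1.wt).2])
  | op f ts i C ih => cases hC with | op _ hts h1 => exact .op f (update ih hts) h1

/-- A `β₁`-step preserves long terms, since the terms that it substitutes are entries of a
tuple, where the flag is `true`. -/
theorem beta1 {x y : Term A} (h : Beta1Root x y) {r : Bool} {a : A.Ob} (hx : Long r x a) :
    Long r y a := by
  obtain @⟨k, as, s, L, hL, ts⟩ := h
  cases hx with
  | sub hs hl ht =>
  refine of_true ?_ r
  induction L generalizing s with
  | hole =>
    cases ht with
    | tup hts =>
    refine hs.subst fun x b hx => ?_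
    rcases lt_or_eq_add k x with hk | ⟨y, rfl⟩
    · obtain ⟨h, hb⟩ := mem_bvs.1 (hl ▸ mem_low.2 ⟨hx, hk⟩ : (x, b) ∈ bvs as)
      rw [inst_lt _ _ _ hk]
      exact .inl ((show as ⟨x, hk⟩ = b from hb) ▸ hts ⟨x, hk⟩)
    · exact .inr ⟨_, inst_add ..⟩
  | @subBody l bs L t ih =>
    cases ht with
    | sub h1 h2 h3 =>
    have hl' := hl
    rw [← low_fv_rename _ _ (· + l)] at hl'
    have h4 := ih _ hL hl' (h1.of_true _) (hs.rename _)
    rw [inst_lift] at h4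
    refine .sub h4 ?_ h3
    have h5 := red_beta1 (L := L) hL as (s.rename (liftRen k (· + l))) ts
    rw [inst_lift] at h5
    rw [Ctx.depth, (h5.wt (.sub (hs.wt.rename _) hl' h1.wt)).2, fv, low_add, h2,
      low_down_fv_rename_lift, zero_add]
  | _ => cases hL

theorem lam_app {L : Ctx A} (hL : L.IsL) {k : ℕ} (as : Fin k → A.Ob) (s t : Term A) {r : Bool}
    {b : A.Ob} (h : Long r (.app (L.plug (.lam as s)) t) b) :
    Long r (L.plug (.sub as s (t.shift L.depth))) b := by
  cases h with
  | app hs ht h =>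
  refine of_true ?_ r
  clear h
  induction L generalizing t with
  | hole =>
    cases hs with
    | lam hs hl =>
    rw [Ctx.depth, shift_zero]
    exact .sub hs hl (ht.of_true _)
  | @subBody l bs L u ih =>
    cases hs with
    | sub h1 h2 h3 =>
    rw [Ctx.depth, shift_add]
    refine .sub (ih hL _ (ht.rename _) (h1.of_true _)) ?_ h3
    have h4 := (red_lam_app (L := L) hL as s (t.shift l)).wt (.app h1.wt (ht.wt.rename _))
    rw [h4.2, fv, low_add, h2, low_fv_shift, add_zero]
  | _ => cases hL

theorem beta2 {x y : Term A} (h : Beta2Root x y) {r : Bool} {a : A.Ob} (hx : Long r x a) :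
    Long r y a := by
  obtain ⟨L, k, as, s, t, q, hL, rfl, rfl, h1⟩ := h.factor
  exact (lam_app hL as s t hx).plug (fun _ _ => beta1 h1) (fun _ => h1.red.wt) L

end Long

/-! ### Beta-normal terms -/

/-- The terms without `β`-redexes modulo `≡`. -/
def BetaNF : Term A → Prop
  | .var _ _ => True
  | .lam _ s => BetaNF s
  | .app s t => ¬ LamHead s ∧ BetaNF s ∧ BetaNF t
  | .tup ts => ∀ i, BetaNF (ts i)
  | .sub _ s t => ¬ TupHead t ∧ BetaNF s ∧ BetaNF t
  | .op _ ts => ∀ i, BetaNF (ts i)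

theorem betaNF_rename {s : Term A} {ρ : ℕ → ℕ} : BetaNF (s.rename ρ) ↔ BetaNF s := by
  induction s generalizing ρ with
  | var x a => rfl
  | lam as s ih => exact ih
  | app s t ihs iht => simp only [BetaNF, Term.rename, ihs, iht, lamHead_rename]
  | tup ts ih => exact forall_congr' fun i => ih i
  | sub as s t ihs iht => simp only [BetaNF, Term.rename, ihs, iht, tupHead_rename]
  | op f ts ih => exact forall_congr' fun i => ih i

theorem betaNF_shift {s : Term A} {k : ℕ} : BetaNF (s.shift k) ↔ BetaNF s := betaNF_rename

theorem betaNF_update {m : ℕ} {ts : Fin m → Term A} {i : Fin m} {s : Term A} :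
    (∀ j, BetaNF (Function.update ts i s j)) ↔ BetaNF s ∧ ∀ j, j ≠ i → BetaNF (ts j) := by
  constructor
  · intro h
    exact ⟨by simpa using h i, fun j hj => by simpa [hj] using h j⟩
  · rintro ⟨h1, h2⟩ j
    by_cases hj : j = i
    · subst hj; simpa using h1
    · simpa [hj] using h2 j hj

theorem SEq.betaNF_iff {s s' : Term A} (h : SEq s s') : BetaNF s ↔ BetaNF s' := by
  induction h with
  | refl s => rfl
  | symm h ih => exact ih.symm
  | trans h h' ih ih' => exact ih.trans ih'
  | lam as h ih => exact ih
  | app h h' ih ih' => simp only [BetaNF, ih, ih', h.lamHead_iff]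
  | tup h ih => exact forall_congr' fun i => ih i
  | sub as h h' ih ih' => simp only [BetaNF, ih, ih', h'.tupHead_iff]
  | op f h ih => exact forall_congr' fun i => ih i
  | lam_sub bs as s t => simp only [BetaNF, Term.shift, betaNF_rename, tupHead_rename]
  | app_sub as s t u => simp only [BetaNF, betaNF_shift, lamHead_sub]; tauto
  | app_arg as u s t =>
    simp only [BetaNF, Term.shift, betaNF_rename, lamHead_rename]; tauto
  | tup_sub ts i as s t => simp only [BetaNF, betaNF_update, betaNF_shift]; tauto
  | op_sub f ts i as s t => simp only [BetaNF, betaNF_update, betaNF_shift]; tauto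
  | sub_body bs as s t u =>
    simp only [BetaNF, Term.shift, betaNF_rename, tupHead_rename]; tauto
  | sub_arg bs as r s t => simp only [BetaNF, betaNF_rename, tupHead_sub]; tauto

theorem Red.seq_of_betaNF {s s' : Term A} (h : Red s s') (hs : BetaNF s) : SEq s s' := by
  induction h with
  | seq h => exact h
  | trans h h' ih ih' =>
    have h1 := ih hs
    exact h1.trans (ih' (h1.betaNF_iff.1 hs))
  | lam as h ih => exact .lam as (ih hs)
  | app h h' ih ih' => exact .app (ih hs.2.1) (ih' hs.2.2)
  | tup h ih => exact .tup fun i => ih i (hs i)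
  | sub as h h' ih ih' => exact .sub as (ih hs.2.1) (ih' hs.2.2)
  | op f h ih => exact .op f fun i => ih i (hs i)
  | lam_app as s t => exact absurd (.lam as s) hs.1
  | sub_tup as s ts => exact absurd (.tup ts) hs.1

theorem Join.seq_of_betaNF {s s' : Term A} (h : Join s s') (hs : BetaNF s) (hs' : BetaNF s') :
    SEq s s' := by
  obtain ⟨r, h1, h2⟩ := h
  exact (h1.seq_of_betaNF hs).trans (h2.seq_of_betaNF hs').symm

/-! ### Existence of eta-long forms -/

/-- The number of constructors `⊗` and `⊸` that occur in a type. -/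
def Ty.rank {At : Type u} : Ty At → ℕ
  | .atom _ => 0
  | .tensor as => 1 + ∑ i, (as i).rank
  | .lolli as b => 1 + ∑ i, (as i).rank + b.rank

/-- The type `b` of `a = (a₁ ⊗ ⋯ ⊗ aₖ) ⊸ b`; the value at other types is irrelevant. -/
def Ty.cod {At : Type u} : Ty At → Ty At
  | .lolli _ b => b
  | a => a

namespace Term

/-- The type of a typed term. -/
def ty : Term A → A.Ob
  | var _ a => a
  | lam as s => .lolli as s.ty
  | app s _ => s.ty.cod
  | tup ts => .tensor fun i => (ts i).ty
  | sub _ s _ => s.ty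
  | op (b := b) _ _ => b

/-- A measure that decreases if a variable, an application or a multiarrow is `η`-expanded: the sum
of the ranks of the types of those subterms of this form that can be expanded. The flag has the same
meaning as in `Long`. -/
def defect : Bool → Term A → ℕ
  | r, var _ a => cond r a.rank 0
  | _, lam _ s => defect true s
  | r, app s t => cond r s.ty.cod.rank 0 + (defect false s + defect true t)
  | _, tup ts => ∑ i, defect true (ts i)
  | _, sub _ s t => defect true s + defect false t
  | r, op (b := b) _ ts => cond r b.rank 0 + ∑ i, defect true (ts i)

theorem ty_rename (s : Term A) (ρ : ℕ → ℕ) : (s.rename ρ).ty = s.ty := by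
  induction s generalizing ρ with
  | var x a => rfl
  | lam as s ih => simp only [rename, ty, ih]
  | app s t ihs iht => simp only [rename, ty, ihs]
  | tup ts ih => simp only [rename, ty, ih]
  | sub as s t ihs iht => simp only [rename, ty, ihs]
  | op f ts ih => rfl

theorem defect_rename (r : Bool) (s : Term A) (ρ : ℕ → ℕ) :
    defect r (s.rename ρ) = defect r s := by
  induction s generalizing r ρ with
  | var x a => rfl
  | lam as s ih => simp only [rename, defect, ih]
  | app s t ihs iht => simp only [rename, defect, ihs, iht, ty_rename]
  | tup ts ih => simp only [rename, defect, ih]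
  | sub as s t ihs iht => simp only [rename, defect, ihs, iht]
  | op f ts ih => simp only [rename, defect, ih]

theorem Linear.of_le {s t : Term A} (hs : s.Linear) (h : fv t ≤ fv s) : t.Linear :=
  Multiset.nodup_of_le (Multiset.map_le_map h) hs

end Term

theorem WT.ty_eq {s : Term A} {a : A.Ob} (h : WT s a) : s.ty = a := by
  induction h with
  | var x a => rfl
  | op f hts ih => rfl
  | tup hts ih => exact congrArg Ty.tensor (funext ih)
  | lam hs hl ih => rw [ty, ih]
  | app hs ht ihs iht => rw [ty, ihs, Ty.cod]
  | sub hs hl ht ihs iht => exact ihs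

theorem fv_le_sum {m : ℕ} (ts : Fin m → Term A) (i : Fin m) : fv (ts i) ≤ ∑ j, fv (ts j) :=
  Finset.single_le_sum (f := fun j => fv (ts j)) (fun _ _ => Multiset.zero_le _)
    (Finset.mem_univ i)

/-- The body of a binder is linear if the whole is. -/
theorem linear_body {k : ℕ} {as : Fin k → A.Ob} {s : Term A} (hl : low k (fv s) = bvs as)
    (h : ((down k (fv s)).map Prod.fst).Nodup) : s.Linear := by
  rw [Linear, eq_shift_add_low k (fv s), hl, Multiset.map_add, Multiset.nodup_add]
  refine ⟨?_, ?_, ?_⟩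
  · rw [Multiset.bind_singleton, Multiset.map_map]
    rw [show (Prod.fst ∘ fun p : ℕ × A.Ob => (p.1 + k, p.2)) = (· + k) ∘ Prod.fst from rfl,
      ← Multiset.map_map]
    exact h.map (add_left_injective k)
  · rw [← coe_ofTypes, Multiset.map_coe, Multiset.coe_nodup, Cxt.ofTypes, List.map_ofFn]
    exact List.nodup_ofFn.2 fun i j hij => Fin.ext hij
  · rw [Multiset.disjoint_left]
    intro x hx hx'
    obtain ⟨p, hp, rfl⟩ := Multiset.mem_map.1 hx
    obtain ⟨q, hq, hpq⟩ := Multiset.mem_map.1 hx'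
    obtain ⟨p', -, hp'⟩ := Multiset.mem_bind.1 hp
    obtain rfl := Multiset.mem_singleton.1 hp'
    obtain ⟨hq, -⟩ := mem_bvs.1 hq
    simp only at hpq
    omega

/-- An `η`-step. If the flag is `false`, then it does not expand the term itself. -/
def EtaStep (r : Bool) (s s' : Term A) : Prop :=
  ∃ (C : Ctx A) (x y : Term A), s = C.plug x ∧ s' = C.plug y ∧ (r = false → C ≠ .hole) ∧
    (C.IsE ∧ Eta1Root x y ∨ C.IsD ∧ Eta2Root x y)

namespace EtaStep

theorem step {r : Bool} {s s' : Term A} (h : EtaStep r s s') : Step s s' := by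
  obtain ⟨C, x, y, rfl, rfl, -, ⟨hC, h⟩ | ⟨hC, h⟩⟩ := h
  · exact .eta1 C hC h
  · exact .eta2 C hC h

theorem lam {r : Bool} {k : ℕ} (as : Fin k → A.Ob) {s s' : Term A} (h : EtaStep true s s') :
    EtaStep r (.lam as s) (.lam as s') := by
  obtain ⟨C, x, y, rfl, rfl, -, h⟩ := h
  exact ⟨.lam as C, x, y, rfl, rfl, nofun, h⟩

theorem app_fun {r : Bool} {s s' : Term A} (h : EtaStep false s s') (t : Term A) :
    EtaStep r (.app s t) (.app s' t) := by
  obtain ⟨C, x, y, rfl, rfl, hC, h⟩ := h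
  exact ⟨.appFun C t, x, y, rfl, rfl, nofun, h.imp_right (.imp_left fun h => ⟨hC rfl, h⟩)⟩

theorem app_arg {r : Bool} (s : Term A) {t t' : Term A} (h : EtaStep true t t') :
    EtaStep r (.app s t) (.app s t') := by
  obtain ⟨C, x, y, rfl, rfl, -, h⟩ := h
  exact ⟨.appArg s C, x, y, rfl, rfl, nofun, h⟩

theorem sub_body {r : Bool} {k : ℕ} (as : Fin k → A.Ob) {s s' : Term A} (h : EtaStep true s s')
    (t : Term A) : EtaStep r (.sub as s t) (.sub as s' t) := by
  obtain ⟨C, x, y, rfl, rfl, -, h⟩ := h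
  exact ⟨.subBody as C t, x, y, rfl, rfl, nofun, h⟩

theorem sub_arg {r : Bool} {k : ℕ} (as : Fin k → A.Ob) (s : Term A) {t t' : Term A}
    (h : EtaStep false t t') : EtaStep r (.sub as s t) (.sub as s t') := by
  obtain ⟨C, x, y, rfl, rfl, hC, h⟩ := h
  exact ⟨.subArg as s C, x, y, rfl, rfl, nofun, h.imp_left (.imp_left fun h => ⟨hC rfl, h⟩)⟩

theorem tup {r : Bool} {m : ℕ} (ts : Fin m → Term A) (i : Fin m) {s' : Term A}
    (h : EtaStep true (ts i) s') : EtaStep r (.tup ts) (.tup (Function.update ts i s')) := by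
  obtain ⟨C, x, y, hx, rfl, -, h⟩ := h
  exact ⟨.tup ts i C, x, y, by rw [Ctx.plug, ← hx, Function.update_eq_self], rfl, nofun, h⟩

theorem op {r : Bool} {m : ℕ} {as : Fin m → A.Ob} {b : A.Ob} (f : A.Arr as b)
    (ts : Fin m → Term A) (i : Fin m) {s' : Term A} (h : EtaStep true (ts i) s') :
    EtaStep r (.op f ts) (.op f (Function.update ts i s')) := by
  obtain ⟨C, x, y, hx, rfl, -, h⟩ := h
  exact ⟨.op f ts i C, x, y, by rw [Ctx.plug, ← hx, Function.update_eq_self], rfl, nofun, h⟩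

end EtaStep

/-- A variable, an application or a multiarrow that is not of atomic type can be expanded. -/
theorem WT.exists_etaStep {s : Term A} {a : A.Ob} (h : WT s a) (hs : s.Linear)
    (ha : ¬ ∃ o, a = .atom o) (hT : ¬ TupHead s) (hL : ¬ LamHead s)
    (hd : defect true s = a.rank + defect false s) :
    ∃ s', EtaStep true s s' ∧ defect true s' < defect true s := by
  obtain ⟨γ, hγ⟩ := h.exists_hasType hs
  cases a with
  | atom o => exact absurd ⟨o, rfl⟩ ha
  | tensor as =>
    refine ⟨_, ⟨.hole, s, _, rfl, rfl, nofun, .inl ⟨trivial, .mk as s γ hγ (mt isLT_iff.1 hT)⟩⟩, ?_⟩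
    rw [hd]
    simp only [Ctx.plug, boundTuple, defect, Ty.rank, cond_true]
    omega
  | lolli as b =>
    refine ⟨_, ⟨.hole, s, _, rfl, rfl, nofun,
      .inr ⟨trivial, .mk as b s γ hγ (mt isAT_iff.1 hL)⟩⟩, ?_⟩
    rw [hd]
    simp only [Ctx.plug, boundTuple, defect, Term.shift, ty_rename, defect_rename, h.ty_eq, Ty.cod,
      Ty.rank, cond_true]
    omega

theorem defect_update_lt {m : ℕ} {ts : Fin m → Term A} {i : Fin m} {s' : Term A}
    (h : defect true s' < defect true (ts i)) :
    ∑ j, defect true (Function.update ts i s' j) < ∑ j, defect true (ts j) := by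
  rw [sum_update (defect true), ← Finset.add_sum_erase _ _ (Finset.mem_univ i)]
  exact Nat.add_lt_add_right h _

/-- A term that is not long has an `η`-step that decreases the defect. The step expands a variable,
an application or a multiarrow; to expand `s[x⃗ := t]` is possible too if `s` can be expanded, but
does not decrease the defect. -/
theorem WT.long_or_etaStep {s : Term A} {a : A.Ob} (h : WT s a) (hs : s.Linear) (r : Bool) :
    Long r s a ∨ ∃ s', EtaStep r s s' ∧ defect r s' < defect r s := by
  have root {s : Term A} {a : A.Ob} {r : Bool} (h : WT s a) (hs : s.Linear) (hT : ¬ TupHead s)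
      (hL : ¬ LamHead s) (hd : defect true s = a.rank + defect false s)
      (hlong : (r = true → ∃ o, a = .atom o) → Long r s a) :
      Long r s a ∨ ∃ s', EtaStep r s s' ∧ defect r s' < defect r s := by
    by_cases ha : r = true → ∃ o, a = .atom o
    · exact .inl (hlong ha)
    · rw [Classical.not_imp] at ha
      obtain ⟨rfl, ha⟩ := ha
      exact .inr (h.exists_etaStep hs ha hT hL hd)
  induction h generalizing r with
  | var x a => exact root (.var x a) hs nofun nofun (by simp [defect]) (.var x a)
  | @op n as b f ts hts ih =>
    by_cases hlong : ∀ i, Long true (ts i) (as i)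
    · exact root (.op f hts) hs nofun nofun (by simp [defect]) (.op f hlong)
    · obtain ⟨i, hi⟩ := not_forall.1 hlong
      obtain ⟨s', h1, h2⟩ := (ih i (hs.of_le (fv_le_sum ts i)) true).resolve_left hi
      exact .inr ⟨_, h1.op f ts i, Nat.add_lt_add_left (defect_update_lt h2) _⟩
  | @tup k as ts hts ih =>
    by_cases hlong : ∀ i, Long true (ts i) (as i)
    · exact .inl (.tup hlong)
    · obtain ⟨i, hi⟩ := not_forall.1 hlong
      obtain ⟨s', h1, h2⟩ := (ih i (hs.of_le (fv_le_sum ts i)) true).resolve_left hi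
      exact .inr ⟨_, h1.tup ts i, defect_update_lt h2⟩
  | lam h hl ih =>
    rcases ih (linear_body hl hs) true with h1 | ⟨s', h1, h2⟩
    · exact .inl (.lam h1 hl)
    · exact .inr ⟨_, h1.lam _, h2⟩
  | @app k as b s t h1 h2 ih1 ih2 =>
    rcases ih1 (hs.of_le (Multiset.le_add_right _ _)) false with l1 | ⟨s', l1, l2⟩
    · rcases ih2 (hs.of_le (Multiset.le_add_left _ _)) true with l2 | ⟨t', l2, l3⟩
      · exact root (.app h1 h2) hs nofun nofun (by simp [defect, h1.ty_eq, Ty.cod]) (.app l1 l2)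
      · refine .inr ⟨_, l2.app_arg s, ?_⟩
        simp only [defect]
        omega
    · refine .inr ⟨_, l1.app_fun t, ?_⟩
      simp only [defect, h1.ty_eq, (l1.step.wt h1).1.ty_eq]
      omega
  | @sub k as b s t h1 hl h2 ih1 ih2 =>
    have hs' : ((down k (fv s)).map Prod.fst).Nodup :=
      Multiset.nodup_of_le (Multiset.map_le_map (Multiset.le_add_right _ _)) hs
    rcases ih1 (linear_body hl hs') true with l1 | ⟨s', l1, l2⟩
    · rcases ih2 (hs.of_le (Multiset.le_add_left _ _)) false with l2 | ⟨t', l2, l3⟩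
      · exact .inl (.sub l1 hl l2)
      · exact .inr ⟨_, l2.sub_arg as s, Nat.add_lt_add_left l3 _⟩
    · exact .inr ⟨_, l1.sub_body as t, Nat.add_lt_add_right l2 _⟩

theorem Step.linear {s s' : Term A} (h : Step s s') {a : A.Ob} (hw : WT s a) (hs : s.Linear) :
    s'.Linear := by
  rwa [Linear, (h.wt hw).2]

theorem WT.exists_long {s : Term A} {a : A.Ob} (h : WT s a) (hs : s.Linear) :
    ∃ s', Relation.ReflTransGen Step s s' ∧ Long true s' a := by
  induction hd : defect true s using Nat.strong_induction_on generalizing s with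
  | _ d ih =>
  subst hd
  rcases h.long_or_etaStep hs true with h1 | ⟨s', h1, h2⟩
  · exact ⟨s, .refl, h1⟩
  · obtain ⟨m, h3, h4⟩ := ih _ h2 (h1.step.wt h).1 (h1.step.linear h hs) rfl
    exact ⟨m, .head h1.step h3, h4⟩

/-! ### Termination of beta-reduction -/

/-- The number of constructors of a term. Variables do not count, so that renaming a variable does
not change the size and a linear substitution adds sizes. -/
def Term.size : Term A → ℕ
  | .var _ _ => 0
  | .lam _ s => 1 + s.size
  | .app s t => 1 + s.size + t.size
  | .tup ts => 1 + ∑ i, (ts i).size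
  | .sub _ s t => 1 + s.size + t.size
  | .op _ ts => 1 + ∑ i, (ts i).size

theorem size_rename (s : Term A) (ρ : ℕ → ℕ) : (s.rename ρ).size = s.size := by
  induction s generalizing ρ with
  | var x a => rfl
  | lam as s ih => simp only [Term.rename, size, ih]
  | app s t ihs iht => simp only [Term.rename, size, ihs, iht]
  | tup ts ih => simp only [Term.rename, size, ih]
  | sub as s t ihs iht => simp only [Term.rename, size, ihs, iht]
  | op f ts ih => simp only [Term.rename, size, ih]

theorem size_subst (s : Term A) (σ : ℕ → A.Ob → Term A) :
    (s.subst σ).size = s.size + ((fv s).map fun p => (σ p.1 p.2).size).sum := by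
  have key {k : ℕ} {s : Term A} {σ : ℕ → A.Ob → Term A}
      (ih : (s.subst (liftSub k σ)).size =
        s.size + ((fv s).map fun p => (liftSub k σ p.1 p.2).size).sum) :
      (s.subst (liftSub k σ)).size =
        s.size + ((down k (fv s)).map fun p => (σ p.1 p.2).size).sum := by
    rw [ih, down, Multiset.map_bind, Multiset.sum_bind]
    congr 3
    funext p
    obtain ⟨x, a⟩ := p
    rcases lt_or_eq_add k x with hk | ⟨y, rfl⟩
    · simp [liftSub_lt, hk, size]
    · simp [liftSub_add, Term.shift, size_rename]
  have sum {m : ℕ} (ts : Fin m → Term A) (g : ℕ × A.Ob → ℕ) :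
      ((∑ i, fv (ts i)).map g).sum = ∑ i, ((fv (ts i)).map g).sum := by
    rw [← Multiset.coe_mapAddMonoidHom, map_sum, ← Multiset.coe_sumAddMonoidHom, map_sum]
  induction s generalizing σ with
  | var x a => simp [Term.subst, size, fv]
  | lam as s ih => simp only [Term.subst, size, fv, key (ih _), add_assoc]
  | app s t ihs iht =>
    simp only [Term.subst, size, fv, ihs, iht, Multiset.map_add, Multiset.sum_add]
    omega
  | tup ts ih => simp only [Term.subst, size, fv, ih, sum, Finset.sum_add_distrib, add_assoc]
  | sub as s t ihs iht =>
    simp only [Term.subst, size, fv, key (ihs _), iht, Multiset.map_add, Multiset.sum_add]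
    omega
  | op f ts ih => simp only [Term.subst, size, fv, ih, sum, Finset.sum_add_distrib, add_assoc]

/-- The substituted variables have exactly one occurrence each. -/
theorem size_inst {k : ℕ} {as : Fin k → A.Ob} {s : Term A} (hl : low k (fv s) = bvs as)
    (ts : Fin k → Term A) (d : ℕ) :
    (s.subst (inst ts d)).size = s.size + ∑ i, (ts i).size := by
  have h1 : ((down k (fv s)).bind fun p => {(p.1 + k, p.2)}).map
      (fun p => (inst ts d p.1 p.2).size) = (down k (fv s)).map fun _ => 0 := by
    rw [Multiset.bind_singleton, Multiset.map_map]
    exact Multiset.map_congr rfl fun p _ => by simp [inst_add, size]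
  have h2 : ((bvs as).map fun p => (inst ts d p.1 p.2).size).sum = ∑ i, (ts i).size := by
    rw [bvs, ← Multiset.coe_mapAddMonoidHom, map_sum, ← Multiset.coe_sumAddMonoidHom, map_sum]
    exact Finset.sum_congr rfl fun i _ => by simp [inst_lt]
  rw [size_subst, eq_shift_add_low k (fv s), hl, Multiset.map_add, Multiset.sum_add, h1, h2]
  simp

theorem Ctx.size_plug (C : Ctx A) : ∃ c, ∀ x : Term A, (C.plug x).size = c + x.size := by
  induction C with
  | hole => exact ⟨0, fun x => (zero_add _).symm⟩
  | tup ts i C ih =>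
    obtain ⟨c, hc⟩ := ih
    exact ⟨1 + c + ∑ j ∈ Finset.univ.erase i, (ts j).size, fun x => by
      simp only [plug, size, sum_update size, hc]; omega⟩
  | subBody as C t ih =>
    obtain ⟨c, hc⟩ := ih
    exact ⟨1 + c + t.size, fun x => by simp only [plug, size, hc]; omega⟩
  | subArg as s C ih =>
    obtain ⟨c, hc⟩ := ih
    exact ⟨1 + s.size + c, fun x => by simp only [plug, size, hc]; omega⟩
  | appFun C t ih =>
    obtain ⟨c, hc⟩ := ih
    exact ⟨1 + c + t.size, fun x => by simp only [plug, size, hc]; omega⟩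
  | appArg s C ih =>
    obtain ⟨c, hc⟩ := ih
    exact ⟨1 + s.size + c, fun x => by simp only [plug, size, hc]; omega⟩
  | lam as C ih =>
    obtain ⟨c, hc⟩ := ih
    exact ⟨1 + c, fun x => by simp only [plug, size, hc]; omega⟩
  | op f ts i C ih =>
    obtain ⟨c, hc⟩ := ih
    exact ⟨1 + c + ∑ j ∈ Finset.univ.erase i, (ts j).size, fun x => by
      simp only [plug, size, sum_update size, hc]; omega⟩

theorem WT.of_plug {C : Ctx A} {x : Term A} {a : A.Ob} (h : WT (C.plug x) a) : ∃ b, WT x b := by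
  induction C generalizing a with
  | hole => exact ⟨a, h⟩
  | tup ts i C ih => cases h with | tup hts => exact ih (wt_update_iff.1 hts).1
  | subBody as C t ih => cases h with | sub h1 h2 h3 => exact ih h1
  | subArg as s C ih => cases h with | sub h1 h2 h3 => exact ih h3
  | appFun C t ih => cases h with | app h1 h2 => exact ih h1
  | appArg s C ih => cases h with | app h1 h2 => exact ih h2
  | lam as C ih => cases h with | lam h1 h2 => exact ih h1
  | op f ts i C ih => cases h with | op _ hts => exact ih (wt_update_iff.1 hts).1

theorem Beta1Root.size_lt {x y : Term A} (h : Beta1Root x y) {a : A.Ob} (hx : WT x a) :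
    y.size < x.size := by
  obtain @⟨k, as, s, L, hL, ts⟩ := h
  cases hx with
  | sub hs hl ht =>
  obtain ⟨c, hc⟩ := L.size_plug
  obtain ⟨b, hb⟩ := ht.of_plug
  simp only [size, hc, size_inst hl]
  omega

theorem Beta2Root.size_lt {x y : Term A} (h : Beta2Root x y) {a : A.Ob} (hx : WT x a) :
    y.size < x.size := by
  obtain ⟨L, k, as, s, t, r, hL, rfl, rfl, h1⟩ := h.factor
  obtain ⟨c, hc⟩ := L.size_plug
  obtain ⟨b, hb⟩ := ((red_lam_app hL as s t).wt hx).1.of_plug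
  have := h1.size_lt hb
  simp only [size, hc, Term.shift, size_rename] at this ⊢
  omega

/-- A `β`-step. -/
def BetaStep (s s' : Term A) : Prop :=
  ∃ (C : Ctx A) (x y : Term A), s = C.plug x ∧ s' = C.plug y ∧ (Beta1Root x y ∨ Beta2Root x y)

namespace BetaStep

theorem step {s s' : Term A} (h : BetaStep s s') : Step s s' := by
  obtain ⟨C, x, y, rfl, rfl, h | h⟩ := h
  · exact .beta1 C h
  · exact .beta2 C h

theorem size_lt {s s' : Term A} (h : BetaStep s s') {a : A.Ob} (hs : WT s a) :
    s'.size < s.size := by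
  obtain ⟨C, x, y, rfl, rfl, h⟩ := h
  obtain ⟨c, hc⟩ := C.size_plug
  obtain ⟨b, hb⟩ := hs.of_plug
  have : y.size < x.size := h.elim (·.size_lt hb) (·.size_lt hb)
  rw [hc, hc]
  omega

theorem long {s s' : Term A} (h : BetaStep s s') {r : Bool} {a : A.Ob} (hs : Long r s a) :
    Long r s' a := by
  obtain ⟨C, x, y, rfl, rfl, h | h⟩ := h
  · exact hs.plug (fun _ _ => .beta1 h) (fun _ => h.red.wt) C
  · exact hs.plug (fun _ _ => .beta2 h) (fun _ => h.red.wt) C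

end BetaStep

theorem LamHead.exists_plug {s : Term A} (h : LamHead s) {k : ℕ} {as : Fin k → A.Ob} {b : A.Ob}
    (hs : WT s (.lolli as b)) :
    ∃ (L : Ctx A) (s' : Term A), L.IsL ∧ s = L.plug (.lam as s') := by
  induction h with
  | lam bs s => cases hs with | lam h1 h2 => exact ⟨.hole, s, trivial, rfl⟩
  | sub bs h t ih =>
    cases hs with
    | sub h1 h2 h3 =>
      obtain ⟨L, s', hL, rfl⟩ := ih h1
      exact ⟨.subBody bs L t, s', hL, rfl⟩

theorem TupHead.exists_plug {s : Term A} (h : TupHead s) {k : ℕ} {as : Fin k → A.Ob}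
    (hs : WT s (.tensor as)) :
    ∃ (L : Ctx A) (ts : Fin k → Term A), L.IsL ∧ s = L.plug (.tup ts) := by
  induction h with
  | tup ts => cases hs with | tup h1 => exact ⟨.hole, ts, trivial, rfl⟩
  | sub bs h t ih =>
    cases hs with
    | sub h1 h2 h3 =>
      obtain ⟨L, s', hL, rfl⟩ := ih h1
      exact ⟨.subBody bs L t, s', hL, rfl⟩

/-- In a long term the argument of an application is of the form `L[⟨t₁, …, tₖ⟩]`, so that redexes
modulo `≡` are redexes. -/
theorem Long.betaNF_or_betaStep {r : Bool} {s : Term A} {a : A.Ob} (h : Long r s a) :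
    BetaNF s ∨ ∃ s', BetaStep s s' := by
  induction h with
  | var x a h => exact .inl trivial
  | @op _ n as b f ts hts h ih =>
    by_cases hn : ∀ i, BetaNF (ts i)
    · exact .inl hn
    · obtain ⟨i, hi⟩ := not_forall.1 hn
      obtain ⟨_, C, x, y, hx, -, h⟩ := (ih i).resolve_left hi
      exact .inr ⟨_, .op f ts i C, x, y, by rw [Ctx.plug, ← hx, Function.update_eq_self], rfl, h⟩
  | @tup _ k as ts hts ih =>
    by_cases hn : ∀ i, BetaNF (ts i)
    · exact .inl hn
    · obtain ⟨i, hi⟩ := not_forall.1 hn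
      obtain ⟨_, C, x, y, hx, -, h⟩ := (ih i).resolve_left hi
      exact .inr ⟨_, .tup ts i C, x, y, by rw [Ctx.plug, ← hx, Function.update_eq_self], rfl, h⟩
  | @lam _ k as b s hs hl ih =>
    rcases ih with ih | ⟨_, C, x, y, rfl, -, h⟩
    · exact .inl ih
    · exact .inr ⟨_, .lam as C, x, y, rfl, rfl, h⟩
  | @app _ k as b s t hs ht h ihs iht =>
    rcases ihs with ihs | ⟨_, C, x, y, rfl, -, h⟩
    · rcases iht with iht | ⟨_, C, x, y, rfl, -, h⟩
      · by_cases hL : LamHead s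
        · obtain ⟨L, s', hL', rfl⟩ := hL.exists_plug hs.wt
          obtain ⟨L', ts, hT, rfl⟩ := ht.tupHead.exists_plug ht.wt
          exact .inr ⟨_, .hole, _, _, rfl, rfl, .inr (.mk as s' L L' hL' hT ts)⟩
        · exact .inl ⟨hL, ihs, iht⟩
      · exact .inr ⟨_, .appArg s C, x, y, rfl, rfl, h⟩
    · exact .inr ⟨_, .appFun C t, x, y, rfl, rfl, h⟩
  | @sub _ k as b s t hs hl ht ihs iht =>
    rcases ihs with ihs | ⟨_, C, x, y, rfl, -, h⟩
    · rcases iht with iht | ⟨_, C, x, y, rfl, -, h⟩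
      · by_cases hT : TupHead t
        · obtain ⟨L, ts, hL, rfl⟩ := hT.exists_plug ht.wt
          exact .inr ⟨_, .hole, _, _, rfl, rfl, .inl (.mk as s L hL ts)⟩
        · exact .inl ⟨hT, ihs, iht⟩
      · exact .inr ⟨_, .subArg as s C, x, y, rfl, rfl, h⟩
    · exact .inr ⟨_, .subBody as C t, x, y, rfl, rfl, h⟩

theorem Long.exists_betaNF {r : Bool} {s : Term A} {a : A.Ob} (h : Long r s a) :
    ∃ s', Relation.ReflTransGen Step s s' ∧ Long r s' a ∧ BetaNF s' := by
  induction hd : s.size using Nat.strong_induction_on generalizing s with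
  | _ d ih =>
  subst hd
  rcases h.betaNF_or_betaStep with h1 | ⟨s', h1⟩
  · exact ⟨s, .refl, h, h1⟩
  · obtain ⟨m, h3, h4⟩ := ih _ (h1.size_lt h.wt) (h1.long h) rfl
    exact ⟨m, .head h1.step h3, h4⟩

/-! ### Normal forms -/

theorem BetaNF.of_plug {C : Ctx A} {x : Term A} (h : BetaNF (C.plug x)) : BetaNF x := by
  induction C with
  | hole => exact h
  | tup ts i C ih => exact ih (betaNF_update.1 h).1
  | subBody as C t ih => exact ih h.2.1
  | subArg as s C ih => exact ih h.2.2
  | appFun C t ih => exact ih h.2.1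
  | appArg s C ih => exact ih h.2.2
  | lam as C ih => exact ih h
  | op f ts i C ih => exact ih (betaNF_update.1 h).1

/-- The holes of the contexts `E` are at positions with flag `true`, except for the holes at the
function of an application, which do not accept terms of a tensor type. -/
theorem Long.of_plug_isE {C : Ctx A} (hC : C.IsE) {r : Bool} {x : Term A} {a : A.Ob}
    (h : Long r (C.plug x) a) (hr : C = .hole → r = true) {k : ℕ} {as : Fin k → A.Ob}
    (hx : WT x (.tensor as)) : Long true x (.tensor as) := by
  have entry {m : ℕ} {bs : Fin m → A.Ob} {ts : Fin m → Term A} {i : Fin m} {s : Term A}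
      (hts : ∀ j, Long true (Function.update ts i s j) (bs j)) : Long true s (bs i) := by
    simpa using hts i
  induction C generalizing r a with
  | hole =>
    obtain rfl := hr rfl
    exact hx.unique h.wt ▸ h
  | tup ts i C ih => cases h with | tup hts => exact ih hC (entry hts) fun _ => rfl
  | subBody bs C t ih => cases h with | sub h1 h2 h3 => exact ih hC h1 fun _ => rfl
  | subArg bs s C ih => cases h with | sub h1 h2 h3 => exact ih hC.2 h3 fun h => absurd h hC.1
  | appFun C t ih =>
    cases h with
    | app h1 h2 h3 =>
      refine ih hC h1 fun h => ?_
      subst h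
      cases hx.unique h1.wt
  | appArg s C ih => cases h with | app h1 h2 h3 => exact ih hC h2 fun _ => rfl
  | lam bs C ih => cases h with | lam h1 h2 => exact ih hC h1 fun _ => rfl
  | op f ts i C ih => cases h with | op _ hts => exact ih hC (entry hts) fun _ => rfl

/-- The holes of the contexts `D` are at positions with flag `true`, except for the holes at the
argument of an explicit substitution, which only accept terms of a tensor type. -/
theorem Long.of_plug_isD {C : Ctx A} (hC : C.IsD) {r : Bool} {x : Term A} {a : A.Ob}
    (h : Long r (C.plug x) a) (hr : C = .hole → r = true) {k : ℕ} {as : Fin k → A.Ob} {b : A.Ob}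
    (hx : WT x (.lolli as b)) : Long true x (.lolli as b) := by
  have entry {m : ℕ} {bs : Fin m → A.Ob} {ts : Fin m → Term A} {i : Fin m} {s : Term A}
      (hts : ∀ j, Long true (Function.update ts i s j) (bs j)) : Long true s (bs i) := by
    simpa using hts i
  induction C generalizing r a with
  | hole =>
    obtain rfl := hr rfl
    exact hx.unique h.wt ▸ h
  | tup ts i C ih => cases h with | tup hts => exact ih hC (entry hts) fun _ => rfl
  | subBody bs C t ih => cases h with | sub h1 h2 h3 => exact ih hC h1 fun _ => rfl
  | subArg bs s C ih =>
    cases h with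
    | sub h1 h2 h3 =>
      refine ih hC h3 fun h => ?_
      subst h
      cases hx.unique h3.wt
  | appFun C t ih => cases h with | app h1 h2 h3 => exact ih hC.2 h1 fun h => absurd h hC.1
  | appArg s C ih => cases h with | app h1 h2 h3 => exact ih hC h2 fun _ => rfl
  | lam bs C ih => cases h with | lam h1 h2 => exact ih hC h1 fun _ => rfl
  | op f ts i C ih => cases h with | op _ hts => exact ih hC (entry hts) fun _ => rfl

/-- The normal forms of `→_aut` are the `η`-long terms without `β`-redexes modulo `≡`. -/
theorem WT.normal_iff {s : Term A} {a : A.Ob} (h : WT s a) (hs : s.Linear) :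
    (∀ s', ¬ Step s s') ↔ Long true s a ∧ BetaNF s := by
  constructor
  · intro hn
    have hl : Long true s a :=
      (h.long_or_etaStep hs true).resolve_right fun ⟨s', h', _⟩ => hn s' h'.step
    exact ⟨hl, hl.betaNF_or_betaStep.resolve_right fun ⟨s', h'⟩ => hn s' h'.step⟩
  · rintro ⟨hl, hb⟩ s' hst
    cases hst with
    | beta1 C h' =>
      obtain ⟨as, s, L, hL, ts⟩ := h'
      exact hb.of_plug.1 (isLT_iff.1 ⟨L, _, ts, hL, rfl⟩)
    | beta2 C h' =>
      obtain ⟨as, s, L, L', hL, hL', ts⟩ := h'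
      exact hb.of_plug.1 (isAT_iff.1 ⟨L, _, as, s, hL, rfl⟩)
    | eta1 E hE h' =>
      obtain ⟨as, s, γ, hγ, hLT⟩ := h'
      exact hLT (isLT_iff.2 (hl.of_plug_isE hE (fun _ => rfl) hγ.wt.1).tupHead)
    | eta2 D hD h' =>
      obtain ⟨as, b, s, γ, hγ, hAT⟩ := h'
      exact hAT (isAT_iff.2 (hl.of_plug_isD hD (fun _ => rfl) hγ.wt.1).lamHead)

theorem IsNormalFormOf.hasType {m s : Term A} (h : IsNormalFormOf m s) {γ : Cxt A} {a : A.Ob}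
    (hs : HasType γ s a) : HasType γ m a := by
  obtain ⟨h, -⟩ := h
  induction h with
  | refl => exact hs
  | tail h h' ih =>
    obtain ⟨h1, h2, h3⟩ := ih.wt
    obtain ⟨h4, h5⟩ := h'.wt h1
    exact h4.hasType (h5.trans h2).symm h3

theorem HasType.exists_normalForm {γ : Cxt A} {s : Term A} {a : A.Ob} (h : HasType γ s a) :
    ∃ m, IsNormalFormOf m s := by
  obtain ⟨hw, hf, hd⟩ := h.wt
  have hs := (distinct_iff hf).1 hd
  obtain ⟨s', h1, h2⟩ := hw.exists_long hs
  obtain ⟨m, h3, h4⟩ := h2.exists_betaNF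
  refine ⟨m, h1.trans h3, ?_⟩
  have hm : Linear m ∧ WT m a := by
    have h5 := h1.trans h3
    clear h3 h4
    induction h5 with
    | refl => exact ⟨hs, hw⟩
    | tail _ h' ih => exact ⟨h'.linear ih.2 ih.1, (h'.wt ih.2).1⟩
  exact (hm.2.normal_iff hm.1).2 h4

/-! ### Morphisms of the free autonomous multicategory -/

section Morphisms

variable {n : ℕ} {γ : Fin n → A.Ob} {a : A.Ob}

/-- A normal form of a term is joinable with the full expansion of the term. -/
theorem IsNormalFormOf.join_el {m s : Term A} (h : IsNormalFormOf m s) {γ : Cxt A} {a : A.Ob}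
    (hs : HasType γ s a) : Join (el s) m ∧ BetaNF m := by
  obtain ⟨hw, hf, hd⟩ := (h.hasType hs).wt
  obtain ⟨hl, hb⟩ := (hw.normal_iff ((distinct_iff hf).1 hd)).1 h.2
  have h1 : Join (el s) (el m) ∧ WT m a := by
    obtain ⟨h, -⟩ := h
    clear hl hb hd hf hw
    induction h with
    | refl => exact ⟨.refl _, hs.wt.1⟩
    | tail h h' ih => exact ⟨ih.1.trans (h'.join_el ih.2) ih.2.el, (h'.wt ih.2).1⟩
  exact ⟨h1.1.trans (hl.join.2 rfl) hw.el, hb⟩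

/-- Terms with the same morphism have joinable full expansions. -/
theorem FreeHom.join_el {s s' : TermsIn A γ a} (h : FreeHom.mk s = FreeHom.mk s') :
    Join (el s.1) (el s'.1) := by
  have h' := Quot.eqvGen_exact h
  clear h
  induction h' with
  | rel s s' h =>
    rcases h with h | h
    · exact .of_seq h.seq.el
    · exact h.join_el s.2.wt.1
  | refl s => exact .refl _
  | symm s s' h ih => exact ih.symm
  | trans s t u h h' ih ih' => exact ih.trans ih' t.2.wt.1.el

theorem FreeHom.mk_eq_of_normalForm {s m : TermsIn A γ a} (h : IsNormalFormOf m.1 s.1) :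
    FreeHom.mk s = FreeHom.mk m := by
  obtain ⟨s, hs⟩ := s
  obtain ⟨m, hm⟩ := m
  obtain ⟨h, -⟩ := h
  simp only at h
  induction h using Relation.ReflTransGen.head_induction_on with
  | refl => rfl
  | head h h' ih =>
    obtain ⟨h1, h2, h3⟩ := hs.wt
    obtain ⟨h4, h5⟩ := h.wt h1
    exact (Quot.sound (.inr h)).trans (ih (h4.hasType (h5.trans h2).symm h3))

theorem FreeHom.mk_eq_iff {s s' : TermsIn A γ a} {m m' : Term A} (h : IsNormalFormOf m s.1)
    (h' : IsNormalFormOf m' s'.1) : FreeHom.mk s = FreeHom.mk s' ↔ StructEq m m' := by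
  constructor
  · intro he
    obtain ⟨h1, h2⟩ := h.join_el s.2
    obtain ⟨h3, h4⟩ := h'.join_el s'.2
    exact ((h1.symm.trans (join_el he) s.2.wt.1.el).trans h3
      s'.2.wt.1.el |>.seq_of_betaNF h2 h4).structEq
  · intro he
    exact (mk_eq_of_normalForm (m := ⟨m, h.hasType s.2⟩) h).trans
      ((Quot.sound (.inl he)).trans (mk_eq_of_normalForm (m := ⟨m', h'.hasType s'.2⟩) h').symm)

end Morphisms

end ResourceCalculus

theorem mainTheorem11 (A : ResourceCalculus.AutSig.{u, v}) {n : ℕ}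
    (γ : Fin n → A.Ob) (a : A.Ob) :
    (∀ s : ResourceCalculus.TermsIn A γ a,
      (∃ m, ResourceCalculus.IsNormalFormOf m s.1) ∧
      (∀ m, ResourceCalculus.IsNormalFormOf m s.1 →
        ResourceCalculus.HasType (ResourceCalculus.Cxt.ofTypes γ) m a) ∧
      (∀ m m', ResourceCalculus.IsNormalFormOf m s.1 → ResourceCalculus.IsNormalFormOf m' s.1 →
        ResourceCalculus.StructEq m m')) ∧
    (∀ s s' : ResourceCalculus.TermsIn A γ a, ∀ m m' : ResourceCalculus.Term A,
      ResourceCalculus.IsNormalFormOf m s.1 → ResourceCalculus.IsNormalFormOf m' s'.1 →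
        (ResourceCalculus.FreeHom.mk s = ResourceCalculus.FreeHom.mk s' ↔
          ResourceCalculus.StructEq m m')) :=
  ⟨fun s => ⟨s.2.exists_normalForm, fun _ h => h.hasType s.2,
    fun _ _ h h' => (ResourceCalculus.FreeHom.mk_eq_iff h h').1 rfl⟩,
    fun _ _ _ _ h h' => ResourceCalculus.FreeHom.mk_eq_iff h h'⟩
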